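/- Work in one of the two categories $C^r$ with $r=\infty$ (smooth) or $r=\omega$ (real analytic); all manifolds, functions, operator fields and coordinate changes are of class $C^r$. An operator field $L$ (a field of endomorphisms of the tangent spaces) is called Nijenhuis if $L^2[\xi,\eta]-L[L\xi,\eta]-L[\xi,L\eta]+[L\xi,L\eta]=0$ for all vector fields $\xi,\eta$. A differential $\mathrm df$ is a conservation law of $L$ if $\mathrm d(L^*\mathrm df)=0$. For operator fields put $\langle L,M\rangle(\xi,\eta)=M[L\xi,\eta]+L[\xi,M\eta]-[L\xi,M\eta]-LM[\xi,\eta]$. An operator field $M$ is a symmetry of $L$ if $LM=ML$ and $\langle L,M\rangle(\xi,\xi)=0$ for all vector fields $\xi$; it is a strong symmetry of $L$ if $LM=ML$ and $\langle M,L\rangle=0$. Theorem. Let $L$ be a Nijenhuis operator on an $n$-dimensional manifold. Assume that at a point $\mathsf p$ its characteristic polynomial $\chi_L(\lambda)=\det(\lambda\,\mathrm{Id}-L(\mathsf p))$ is factorised as $\chi_L=\chi_1\chi_2$, where $\chi_1,\chi_2\in\mathbb R[\lambda]$ are coprime monic polynomials, and put $m_i=\deg\chi_i$. Then there is a coordinate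 system $(u_1,u_2)=(u_1^1,\dots,u_1^{m_1},u_2^1,\dots,u_2^{m_2})$ on a neighbourhood of $\mathsf p$, with image a product $U_1\times U_2$ of connected open sets $U_i\subseteq\mathbb R^{m_i}$, such that: 1. $L(u_1,u_2)=\begin{pmatrix}L_1(u_1)&0\\0&L_2(u_2)\end{pmatrix}$, where $L_i$ is a Nijenhuis operator on $U_i$ and the characteristic polynomial of $L_i$ at $u_i(\mathsf p)$ is $\chi_i$, $i=1,2$. Moreover, for all connected open subsets $V_1\subseteq U_1$, $V_2\subseteq U_2$ (in particular for $V_i=U_i$): 2. Every conservation law $\mathrm df$ of $L$ on $V_1\times V_2$ has the form $\mathrm d\bigl(f_1(u_1)+f_2(u_2)\bigr)$, where $\mathrm df_i$ is a conservation law of $L_i$ on $V_i$, $i=1,2$. 3. Every symmetry $M$ of $L$ on $V_1\times V_2$ has the form $M(u_1,u_2)=\begin{pmatrix}M_1(u_1)&0\\0&M_2(u_2)\end{pmatrix}$, where $M_i$ is a symmetry of $L_i$ on $V_i$, $i=1,2$. 4. Every strong symmetry $M$ of $L$ on $V_1\times V_2$ has the form $M(u_1,u_2)=\begin{pmatrix}M_1(u_1)&0\\0&M_2(u_2)\end{pmatrix}$,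 where $M_i$ is a strong symmetry of $L_i$ on $V_i$, $i=1,2$. -/

import Mathlib

open scoped Manifold ContDiff Topology
open VectorField

noncomputable section

namespace NijenhuisSplitting

variable {E : Type*} [NormedAddCommGroup E] [NormedSpace ℝ E]
  {H : Type*} [TopologicalSpace H] (I : ModelWithCorners ℝ E H)
  {M : Type*} [TopologicalSpace M] [ChartedSpace H M]

/-- A (not necessarily continuous) vector field on `M`. -/
abbrev VField (I : ModelWithCorners ℝ E H) (M : Type*) [TopologicalSpace M] [ChartedSpace H M] :=
  ∀ x : M, TangentSpace I x

/-- A (not necessarily continuous) field of endomorphisms of the tangent spaces of `M`. -/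
abbrev OpField (I : ModelWithCorners ℝ E H) (M : Type*) [TopologicalSpace M] [ChartedSpace H M] :=
  ∀ x : M, TangentSpace I x →L[ℝ] TangentSpace I x

/-- A (not necessarily continuous) differential 1-form on `M`. -/
abbrev OneForm (I : ModelWithCorners ℝ E H) (M : Type*) [TopologicalSpace M] [ChartedSpace H M] :=
  ∀ x : M, TangentSpace I x →L[ℝ] ℝ

/-- The vector field `ξ` is smooth at `x`. -/
def VField.SmoothAt [IsManifold I 1 M] (ξ : VField I M) (x : M) : Prop :=
  ContMDiffAt I (I.prod 𝓘(ℝ, E)) ∞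
    (fun y => (Bundle.TotalSpace.mk' E y (ξ y) : TangentBundle I M)) x

/-- The operator field `L` is of class `C^r` on `W`, as a section of the bundle `End(TM)`. -/
def OpField.ContMDiffOn [IsManifold I 1 M] (r : ℕ∞ω) (L : OpField I M) (W : Set M) : Prop :=
  _root_.ContMDiffOn I (I.prod 𝓘(ℝ, E →L[ℝ] E)) r
    (fun y => Bundle.TotalSpace.mk' (E →L[ℝ] E)
      (E := fun z : M => TangentSpace I z →L[ℝ] TangentSpace I z) y (L y)) W

/-- The vector field `Lξ`. -/
def OpField.app (L : OpField I M) (ξ : VField I M) : VField I M := fun x => L x (ξ x)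

/-- The Nijenhuis torsion
`N_L(ξ, η) = L²[ξ, η] - L[Lξ, η] - L[ξ, Lη] + [Lξ, Lη]`. -/
def torsion (L : OpField I M) (ξ η : VField I M) (x : M) : TangentSpace I x :=
  L x (L x (mlieBracket I ξ η x)) - L x (mlieBracket I (OpField.app I L ξ) η x)
    - L x (mlieBracket I ξ (OpField.app I L η) x)
    + mlieBracket I (OpField.app I L ξ) (OpField.app I L η) x

/-- `⟨L, A⟩(ξ, η) = A[Lξ, η] + L[ξ, Aη] - [Lξ, Aη] - LA[ξ, η]`. -/
def pairing (L A : OpField I M) (ξ η : VField I M) (x : M) : TangentSpace I x :=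
  A x (mlieBracket I (OpField.app I L ξ) η x) + L x (mlieBracket I ξ (OpField.app I A η) x)
    - mlieBracket I (OpField.app I L ξ) (OpField.app I A η) x
    - L x (A x (mlieBracket I ξ η x))

/-- `L` is a Nijenhuis operator of class `C^r` on `W`. The torsion at `x` is evaluated on all
vector fields that are smooth at `x`. -/
structure IsNijenhuisOn [IsManifold I 1 M] (r : ℕ∞ω) (L : OpField I M) (W : Set M) : Prop where
  contMDiffOn : OpField.ContMDiffOn I r L W
  torsion_eq_zero : ∀ x ∈ W, ∀ ξ η : VField I M,
    VField.SmoothAt I ξ x → VField.SmoothAt I η x → torsion I L ξ η x = 0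

/-- `A` is a symmetry of `L` of class `C^r` on `W`. -/
structure IsSymmetryOn [IsManifold I 1 M] (r : ℕ∞ω) (L A : OpField I M) (W : Set M) : Prop where
  contMDiffOn : OpField.ContMDiffOn I r A W
  comm : ∀ x ∈ W, (L x).comp (A x) = (A x).comp (L x)
  pairing_self : ∀ x ∈ W, ∀ ξ : VField I M, VField.SmoothAt I ξ x → pairing I L A ξ ξ x = 0

/-- `A` is a strong symmetry of `L` of class `C^r` on `W`. -/
structure IsStrongSymmetryOn [IsManifold I 1 M] (r : ℕ∞ω) (L A : OpField I M) (W : Set M) :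
    Prop where
  contMDiffOn : OpField.ContMDiffOn I r A W
  comm : ∀ x ∈ W, (A x).comp (L x) = (L x).comp (A x)
  pairing_eq_zero : ∀ x ∈ W, ∀ ξ η : VField I M,
    VField.SmoothAt I ξ x → VField.SmoothAt I η x → pairing I A L ξ η x = 0

/-- The differential `df` of a function. -/
def differential (f : M → ℝ) : OneForm I M := fun x => mfderiv I 𝓘(ℝ, ℝ) f x

/-- The 1-form `L^*θ`, i.e. `(L^*θ)(v) = θ(Lv)`. -/
def OneForm.pull (L : OpField I M) (θ : OneForm I M) : OneForm I M := fun x => (θ x).comp (L x)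

/-- The exterior derivative `dθ(ξ, η) = ξ(θ(η)) - η(θ(ξ)) - θ([ξ, η])` of a
(differentiable) 1-form. -/
def extDerivOneForm (θ : OneForm I M) (ξ η : VField I M) (x : M) : ℝ :=
  differential I (fun y => θ y (η y)) x (ξ x) - differential I (fun y => θ y (ξ y)) x (η x)
    - θ x (mlieBracket I ξ η x)

/-- The (differentiable) 1-form `θ` is closed on `W`. -/
def IsClosedFormOn [IsManifold I 1 M] (θ : OneForm I M) (W : Set M) : Prop :=
  ∀ x ∈ W, ∀ ξ η : VField I M,
    VField.SmoothAt I ξ x → VField.SmoothAt I η x → extDerivOneForm I θ ξ η x = 0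

/-- The (differentiable) 1-form `θ` is a conservation law of `L` on `W`: both `θ` and `L^*θ`
are closed. -/
def IsConservationLawOn [IsManifold I 1 M] (L : OpField I M) (θ : OneForm I M) (W : Set M) :
    Prop :=
  IsClosedFormOn I θ W ∧ IsClosedFormOn I (OneForm.pull I L θ) W

/-- The characteristic polynomial `det(λ Id - L(x))`. -/
def charpolyAt [FiniteDimensional ℝ E] (L : OpField I M) (x : M) : Polynomial ℝ :=
  LinearMap.charpoly (R := ℝ) (M := E) (L x).toLinearMap

variable {E₁ E₂ : Type*} [NormedAddCommGroup E₁] [NormedSpace ℝ E₁]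
  [NormedAddCommGroup E₂] [NormedSpace ℝ E₂]

/-- `e` is a `C^r` local coordinate system on `M` (defined on the open set `e.source`), the
coordinates being divided into two groups `u₁ ∈ E₁` and `u₂ ∈ E₂`. -/
def IsCoordinateSystem (r : ℕ∞ω) (e : OpenPartialHomeomorph M (E₁ × E₂)) : Prop :=
  ContMDiffOn I 𝓘(ℝ, E₁ × E₂) r e e.source ∧ ContMDiffOn 𝓘(ℝ, E₁ × E₂) I r e.symm e.target

/-- The components with respect to the coordinates `e` of a tangent vector at `x`. -/
def components (e : OpenPartialHomeomorph M (E₁ × E₂)) (x : M) :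
    TangentSpace I x →L[ℝ] E₁ × E₂ :=
  mfderiv I 𝓘(ℝ, E₁ × E₂) e x

/-- In the coordinates `e`, on the set `W`, the operator field `A` has the form
`diag(A₁(u₁), A₂(u₂))`. -/
def IsBlockDiagonalOn (e : OpenPartialHomeomorph M (E₁ × E₂)) (A : OpField I M)
    (A₁ : OpField 𝓘(ℝ, E₁) E₁) (A₂ : OpField 𝓘(ℝ, E₂) E₂) (W : Set M) : Prop :=
  ∀ x ∈ W, ∀ v : TangentSpace I x,
    components I e x (A x v) =
      (A₁ (e x).1 (components I e x v).1, A₂ (e x).2 (components I e x v).2)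

end NijenhuisSplitting

end

/-! Everything rests on one linear fact. If `α` and `δ` are annihilated by coprime polynomials, then
`δ R = R α` forces `R = 0`, by Bézout (`noIntertwiner_of_isCoprime`). Equivalently, the Sylvester
operator `R ↦ δ R - R α` is invertible, which is an open condition on `(α, δ)`. The primary
decomposition of `L(p)` provides such a pair, and the equation `δ R = R α` then appears at every
stage.

Existence of the coordinates. An `L`-invariant distribution near `E₁ × 0` is the graph of a field `X
: E₁ → E₂`, and invariance is an equation for `X` whose linearisation at the base point is the
Sylvester operator; the implicit function theorem solves it (`exists_invariant_graph`). Vanishing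
torsion says that the curvature `S` of the distribution satisfies `δδS(k,k') - δS(αk,k') - δS(k,αk')
+ S(αk,αk') = 0`. The left side is the composite of two Sylvester operators, one in each argument,
so `S = 0` (`graph_integrable`). The Frobenius theorem yields a submersion whose fibres are the
leaves; exchanging the factors gives a second one, and together they are coordinates in which `L` is
block diagonal (`exists_straightening`).

Consequences. On mixed arguments `(x,0)`, `(0,y)`, vanishing torsion says that the derivative of one
block in the direction of the other factor intertwines the blocks, hence is zero; over a product of
connected sets each block therefore depends on its own variables only. A symmetry commutes with `L`,
so its off-diagonal blocks are intertwiners and vanish, and the polarised symmetry condition treats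
the derivatives of its diagonal blocks in the same way. A strong symmetry is in particular a
symmetry. For a conservation law `df`, the mixed second derivative of `f` intertwines the first
block with the transpose of the second, so it vanishes and `df` separates (`mixed_fderiv_eq_zero`).

The Frobenius theorem is proved for `r = ∞` and `r = ω` at once. Along rays the system becomes an
integral equation in the Banach space `C([0,1], E₂)`, solved by the implicit function theorem once
the superposition operator `u ↦ φ ∘ u` is known to be of class `C^r`. Integrability then turns the
radial solution into a solution in all directions, through a linear homogeneous ODE and Gronwall. -/

open scoped Manifold ContDiff Topology
open VectorField

noncomputable section

namespace NijenhuisSplitting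

open Filter

/-! ### Inverse and implicit function theorems of class `C^r` on a neighbourhood. -/

section InverseFunction

variable {E F : Type*} [NormedAddCommGroup E] [NormedSpace ℝ E] [CompleteSpace E]
  [NormedAddCommGroup F] [NormedSpace ℝ F]

/-- The inverse function theorem, in the form that provides a `C^r` local diffeomorphism. -/
theorem exists_openPartialHomeomorph_contDiffAt {f : E → F} {a : E} {r : ℕ∞ω} (hr : r ≠ 0)
    (hf : ∀ᶠ x in 𝓝 a, ContDiffAt ℝ r f x) (f' : E ≃L[ℝ] F)
    (hf' : HasFDerivAt f (f' : E →L[ℝ] F) a) :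
    ∃ e : OpenPartialHomeomorph E F, a ∈ e.source ∧ (e : E → F) = f ∧
      (∀ x ∈ e.source, ContDiffAt ℝ r f x) ∧ ∀ y ∈ e.target, ContDiffAt ℝ r e.symm y := by
  have ha : ContDiffAt ℝ r f a := hf.self_of_nhds
  -- Invertible operators form an open set. Shrinking the source to where the derivative is
  -- invertible makes the inverse `C^r` at every point of the target, not only at the image of `a`.
  have hinv : ∀ᶠ x in 𝓝 a, ∃ g : E ≃L[ℝ] F, (g : E →L[ℝ] F) = fderiv ℝ f x := by
    have h1 : (1 : ℕ∞ω) ≤ r := ENat.one_le_iff_ne_zero_withTop.mpr hr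
    have hc : ContinuousAt (fderiv ℝ f) a :=
      (ha.fderiv_right (m := 0) (by simpa using h1)).continuousAt
    have : Set.range ((↑) : (E ≃L[ℝ] F) → E →L[ℝ] F) ∈ 𝓝 (fderiv ℝ f a) := by
      rw [hf'.fderiv]; exact ContinuousLinearEquiv.nhds f'
    exact hc this
  obtain ⟨s, hs, hso, has⟩ := mem_nhds_iff.1 (hf.and hinv)
  let e := (ha.toOpenPartialHomeomorph f hf' hr).restrOpen s hso
  refine ⟨e, ⟨ha.mem_toOpenPartialHomeomorph_source hf' hr, has⟩, rfl,
    fun x hx => (hs hx.2).1, fun y hy => ?_⟩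
  have hy' := e.map_target hy
  obtain ⟨h1, g, hg⟩ := hs hy'.2
  refine e.contDiffAt_symm (f₀' := g) hy ?_ h1
  rw [hg]
  exact (h1.differentiableAt hr).hasFDerivAt

variable {Z B C : Type*} [NormedAddCommGroup Z] [NormedSpace ℝ Z] [CompleteSpace Z]
  [NormedAddCommGroup B] [NormedSpace ℝ B] [CompleteSpace B]
  [NormedAddCommGroup C] [NormedSpace ℝ C]

/-- The implicit function theorem, with an implicit function that is `C^r` on a neighbourhood. -/
theorem exists_implicit_contDiffAt {f : Z × B → C} {z₀ : Z} {b₀ : B} {r : ℕ∞ω} (hr : r ≠ 0)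
    (hf : ∀ᶠ x in 𝓝 (z₀, b₀), ContDiffAt ℝ r f x) (h0 : f (z₀, b₀) = 0)
    {f' : Z × B →L[ℝ] C} (hf' : HasFDerivAt f f' (z₀, b₀))
    (Q : B ≃L[ℝ] C) (hQ : ∀ b, f' (0, b) = Q b) :
    ∃ g : Z → B, (∀ᶠ z in 𝓝 z₀, ContDiffAt ℝ r g z) ∧ g z₀ = b₀ ∧ ∀ᶠ z in 𝓝 z₀, f (z, g z) = 0 := by
  have hsplit : ∀ z b, f' (z, b) = f' (z, 0) + Q b := fun z b => by
    rw [← hQ, ← map_add]; simp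
  -- The derivative of `(z, b) ↦ (z, f(z, b))` is block triangular with diagonal entries `id` and
  -- `Q`, so its inverse can be written explicitly.
  let T : (Z × B) ≃L[ℝ] Z × C := ContinuousLinearEquiv.equivOfInverse
    ((ContinuousLinearMap.fst ℝ Z B).prod f')
    ((ContinuousLinearMap.fst ℝ Z C).prod ((Q.symm : C →L[ℝ] B).comp
      (ContinuousLinearMap.snd ℝ Z C - f'.comp ((ContinuousLinearMap.inl ℝ Z B).comp
        (ContinuousLinearMap.fst ℝ Z C)))))
    (fun ⟨z, b⟩ => by simp [hsplit z b]) (fun ⟨z, c⟩ => by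
      simp only [ContinuousLinearMap.prod_apply, ContinuousLinearMap.coe_fst', Prod.mk.injEq, true_and]
      rw [hsplit]; simp)
  obtain ⟨e, he, hef, -, hsymm⟩ := exists_openPartialHomeomorph_contDiffAt
    (f := fun x : Z × B => (x.1, f x)) (a := (z₀, b₀)) hr
    (hf.mono fun x hx => contDiffAt_fst.prodMk hx) T (hasFDerivAt_fst.prodMk hf')
  have hval : e (z₀, b₀) = (z₀, 0) := by rw [hef]; simp [h0]
  have hlim : ∀ᶠ z in 𝓝 z₀, (z, (0 : C)) ∈ e.target := by
    have hc : ContinuousAt (fun z : Z => (z, (0 : C))) z₀ := by fun_prop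
    refine hc.preimage_mem_nhds (e.open_target.mem_nhds ?_)
    rw [← hval]; exact e.map_source he
  refine ⟨fun z => (e.symm (z, 0)).2, ?_, ?_, ?_⟩
  · filter_upwards [hlim] with z hz
    exact contDiffAt_snd.comp z ((hsymm _ hz).comp z (contDiffAt_id.prodMk contDiffAt_const))
  · simp only
    rw [← hval, e.left_inv he]
  · filter_upwards [hlim] with z hz
    have h := e.right_inv hz
    rw [hef, Prod.ext_iff] at h
    have h1 : (z, (e.symm (z, 0)).2) = e.symm (z, 0) := Prod.ext h.1.symm rfl
    rw [h1]; exact h.2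

end InverseFunction

/-! ### Regularity of superposition operators on spaces of continuous curves. -/

section Superposition

universe u
variable {K : Type*} [TopologicalSpace K] [CompactSpace K]
  {G F : Type u} [NormedAddCommGroup G] [NormedSpace ℝ G] [NormedAddCommGroup F] [NormedSpace ℝ F]

/-- Pointwise application of a continuous family of operators. -/
def pointwiseApply : C(K, G →L[ℝ] F) →L[ℝ] C(K, G) →L[ℝ] C(K, F) :=
  LinearMap.mkContinuous₂
    (LinearMap.mk₂ ℝ (fun (T : C(K, G →L[ℝ] F)) (v : C(K, G)) => (⟨fun s => T s (v s), by fun_prop⟩ : C(K, F)))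
      (fun _ _ _ => by ext; simp) (fun _ _ _ => by ext; simp) (fun _ _ _ => by ext; simp)
      (fun _ _ _ => by ext; simp)) 1
    (fun T v => by
      rw [one_mul, ContinuousMap.norm_le _ (by positivity)]
      intro s
      exact ((T s).le_opNorm _).trans (mul_le_mul (T.norm_coe_le_norm s) (v.norm_coe_le_norm s)
        (by positivity) (by positivity)))

@[simp] theorem pointwiseApply_apply (T : C(K, G →L[ℝ] F)) (v : C(K, G)) (s : K) :
    pointwiseApply T v s = T s (v s) := rfl

/-- The superposition operator `u ↦ φ ∘ u`. -/
def superposition (K : Type*) {G F : Type*} [TopologicalSpace K] [NormedAddCommGroup G]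
    [NormedAddCommGroup F] (φ : G → F) (hφ : Continuous φ) :
    C(K, G) → C(K, F) := fun u => (⟨φ, hφ⟩ : C(G, F)).comp u

theorem continuous_superposition {K G F : Type*} [TopologicalSpace K] [NormedAddCommGroup G]
    [NormedAddCommGroup F] (φ : G → F) (hφ : Continuous φ) :
    Continuous (superposition K φ hφ) :=
  ContinuousMap.continuous_postcomp _

/-- Pointwise differentiability must be made uniform in `s`. Continuity of `u ↦ φ' ∘ u` in the sup
norm bounds `φ' - φ'(u s)` along each segment from `u s` to `u s + v s` by the same `ε`, and the
mean value inequality does the rest. -/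
theorem hasFDerivAt_superposition {φ : G → F} (hφ : ContDiff ℝ 1 φ) (u : C(K, G)) :
    HasFDerivAt (superposition K φ hφ.continuous)
      (pointwiseApply (superposition K (fderiv ℝ φ) (hφ.continuous_fderiv one_ne_zero) u)) u := by
  have hc := (continuous_superposition (K := K) (fderiv ℝ φ)
    (hφ.continuous_fderiv one_ne_zero)).continuousAt (x := u)
  rw [hasFDerivAt_iff_isLittleO_nhds_zero, Asymptotics.isLittleO_iff]
  intro ε hε
  obtain ⟨δ, hδ, hball⟩ := Metric.continuousAt_iff.1 hc ε hε
  filter_upwards [Metric.ball_mem_nhds 0 hδ] with v hv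
  rw [mem_ball_zero_iff] at hv
  rw [ContinuousMap.norm_le _ (by positivity)]
  intro s
  have hseg : ∀ y ∈ segment ℝ (u s) (u s + v s), ‖fderiv ℝ φ y - fderiv ℝ φ (u s)‖ ≤ ε := by
    intro y hy
    rw [segment_eq_image'] at hy
    obtain ⟨t, ht, rfl⟩ := hy
    have h1 : dist (u + t • v) u < δ := by
      rw [dist_eq_norm]
      simp only [add_sub_cancel_left, norm_smul, Real.norm_of_nonneg ht.1]
      nlinarith [norm_nonneg v, ht.2]
    have h2 := (ContinuousMap.dist_apply_le_dist s).trans_lt (hball h1)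
    rw [dist_eq_norm] at h2
    simpa [superposition] using h2.le
  have := (convex_segment (u s) (u s + v s)).norm_image_sub_le_of_norm_hasFDerivWithin_le'
    (f := φ) (f' := fderiv ℝ φ) (φ := fderiv ℝ φ (u s)) (C := ε)
    (fun y _ => ((hφ.differentiable one_ne_zero) y).hasFDerivAt.hasFDerivWithinAt) hseg
    (left_mem_segment ℝ _ _) (right_mem_segment ℝ _ _)
  simp only [add_sub_cancel_left] at this
  refine le_trans (le_of_eq ?_) (this.trans (by gcongr; exact v.norm_coe_le_norm s))
  simp [superposition]

/-- The derivative is again a superposition operator, that of `fderiv ℝ φ`, followed by a continuous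
linear map. The target `F` is generalised in the induction since it becomes `G →L[ℝ] F`; this is why
both spaces share a universe. -/
theorem contDiff_superposition (n : ℕ) : ∀ {F : Type u} [NormedAddCommGroup F] [NormedSpace ℝ F]
    {φ : G → F} (hφ : ContDiff ℝ n φ), ContDiff ℝ n (superposition K φ hφ.continuous) := by
  induction n with
  | zero => intro F _ _ φ hφ; exact contDiff_zero.2 (continuous_superposition φ hφ.continuous)
  | succ n ih =>
    intro F _ _ φ hφ
    have h1 : ContDiff ℝ 1 φ := hφ.of_le (by norm_cast; omega)
    have h2 : ContDiff ℝ n (fderiv ℝ φ) := hφ.fderiv_right (by norm_cast)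
    have h3 : ContDiff ℝ n (pointwiseApply (K := K) (G := G) (F := F)) :=
      ContinuousLinearMap.contDiff _
    exact contDiff_succ_iff_hasFDerivAt.2
      ⟨fun u => pointwiseApply (superposition K (fderiv ℝ φ) h2.continuous u),
        h3.comp (ih h2), fun u => hasFDerivAt_superposition h1 u⟩

/-- The multilinear maps induced pointwise by a formal multilinear series. -/
def pointwiseSeries (K : Type*) [TopologicalSpace K] [CompactSpace K]
    (p : FormalMultilinearSeries ℝ G F) : FormalMultilinearSeries ℝ C(K, G) C(K, F) := fun n =>
  MultilinearMap.mkContinuous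
    { toFun := fun m => ⟨fun s => p n (fun i => m i s), by fun_prop⟩
      map_update_add' := fun m i x y => by
        ext s
        have h : ∀ z : C(K, G), (fun j => Function.update m i z j s)
            = Function.update (fun j => m j s) i (z s) := fun z => by
          ext j; by_cases hj : j = i
          · subst hj; simp
          · simp [hj]
        simp [h]
      map_update_smul' := fun m i c x => by
        ext s
        have h : ∀ z : C(K, G), (fun j => Function.update m i z j s)
            = Function.update (fun j => m j s) i (z s) := fun z => by
          ext j; by_cases hj : j = i
          · subst hj; simp
          · simp [hj]
        simp [h] } ‖p n‖ (fun m => by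
      rw [ContinuousMap.norm_le _ (by positivity)]
      intro s
      refine ((p n).le_opNorm _).trans ?_
      gcongr with i
      exact (m i).norm_coe_le_norm s)

theorem norm_pointwiseSeries_le (p : FormalMultilinearSeries ℝ G F) (n : ℕ) :
    ‖pointwiseSeries K p n‖ ≤ ‖p n‖ := MultilinearMap.mkContinuous_norm_le _ (norm_nonneg _) _

theorem radius_le_pointwiseSeries (p : FormalMultilinearSeries ℝ G F) :
    p.radius ≤ (pointwiseSeries K p).radius := by
  refine ENNReal.le_of_forall_nnreal_lt fun r hr => ?_
  refine FormalMultilinearSeries.le_radius_of_summable_norm _ ?_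
  refine Summable.of_nonneg_of_le (fun n => by positivity) (fun n => ?_)
    (p.summable_norm_mul_pow hr)
  gcongr
  exact norm_pointwiseSeries_le p n

/-- A power series of `φ` acts on curves term by term without increasing norms, so it still
converges on a ball of `C(K, G)`. Evaluation at `s` is continuous and linear, hence commutes with
the sum and recovers `φ (u s)`. -/
theorem exists_superposition_analyticAt [CompleteSpace F] {φ : G → F} (hφ : AnalyticAt ℝ φ 0) :
    ∃ N : C(K, G) → C(K, F), AnalyticAt ℝ N 0 ∧
      ∀ᶠ u in 𝓝 (0 : C(K, G)), ∀ s, N u s = φ (u s) := by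
  obtain ⟨p, R, hp⟩ := hφ
  have hrad : 0 < (pointwiseSeries K p).radius :=
    (hp.r_pos.trans_le hp.r_le).trans_le (radius_le_pointwiseSeries p)
  have hN := (pointwiseSeries K p).hasFPowerSeriesOnBall hrad
  refine ⟨(pointwiseSeries K p).sum, ⟨_, _, hN⟩, ?_⟩
  have hR : ∀ᶠ u in 𝓝 (0 : C(K, G)), u ∈ Metric.eball (0 : C(K, G)) R :=
    Metric.eball_mem_nhds _ hp.r_pos
  filter_upwards [hR] with u hu s
  have hus : u s ∈ Metric.eball (0 : G) R := by
    rw [Metric.mem_eball, edist_eq_enorm_sub, sub_zero, ← ofReal_norm] at hu ⊢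
    exact (ENNReal.ofReal_le_ofReal (u.norm_coe_le_norm s)).trans_lt hu
  have h1 := hp.hasSum hus
  have h2 := hN.hasSum (y := u) (Metric.eball_subset_eball (hp.r_le.trans (radius_le_pointwiseSeries p)) hu)
  have h3 := h2.map (ContinuousMap.evalCLM ℝ s : C(K, F) →L[ℝ] F)
    (ContinuousMap.evalCLM ℝ s : C(K, F) →L[ℝ] F).continuous
  simp only [zero_add] at h1 h3
  exact h3.unique h1

/-- The superposition operator of a `C^r` germ is of class `C^r`, `r = ∞` or `r = ω`. -/
theorem exists_superposition_contDiffAt [FiniteDimensional ℝ G] [CompleteSpace F]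
    {r : ℕ∞ω} (hr : r = ∞ ∨ r = ω)
    {φ : G → F} (hφ : ∀ᶠ x in 𝓝 0, ContDiffAt ℝ r φ x) :
    ∃ N : C(K, G) → C(K, F), (∀ᶠ u in 𝓝 0, ContDiffAt ℝ r N u) ∧
      ∀ᶠ u in 𝓝 (0 : C(K, G)), ∀ s, N u s = φ (u s) := by
  rcases hr with rfl | rfl
  -- For `r = ∞` a bump function makes the germ global without changing it near `0`. A cutoff would
  -- destroy analyticity, so `r = ω` goes through the power series instead.
  · obtain ⟨ρ, hρ, hball⟩ := Metric.eventually_nhds_iff_ball.1 hφ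
    let b : ContDiffBump (0 : G) := ⟨ρ / 3, ρ / 2, by positivity, by linarith⟩
    have hψ : ContDiff ℝ ∞ (fun x => b x • φ x) := by
      rw [contDiff_iff_contDiffAt]
      intro x
      by_cases hx : x ∈ Metric.ball (0 : G) ρ
      · exact b.contDiff.contDiffAt.smul (hball x hx)
      · have : (fun x => b x • φ x) =ᶠ[𝓝 x] fun _ => 0 := by
          have hx' : x ∈ (Metric.closedBall (0 : G) (ρ / 2))ᶜ := fun h =>
            hx (Metric.closedBall_subset_ball (by linarith) h)
          filter_upwards [Metric.isClosed_closedBall.isOpen_compl.mem_nhds hx'] with y hy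
          rw [b.zero_of_le_dist, zero_smul]
          simp only [Set.mem_compl_iff, Metric.mem_closedBall, not_le] at hy
          exact hy.le
        exact contDiffAt_const.congr_of_eventuallyEq this
    refine ⟨superposition K _ hψ.continuous, Eventually.of_forall fun u => ?_, ?_⟩
    · exact (contDiff_infty.2 fun n =>
        contDiff_superposition n (hψ.of_le (by exact_mod_cast le_top))).contDiffAt
    · filter_upwards [Metric.ball_mem_nhds (0 : C(K, G)) (ε := ρ / 3) (by positivity)] with u hu s
      have : u s ∈ Metric.closedBall (0 : G) b.rIn := by
        rw [mem_ball_zero_iff] at hu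
        rw [mem_closedBall_zero_iff]
        exact (u.norm_coe_le_norm s).trans hu.le
      simp [superposition, b.one_of_mem_closedBall this]
  · obtain ⟨N, hN, h⟩ := exists_superposition_analyticAt (K := K) hφ.self_of_nhds.analyticAt
    exact ⟨N, hN.eventually_analyticAt.mono fun u hu => hu.contDiffAt, h⟩

end Superposition

/-! ### The Frobenius theorem through the radial equation. -/

section Frobenius

universe u

section
variable {F : Type*} [NormedAddCommGroup F] [NormedSpace ℝ F]

/-- The primitive vanishing at `0` of a continuous curve on the unit interval. -/
def primitive : C(unitInterval, F) →L[ℝ] C(unitInterval, F) :=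
  LinearMap.mkContinuous
    { toFun := fun T => ⟨fun t => ∫ s in (0 : ℝ)..t, T (Set.projIcc 0 1 zero_le_one s), by
        have hT : Continuous fun s => T (Set.projIcc 0 1 zero_le_one s) :=
          T.continuous.comp continuous_projIcc
        exact (intervalIntegral.continuous_primitive
          (fun a b => hT.intervalIntegrable a b) 0).comp continuous_subtype_val⟩
      map_add' := fun S T => by
        ext t
        exact intervalIntegral.integral_add
          ((S.continuous.comp continuous_projIcc).intervalIntegrable _ _)
          ((T.continuous.comp continuous_projIcc).intervalIntegrable _ _)
      map_smul' := fun c T => by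
        ext t
        exact intervalIntegral.integral_smul c _ } 1
    (fun T => by
      rw [one_mul, ContinuousMap.norm_le _ (norm_nonneg T)]
      intro t
      have h := intervalIntegral.norm_integral_le_of_norm_le_const (a := (0 : ℝ)) (b := t)
        (f := fun s => T (Set.projIcc 0 1 zero_le_one s)) (C := ‖T‖)
        (fun s _ => T.norm_coe_le_norm _)
      refine h.trans ?_
      rw [sub_zero, abs_of_nonneg t.2.1]
      exact mul_le_of_le_one_right (norm_nonneg T) t.2.2)

theorem primitive_apply (T : C(unitInterval, F)) (t : unitInterval) :
    primitive T t = ∫ s in (0 : ℝ)..t, T (Set.projIcc 0 1 zero_le_one s) := rfl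

theorem eventually_forall_apply {F : Type*} [NormedAddCommGroup F] {K : Type*} [TopologicalSpace K] [CompactSpace K]
    {P : F → Prop} (hP : ∀ᶠ q in 𝓝 0, P q) : ∀ᶠ u in 𝓝 (0 : C(K, F)), ∀ s, P (u s) := by
  obtain ⟨ρ, hρ, hball⟩ := Metric.eventually_nhds_iff_ball.1 hP
  filter_upwards [Metric.ball_mem_nhds (0 : C(K, F)) hρ] with u hu s
  rw [mem_ball_zero_iff] at hu
  exact hball _ (mem_ball_zero_iff.2 ((u.norm_coe_le_norm s).trans_lt hu))

/-- `N` is known only through its values `N u s = φ (u s)` near `u`. Differentiating after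
evaluation at `s` still determines its derivative pointwise. -/
theorem fderiv_apply_of_eventually_superposition {K : Type*} [TopologicalSpace K] [CompactSpace K]
    {G : Type*} [NormedAddCommGroup G] [NormedSpace ℝ G]
    {φ : G → F} {N : C(K, G) → C(K, F)} {u : C(K, G)}
    (hN : DifferentiableAt ℝ N u) (hNφ : ∀ᶠ u' in 𝓝 u, ∀ s, N u' s = φ (u' s)) (s : K)
    (hφ : DifferentiableAt ℝ φ (u s)) (v : C(K, G)) :
    fderiv ℝ N u v s = fderiv ℝ φ (u s) (v s) := by
  have h1 : HasFDerivAt (fun u' => N u' s)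
      ((ContinuousMap.evalCLM ℝ s : C(K, F) →L[ℝ] F).comp (fderiv ℝ N u)) u :=
    (ContinuousMap.evalCLM ℝ s : C(K, F) →L[ℝ] F).hasFDerivAt.comp u hN.hasFDerivAt
  have h2 : HasFDerivAt (fun u' : C(K, G) => φ (u' s))
      ((fderiv ℝ φ (u s)).comp (ContinuousMap.evalCLM ℝ s : C(K, G) →L[ℝ] G)) u :=
    HasFDerivAt.comp u (g := φ) hφ.hasFDerivAt
      (ContinuousMap.evalCLM ℝ s : C(K, G) →L[ℝ] G).hasFDerivAt
  have h3 := h1.unique (h2.congr_of_eventuallyEq (hNφ.mono fun u' hu' => hu' s))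
  exact congrArg (fun T : C(K, G) →L[ℝ] F => T v) h3

end

variable {E₁ E₂ : Type u} [NormedAddCommGroup E₁] [NormedSpace ℝ E₁]
  [NormedAddCommGroup E₂] [NormedSpace ℝ E₂]

/-- The curve `s ↦ (s x, x, g s)`. -/
def radialCurve (E₁ E₂ : Type u) [NormedAddCommGroup E₁] [NormedSpace ℝ E₁]
    [NormedAddCommGroup E₂] [NormedSpace ℝ E₂] :
    (E₁ × E₂) × C(unitInterval, E₂) →L[ℝ] C(unitInterval, E₁ × E₁ × E₂) :=
  LinearMap.mkContinuous
    { toFun := fun q => ⟨fun s => ((s : ℝ) • q.1.1, q.1.1, q.2 s), by fun_prop⟩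
      map_add' := fun _ _ => by ext s <;> simp
      map_smul' := fun c q => by ext s <;> simp [smul_comm c] } 1
    (fun q => by
      rw [one_mul, ContinuousMap.norm_le _ (norm_nonneg q)]
      intro s
      have h1 : ‖q.1.1‖ ≤ ‖q‖ := (norm_fst_le q.1).trans (norm_fst_le q)
      have h2 : ‖q.2 s‖ ≤ ‖q‖ := (q.2.norm_coe_le_norm s).trans (norm_snd_le q)
      refine norm_prod_le_iff.2 ⟨?_, norm_prod_le_iff.2 ⟨h1, h2⟩⟩
      change ‖(s : ℝ) • q.1.1‖ ≤ ‖q‖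
      rw [norm_smul, Real.norm_of_nonneg s.2.1]
      exact (mul_le_of_le_one_left (norm_nonneg _) s.2.2).trans h1)

theorem radialCurve_apply (q : (E₁ × E₂) × C(unitInterval, E₂)) (s : unitInterval) :
    radialCurve E₁ E₂ q s = ((s : ℝ) • q.1.1, q.1.1, q.2 s) := rfl

/-- The right hand side of the radial equation `g'(s) = X(s x, g(s)) x`. -/
def radialRhs (X : E₁ × E₂ → E₁ →L[ℝ] E₂) (q : E₁ × E₁ × E₂) : E₂ := X (q.1, q.2.2) q.2.1

theorem hasFDerivAt_radialRhs {X : E₁ × E₂ → E₁ →L[ℝ] E₂} {q : E₁ × E₁ × E₂}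
    (hX : DifferentiableAt ℝ X (q.1, q.2.2)) :
    DifferentiableAt ℝ (radialRhs X) q ∧ ∀ v : E₁ × E₁ × E₂, fderiv ℝ (radialRhs X) q v =
      fderiv ℝ X (q.1, q.2.2) (v.1, v.2.2) q.2.1 + X (q.1, q.2.2) v.2.1 := by
  let p : E₁ × E₁ × E₂ →L[ℝ] E₁ × E₂ := (ContinuousLinearMap.fst ℝ _ _).prod
    ((ContinuousLinearMap.snd ℝ _ _).comp (ContinuousLinearMap.snd ℝ _ _))
  let p' : E₁ × E₁ × E₂ →L[ℝ] E₁ := (ContinuousLinearMap.fst ℝ _ _).comp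
    (ContinuousLinearMap.snd ℝ _ _)
  have h1 : HasFDerivAt (fun q => X (p q)) ((fderiv ℝ X (q.1, q.2.2)).comp p) q :=
    HasFDerivAt.comp q (g := X) (f := p) hX.hasFDerivAt p.hasFDerivAt
  have h2 := h1.clm_apply p'.hasFDerivAt
  have h3 : HasFDerivAt (radialRhs X) _ q := h2
  refine ⟨h3.differentiableAt, fun v => ?_⟩
  rw [h3.fderiv]
  simp [p, p', add_comm]

variable [FiniteDimensional ℝ E₁] [FiniteDimensional ℝ E₂]

/-- The equation `g(t) = y + ∫₀ᵗ X(s x, g(s)) x ds` is solved for the whole curve `g` as a function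
of `z = (x, y)`. Since `X 0 = 0`, the right hand side `X(·, ·) x` vanishes to second order at the
origin, so the linearisation in `g` is the identity and the implicit function theorem applies. -/
theorem exists_radial_solution {r : ℕ∞ω} (hr : r = ∞ ∨ r = ω) {X : E₁ × E₂ → E₁ →L[ℝ] E₂}
    (hX : ∀ᶠ q in 𝓝 0, ContDiffAt ℝ r X q) (hX0 : X 0 = 0) :
    ∃ (N : C(unitInterval, E₁ × E₁ × E₂) → C(unitInterval, E₂))
      (g : E₁ × E₂ → C(unitInterval, E₂)),
      (∀ᶠ u in 𝓝 0, DifferentiableAt ℝ N u) ∧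
      (∀ᶠ u in 𝓝 0, ∀ s, N u s = radialRhs X (u s)) ∧
      (∀ᶠ z in 𝓝 0, ContDiffAt ℝ r g z) ∧ g 0 = 0 ∧
      ∀ᶠ z in 𝓝 0, g z = ContinuousMap.const _ z.2 + primitive (N (radialCurve E₁ E₂ (z, g z))) := by
  have hr0 : r ≠ 0 := by rcases hr with rfl | rfl <;> simp
  have hφ : ∀ᶠ q in 𝓝 (0 : E₁ × E₁ × E₂), ContDiffAt ℝ r (radialRhs X) q := by
    have hc : Tendsto (fun q : E₁ × E₁ × E₂ => (q.1, q.2.2)) (𝓝 0) (𝓝 0) := by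
      have : ContinuousAt (fun q : E₁ × E₁ × E₂ => (q.1, q.2.2)) 0 := by fun_prop
      exact this
    filter_upwards [hc.eventually hX] with q hq
    exact (ContDiffAt.comp q (g := X) hq (by fun_prop)).clm_apply (by fun_prop)
  obtain ⟨N, hN, hNφ⟩ := exists_superposition_contDiffAt (K := unitInterval) hr hφ
  have hφ0 : radialRhs X 0 = 0 := by simp [radialRhs]
  have hN0 : N 0 = 0 := by
    ext s; rw [hNφ.self_of_nhds s]; simp [hφ0]
  have hdN0 : fderiv ℝ N 0 = 0 := by
    ext v s
    have hX0' : DifferentiableAt ℝ X ((0 : E₁ × E₁ × E₂).1, (0 : E₁ × E₁ × E₂).2.2) :=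
      hX.self_of_nhds.differentiableAt hr0
    have h := hasFDerivAt_radialRhs hX0'
    rw [fderiv_apply_of_eventually_superposition (hN.self_of_nhds.differentiableAt hr0) hNφ s h.1,
      ContinuousMap.zero_apply, h.2]
    simp [← Prod.zero_eq_mk, hX0]
  let cst : E₂ →L[ℝ] C(unitInterval, E₂) := ContinuousLinearMap.const ℝ unitInterval
  let R := radialCurve E₁ E₂
  let f : (E₁ × E₂) × C(unitInterval, E₂) → C(unitInterval, E₂) := fun q =>
    q.2 - cst q.1.2 - primitive (N (R q))
  have hR : Tendsto R (𝓝 0) (𝓝 0) := by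
    simpa using R.continuous.tendsto 0
  have hprim : ContDiff ℝ r (primitive (F := E₂)) := ContinuousLinearMap.contDiff _
  have hf : ∀ᶠ q in 𝓝 ((0 : E₁ × E₂), (0 : C(unitInterval, E₂))), ContDiffAt ℝ r f q := by
    filter_upwards [hR.eventually hN] with q hq
    have h1 : ContDiffAt ℝ r (fun q => primitive (N (R q))) q :=
      hprim.contDiffAt.comp q (hq.comp q R.contDiff.contDiffAt)
    exact (contDiffAt_snd.sub (cst.contDiff.contDiffAt.comp q (by fun_prop))).sub h1
  have hf' : HasFDerivAt f (ContinuousLinearMap.snd ℝ _ _ - cst.comp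
      ((ContinuousLinearMap.snd ℝ _ _).comp (ContinuousLinearMap.fst ℝ _ _)))
      ((0 : E₁ × E₂), (0 : C(unitInterval, E₂))) := by
    have h1 : HasFDerivAt N (0 : C(unitInterval, E₁ × E₁ × E₂) →L[ℝ] C(unitInterval, E₂)) (R 0) := by
      rw [map_zero, ← hdN0]; exact (hN.self_of_nhds.differentiableAt hr0).hasFDerivAt
    have h2 : HasFDerivAt (fun q => primitive (N (R q))) _ 0 :=
      (primitive (F := E₂)).hasFDerivAt.comp 0 (h1.comp 0 R.hasFDerivAt)
    have h3 := (ContinuousLinearMap.snd ℝ (E₁ × E₂) C(unitInterval, E₂) - cst.comp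
      ((ContinuousLinearMap.snd ℝ _ _).comp (ContinuousLinearMap.fst ℝ _ _))).hasFDerivAt
        (x := (0 : (E₁ × E₂) × C(unitInterval, E₂))) |>.sub h2
    refine HasFDerivAt.congr_fderiv h3 ?_
    rw [ContinuousLinearMap.zero_comp, ContinuousLinearMap.comp_zero, sub_zero]
  obtain ⟨g, hg, hg0, hgf⟩ := exists_implicit_contDiffAt hr0 hf (by simp [f, hN0, ← Prod.zero_eq_mk])
    hf' (ContinuousLinearEquiv.refl ℝ _) (fun b => by simp)
  refine ⟨N, g, hN.mono fun u hu => hu.differentiableAt hr0, hNφ, hg, hg0, hgf.mono fun z hz => ?_⟩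
  have h : g z - cst z.2 - primitive (N (R (z, g z))) = 0 := hz
  rw [sub_sub, sub_eq_zero] at h
  exact h

/-- **Frobenius theorem**: a completely integrable system `∂f/∂x = X(x, f)` has a solution
depending smoothly on the initial value. -/
theorem exists_total_solution {r : ℕ∞ω} (hr : r = ∞ ∨ r = ω) {X : E₁ × E₂ → E₁ →L[ℝ] E₂}
    (hX : ∀ᶠ q in 𝓝 0, ContDiffAt ℝ r X q) (hX0 : X 0 = 0)
    (hsymm : ∀ᶠ q in 𝓝 0, ∀ a b, fderiv ℝ X q (a, X q a) b = fderiv ℝ X q (b, X q b) a) :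
    ∃ f : E₁ × E₂ → E₂, (∀ᶠ z in 𝓝 0, ContDiffAt ℝ r f z) ∧ (∀ᶠ y in 𝓝 0, f (0, y) = y) ∧
      ∀ᶠ z in 𝓝 0, ∀ k, fderiv ℝ f z (k, 0) = X (z.1, f z) k := by
  have hr0 : r ≠ 0 := by rcases hr with rfl | rfl <;> simp
  obtain ⟨N, g, hN, hNφ, hg, hg0, hgN⟩ := exists_radial_solution hr hX hX0
  let R := radialCurve E₁ E₂
  -- The solution is the time-one value of the radial curve: the curve starts at `z.2` over `0` and
  -- reaches the point over `z.1` at `t = 1`.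
  let ev : C(unitInterval, E₂) →L[ℝ] E₂ := ContinuousMap.evalCLM ℝ (1 : unitInterval)
  have hRg : Tendsto (fun z => R (z, g z)) (𝓝 0) (𝓝 0) := by
    have h1 : ContinuousAt (fun z => R (z, g z)) 0 :=
      R.continuous.continuousAt.comp (continuousAt_id.prodMk hg.self_of_nhds.continuousAt)
    simpa [ContinuousAt, hg0, ← Prod.zero_eq_mk] using h1
  refine ⟨fun z => ev (g z), hg.mono fun z hz => ev.contDiff.contDiffAt.comp z hz, ?_, ?_⟩
  · have hc : Tendsto (fun y : E₂ => ((0 : E₁), y)) (𝓝 0) (𝓝 0) := by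
      have : ContinuousAt (fun y : E₂ => ((0 : E₁), y)) 0 := by fun_prop
      exact this
    filter_upwards [hc.eventually hgN, hc.eventually (hRg.eventually hNφ)] with y hy hy'
    have h0 : N (radialCurve E₁ E₂ ((0, y), g (0, y))) = 0 := by
      ext s; rw [hy' s]; simp [R, radialCurve_apply, radialRhs]
    rw [hy, h0]
    simp [ev]
  have hXd : ∀ᶠ q in 𝓝 (0 : E₁ × E₂), DifferentiableAt ℝ X q :=
    hX.mono fun q hq => hq.differentiableAt hr0
  -- This bound feeds the Gronwall estimate at the end, with constant `C * ‖z.1‖`.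
  obtain ⟨C, hC⟩ : ∃ C, ∀ᶠ q in 𝓝 (0 : E₁ × E₂), ‖fderiv ℝ X q‖ ≤ C := by
    have h1 : (1 : ℕ∞ω) ≤ r := ENat.one_le_iff_ne_zero_withTop.mpr hr0
    have hc : ContinuousAt (fderiv ℝ X) 0 :=
      (hX.self_of_nhds.fderiv_right (m := 0) (by simpa using h1)).continuousAt
    refine ⟨‖fderiv ℝ X 0‖ + 1, ?_⟩
    have hn : Continuous fun T : E₁ × E₂ →L[ℝ] E₁ →L[ℝ] E₂ => ‖T‖ :=
      continuous_norm (E := E₁ × E₂ →L[ℝ] E₁ →L[ℝ] E₂)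
    have hb : ContinuousAt (fun q => ‖fderiv ℝ X q‖) 0 := hn.continuousAt.comp hc
    filter_upwards [hb.eventually (gt_mem_nhds (lt_add_one _))] with q hq using hq.le
  have hpt : ∀ᶠ q in 𝓝 (0 : E₁ × E₁ × E₂), DifferentiableAt ℝ X (q.1, q.2.2) ∧
      ‖fderiv ℝ X (q.1, q.2.2)‖ ≤ C ∧ ∀ a b, fderiv ℝ X (q.1, q.2.2) (a, X (q.1, q.2.2) a) b =
        fderiv ℝ X (q.1, q.2.2) (b, X (q.1, q.2.2) b) a := by
    have hc : Tendsto (fun q : E₁ × E₁ × E₂ => (q.1, q.2.2)) (𝓝 0) (𝓝 0) := by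
      have : ContinuousAt (fun q : E₁ × E₁ × E₂ => (q.1, q.2.2)) 0 := by fun_prop
      exact this
    exact hc.eventually (hXd.and (hC.and hsymm))
  -- For small `z` the curve is small in the sup norm, so the pointwise conditions hold at all its
  -- points simultaneously.
  filter_upwards [hRg.eventually (hN.and (hNφ.eventually_nhds.and (eventually_forall_apply hpt))),
    hgN.eventually_nhds, hg] with z ⟨hN, hNφ, hpt⟩ hgN hg k
  have hgd : DifferentiableAt ℝ g z := hg.differentiableAt hr0
  set h : C(unitInterval, E₂) := fderiv ℝ g z (k, 0) with hh
  -- the integral equations of `g z` and of its derivative `h`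
  have hgt : ∀ t : unitInterval, g z t = z.2 + ∫ s in (0 : ℝ)..t,
      radialRhs X (R (z, g z) (Set.projIcc 0 1 zero_le_one s)) := fun t => by
    conv_lhs => rw [hgN.self_of_nhds]
    rw [ContinuousMap.add_apply, primitive_apply]
    simp only [ContinuousMap.const_apply]
    congr 2
    ext s
    exact hNφ.self_of_nhds _
  have hht : ∀ t : unitInterval, h t = ∫ s in (0 : ℝ)..t,
      fderiv ℝ (radialRhs X) (R (z, g z) (Set.projIcc 0 1 zero_le_one s))
        (R ((k, 0), h) (Set.projIcc 0 1 zero_le_one s)) := fun t => by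
    let cst : E₂ →L[ℝ] C(unitInterval, E₂) := ContinuousLinearMap.const ℝ unitInterval
    have h1 : HasFDerivAt (fun z => cst z.2 + primitive (N (R (z, g z))))
        (cst.comp (ContinuousLinearMap.snd ℝ E₁ E₂) + (primitive (F := E₂)).comp
          ((fderiv ℝ N (R (z, g z))).comp
            (R.comp ((ContinuousLinearMap.id ℝ _).prod (fderiv ℝ g z))))) z := by
      have ha : HasFDerivAt (fun z => R (z, g z))
          (R.comp ((ContinuousLinearMap.id ℝ _).prod (fderiv ℝ g z))) z :=
        R.hasFDerivAt.comp z ((hasFDerivAt_id z).prodMk hgd.hasFDerivAt)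
      have hb : HasFDerivAt (fun z => N (R (z, g z))) _ z :=
        HasFDerivAt.comp z (g := N) hN.hasFDerivAt ha
      exact (cst.comp (ContinuousLinearMap.snd ℝ E₁ E₂)).hasFDerivAt.add
        ((primitive (F := E₂)).hasFDerivAt.comp z hb)
    have h2 : h = primitive (fderiv ℝ N (R (z, g z)) (R ((k, 0), h))) := by
      have h3 := (hgd.hasFDerivAt.congr_of_eventuallyEq
        (hgN.mono fun z hz => hz.symm)).unique h1
      have h4 := congrArg (fun T : E₁ × E₂ →L[ℝ] C(unitInterval, E₂) => T (k, 0)) h3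
      simpa [← hh] using h4
    conv_lhs => rw [h2]
    rw [primitive_apply]
    congr 1
    ext s
    exact fderiv_apply_of_eventually_superposition hN hNφ _ (hasFDerivAt_radialRhs (hpt _).1).1 _
  -- the extensions of these functions to the real line
  have hcont : Continuous fun s : ℝ => radialRhs X (R (z, g z) (Set.projIcc 0 1 zero_le_one s)) := by
    have : Continuous fun s => N (R (z, g z)) (Set.projIcc 0 1 zero_le_one s) :=
      (N (R (z, g z))).continuous.comp continuous_projIcc
    simpa only [hNφ.self_of_nhds] using this
  have hcont' : Continuous fun s : ℝ => fderiv ℝ (radialRhs X)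
      (R (z, g z) (Set.projIcc 0 1 zero_le_one s)) (R ((k, 0), h) (Set.projIcc 0 1 zero_le_one s)) := by
    have : Continuous fun s =>
        fderiv ℝ N (R (z, g z)) (R ((k, 0), h)) (Set.projIcc 0 1 zero_le_one s) :=
      (fderiv ℝ N (R (z, g z)) (R ((k, 0), h))).continuous.comp continuous_projIcc
    simpa only [fderiv_apply_of_eventually_superposition hN hNφ _
      (hasFDerivAt_radialRhs (hpt _).1).1] using this
  let G : ℝ → E₂ := fun t => z.2 + ∫ s in (0 : ℝ)..t,
      radialRhs X (R (z, g z) (Set.projIcc 0 1 zero_le_one s))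
  let H : ℝ → E₂ := fun t => ∫ s in (0 : ℝ)..t,
      fderiv ℝ (radialRhs X) (R (z, g z) (Set.projIcc 0 1 zero_le_one s))
        (R ((k, 0), h) (Set.projIcc 0 1 zero_le_one s))
  have hG : ∀ t : unitInterval, G t = g z t := fun t => (hgt t).symm
  have hH : ∀ t : unitInterval, H t = h t := fun t => (hht t).symm
  have hpr : ∀ t : unitInterval, Set.projIcc (0 : ℝ) 1 zero_le_one t = t := fun t =>
    Set.projIcc_val zero_le_one t
  have hGd : ∀ t : unitInterval, HasDerivAt G (X ((t : ℝ) • z.1, G t) z.1) t := fun t => by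
    have h1 := (hcont.integral_hasStrictDerivAt 0 (t : ℝ)).hasDerivAt.const_add z.2
    rw [hpr] at h1
    rw [hG]
    exact h1
  have hHd : ∀ t : unitInterval, HasDerivAt H (fderiv ℝ X ((t : ℝ) • z.1, G t) ((t : ℝ) • k, H t) z.1
      + X ((t : ℝ) • z.1, G t) k) t := fun t => by
    have h1 := (hcont'.integral_hasStrictDerivAt 0 (t : ℝ)).hasDerivAt
    rw [hpr, (hasFDerivAt_radialRhs (hpt t).1).2] at h1
    rw [hG, hH]
    exact h1
  -- `Z` is the defect between the derivative of the radial curve in the direction `k` and the value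
  -- `t X k` that the full system predicts. Integrability replaces `∂X(x, X x) k` by `∂X(k, X k) x`
  -- in its derivative, leaving the linear equation `Z' = ∂X(0, Z) x` with `Z(0) = 0`. Thus `Z(1) =
  -- 0`, which is the claim.
  let Z : ℝ → E₂ := fun t => H t - t • X (t • z.1, G t) k
  have hZd : ∀ t : unitInterval, HasDerivAt Z (fderiv ℝ X ((t : ℝ) • z.1, G t) (0, Z t) z.1) t :=
      fun t => by
    have hp := hpt t
    simp only [R, radialCurve_apply, ← hG] at hp
    have h1 : HasDerivAt (fun t : ℝ => (t • z.1, G t)) (z.1, X ((t : ℝ) • z.1, G t) z.1) t := by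
      have := (hasDerivAt_id (t : ℝ)).smul_const z.1
      rw [one_smul] at this
      exact this.prodMk (hGd t)
    have h2 : HasDerivAt (fun t : ℝ => X (t • z.1, G t))
        (fderiv ℝ X ((t : ℝ) • z.1, G t) (z.1, X ((t : ℝ) • z.1, G t) z.1)) t :=
      HasFDerivAt.comp_hasDerivAt (t : ℝ) (f := fun t : ℝ => (t • z.1, G t)) (l := X)
        hp.1.hasFDerivAt h1
    have h3 : HasDerivAt Z _ t := (hHd t).sub ((hasDerivAt_id (t : ℝ)).smul (h2.clm_apply (hasDerivAt_const (t : ℝ) k)))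
    convert h3 using 1
    have hz : ((0 : E₁), Z t) = ((t : ℝ) • k, H t) - (t : ℝ) • (k, X ((t : ℝ) • z.1, G t) k) := by
      ext <;> simp [Z]
    rw [hz, map_sub, map_smul]
    simp only [sub_apply, smul_apply, map_zero,
      hp.2.2 k z.1, id, one_smul, add_zero]
    abel
  have hZ : Z 1 = 0 := by
    refine eq_zero_of_abs_deriv_le_mul_abs_self_of_eq_zero_right (K := C * ‖z.1‖) (a := 0) (b := 1)
      (f' := fun t => fderiv ℝ X (t • z.1, G t) (0, Z t) z.1)
      (fun t ht => (hZd ⟨t, ht⟩).continuousAt.continuousWithinAt)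
      (fun t ht => (hZd ⟨t, ht.1, ht.2.le⟩).hasDerivWithinAt) (by simp [Z, H]) (fun t ht => ?_)
      1 (by simp)
    have hp := (hpt ⟨t, ht.1, ht.2.le⟩).2.1
    simp only [R, radialCurve_apply, ← hG] at hp
    refine (ContinuousLinearMap.le_opNorm _ _).trans ?_
    refine (mul_le_mul_of_nonneg_right ((ContinuousLinearMap.le_opNorm _ _).trans
      (mul_le_mul_of_nonneg_right hp (norm_nonneg _))) (norm_nonneg _)).trans (le_of_eq ?_)
    rw [Prod.norm_mk, norm_zero, max_eq_right (norm_nonneg _)]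
    ring
  have hf : fderiv ℝ (fun z => ev (g z)) z (k, 0) = h 1 := by
    have : HasFDerivAt (fun z => ev (g z)) (ev.comp (fderiv ℝ g z)) z :=
      ev.hasFDerivAt.comp z hgd.hasFDerivAt
    rw [this.fderiv]; rfl
  rw [hf]
  have e1 := hH 1
  have e2 := hG 1
  simp only [Set.Icc.coe_one] at e1 e2
  simp only [Z, one_smul, e1, e2, sub_eq_zero] at hZ
  exact hZ

end Frobenius

/-! ### The Sylvester operator and stability of its invertibility. -/

section Sylvester

variable {E₁ E₂ : Type*} [NormedAddCommGroup E₁] [NormedSpace ℝ E₁]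
  [NormedAddCommGroup E₂] [NormedSpace ℝ E₂]

/-- There is no nonzero operator intertwining `α` and `δ`. -/
def NoIntertwiner (α : E₁ →L[ℝ] E₁) (δ : E₂ →L[ℝ] E₂) : Prop :=
  ∀ R : E₁ →L[ℝ] E₂, (∀ k, δ (R k) = R (α k)) → R = 0

/-- The Sylvester operator `R ↦ δ R - R α`. -/
def sylvester (α : E₁ →L[ℝ] E₁) (δ : E₂ →L[ℝ] E₂) : (E₁ →L[ℝ] E₂) →L[ℝ] (E₁ →L[ℝ] E₂) :=
  ContinuousLinearMap.compL ℝ E₁ E₂ E₂ δ - (ContinuousLinearMap.compL ℝ E₁ E₁ E₂).flip α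

theorem sylvester_apply (α : E₁ →L[ℝ] E₁) (δ : E₂ →L[ℝ] E₂) (R : E₁ →L[ℝ] E₂) :
    sylvester α δ R = δ.comp R - R.comp α := rfl

theorem continuous_sylvester :
    Continuous fun q : (E₁ →L[ℝ] E₁) × (E₂ →L[ℝ] E₂) => sylvester q.1 q.2 :=
  ((ContinuousLinearMap.compL ℝ E₁ E₂ E₂).continuous.comp continuous_snd).sub
    ((ContinuousLinearMap.compL ℝ E₁ E₁ E₂).flip.continuous.comp continuous_fst)

theorem noIntertwiner_iff_injective (α : E₁ →L[ℝ] E₁) (δ : E₂ →L[ℝ] E₂) :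
    NoIntertwiner α δ ↔ Function.Injective (sylvester α δ) := by
  rw [injective_iff_map_eq_zero]
  refine forall_congr' fun R => imp_congr ?_ Iff.rfl
  rw [sylvester_apply, sub_eq_zero, ContinuousLinearMap.ext_iff]
  rfl

variable [FiniteDimensional ℝ E₁] [FiniteDimensional ℝ E₂]

/-- Injectivity of an endomorphism of a finite-dimensional space already gives invertibility. -/
theorem NoIntertwiner.exists_equiv {α : E₁ →L[ℝ] E₁} {δ : E₂ →L[ℝ] E₂} (h : NoIntertwiner α δ) :
    ∃ Q : (E₁ →L[ℝ] E₂) ≃L[ℝ] (E₁ →L[ℝ] E₂), (Q : (E₁ →L[ℝ] E₂) →L[ℝ] _) = sylvester α δ :=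
  ⟨(LinearEquiv.ofInjectiveEndo (sylvester α δ : (E₁ →L[ℝ] E₂) →ₗ[ℝ] (E₁ →L[ℝ] E₂))
    ((noIntertwiner_iff_injective α δ).1 h)).toContinuousLinearEquiv, by ext; rfl⟩

/-- The Sylvester operator depends continuously on the pair, and invertible operators form an open
set. This carries coprimality at the base point over to nearby points. -/
theorem NoIntertwiner.eventually {α : E₁ →L[ℝ] E₁} {δ : E₂ →L[ℝ] E₂} (h : NoIntertwiner α δ) :
    ∀ᶠ q in 𝓝 (α, δ), NoIntertwiner q.1 q.2 := by
  obtain ⟨Q, hQ⟩ := h.exists_equiv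
  have h1 := ContinuousLinearEquiv.nhds Q
  rw [hQ] at h1
  filter_upwards [(continuous_sylvester (E₁ := E₁) (E₂ := E₂)).continuousAt h1] with q ⟨Q', hQ'⟩
  replace hQ' : (Q' : (E₁ →L[ℝ] E₂) →L[ℝ] _) = sylvester q.1 q.2 := hQ'
  rw [noIntertwiner_iff_injective, ← hQ']
  exact Q'.injective

end Sylvester

/-! ### Invariant distributions of a Nijenhuis operator and their leaves. -/

section Straightening

universe u

/-- The pairing `⟨L, A⟩` of operator fields on a vector space, evaluated on constant
vector fields. -/
def flatPairing {E : Type*} [NormedAddCommGroup E] [NormedSpace ℝ E] (L A : E → E →L[ℝ] E)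
    (u ξ η : E) : E :=
  - A u (fderiv ℝ L u η ξ) + L u (fderiv ℝ A u ξ η) - fderiv ℝ A u (L u ξ) η
    + fderiv ℝ L u (A u η) ξ

variable {E₁ E₂ : Type u} [NormedAddCommGroup E₁] [NormedSpace ℝ E₁]
  [NormedAddCommGroup E₂] [NormedSpace ℝ E₂]

/-- The embedding `k ↦ (k, X k)` of the graph of `X`. -/
def graphMap (X : E₁ →L[ℝ] E₂) : E₁ →L[ℝ] E₁ × E₂ := (ContinuousLinearMap.id ℝ E₁).prod X

/-- The projection `v ↦ v₂ - X v₁` along the graph of `X`. -/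
def graphProj (X : E₁ →L[ℝ] E₂) : E₁ × E₂ →L[ℝ] E₂ :=
  ContinuousLinearMap.snd ℝ E₁ E₂ - X.comp (ContinuousLinearMap.fst ℝ E₁ E₂)

@[simp] theorem graphMap_apply (X : E₁ →L[ℝ] E₂) (k : E₁) : graphMap X k = (k, X k) := rfl

@[simp] theorem graphProj_apply (X : E₁ →L[ℝ] E₂) (v : E₁ × E₂) :
    graphProj X v = v.2 - X v.1 := rfl

theorem contDiff_graphMap {r : ℕ∞ω} :
    ContDiff ℝ r (graphMap : (E₁ →L[ℝ] E₂) → E₁ →L[ℝ] E₁ × E₂) := by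
  have h : (graphMap : (E₁ →L[ℝ] E₂) → E₁ →L[ℝ] E₁ × E₂) = fun X =>
      ContinuousLinearMap.inl ℝ E₁ E₂ + (ContinuousLinearMap.inr ℝ E₁ E₂).comp X := by
    ext X k <;> simp
  rw [h]
  exact contDiff_const.add (contDiff_const.clm_comp contDiff_id)

theorem contDiff_graphProj {r : ℕ∞ω} :
    ContDiff ℝ r (graphProj : (E₁ →L[ℝ] E₂) → E₁ × E₂ →L[ℝ] E₂) :=
  contDiff_const.sub (contDiff_id.clm_comp contDiff_const)

/-- An invariant graph distribution of a Nijenhuis operator is integrable. -/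
theorem graph_integrable {L : E₁ × E₂ → E₁ × E₂ →L[ℝ] E₁ × E₂} {X : E₁ × E₂ → E₁ →L[ℝ] E₂}
    {u : E₁ × E₂} (hL : DifferentiableAt ℝ L u) (hX : DifferentiableAt ℝ X u)
    (hinv : ∀ᶠ u in 𝓝 u, ∀ k, graphProj (X u) (L u (graphMap (X u) k)) = 0)
    (hN : ∀ ξ η, flatPairing L L u ξ η = 0)
    (h : NoIntertwiner ((ContinuousLinearMap.fst ℝ E₁ E₂).comp ((L u).comp (graphMap (X u))))
      ((graphProj (X u)).comp ((L u).comp (ContinuousLinearMap.inr ℝ E₁ E₂)))) (a b : E₁) :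
    fderiv ℝ X u (a, X u a) b = fderiv ℝ X u (b, X u b) a := by
  -- `α` is `L` restricted to the graph, parametrised by `E₁`; `δ` is the operator induced on the
  -- quotient by the graph.
  set α := (ContinuousLinearMap.fst ℝ E₁ E₂).comp ((L u).comp (graphMap (X u))) with hα
  set δ := (graphProj (X u)).comp ((L u).comp (ContinuousLinearMap.inr ℝ E₁ E₂)) with hδ
  set π := graphProj (X u) with hπ
  set ι := graphMap (X u) with hι
  have hLι : ∀ k, L u (ι k) = ι (α k) := fun k => by
    have h0 := hinv.self_of_nhds k
    rw [graphProj_apply, sub_eq_zero] at h0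
    exact Prod.ext rfl h0
  have hπι : ∀ k, π (ι k) = 0 := fun k => by simp [hπ, hι]
  have hπL : ∀ v, π (L u v) = δ (π v) := fun v => by
    have h0 : v = ι v.1 + (0, π v) := by ext <;> simp [hπ, hι]
    have h1 : L u v = ι (α v.1) + L u (0, π v) := by
      conv_lhs => rw [h0, map_add, hLι]
    rw [h1, map_add, hπι, zero_add]
    rfl
  -- This is the derivative of the invariance identity. It expresses the part of `∂L` that the
  -- torsion sees through `∂X`, so that the torsion becomes an equation for the curvature alone.
  have hD : ∀ w k, π (fderiv ℝ L u w (ι k)) = fderiv ℝ X u w (α k) - δ (fderiv ℝ X u w k) := by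
    intro w k
    have h1 : HasFDerivAt (fun u => L u (graphMap (X u) k)) _ u :=
      hL.hasFDerivAt.clm_apply ((hasFDerivAt_const k u).prodMk
        (hX.hasFDerivAt.clm_apply (hasFDerivAt_const k u)))
    have h2 : HasFDerivAt (fun u => graphProj (X u) (L u (graphMap (X u) k))) _ u :=
      (hasFDerivAt_snd.comp u h1).sub (hX.hasFDerivAt.clm_apply (hasFDerivAt_fst.comp u h1))
    have h3 : HasFDerivAt (fun u => graphProj (X u) (L u (graphMap (X u) k)))
        (0 : E₁ × E₂ →L[ℝ] E₂) u :=
      (hasFDerivAt_const (0 : E₂) u).congr_of_eventuallyEq (hinv.mono fun u hu => hu k)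
    have h4 := congrArg (fun T : E₁ × E₂ →L[ℝ] E₂ => T w) (h2.unique h3)
    have h5 : π (L u (0, fderiv ℝ X u w k)) = δ (fderiv ℝ X u w k) := rfl
    have h6 : π (L u (0, fderiv ℝ X u w k) + fderiv ℝ L u w (ι k)) - fderiv ℝ X u w (α k) = 0 := by
      refine Eq.trans ?_ h4
      simp [hπ, hα, hι, sub_sub]
    rw [map_add, h5] at h6
    rw [eq_sub_iff_add_eq, add_comm, ← sub_eq_zero]
    exact h6
  let Bc : E₁ →L[ℝ] E₁ →L[ℝ] E₂ := (fderiv ℝ X u).comp ι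
  -- The curvature of the distribution, whose vanishing is the claim.
  let S : E₁ →L[ℝ] E₁ →L[ℝ] E₂ := Bc - Bc.flip
  have hS : ∀ k k', S k k' = fderiv ℝ X u (ι k) k' - fderiv ℝ X u (ι k') k := fun k k' => rfl
  have key : ∀ k k', δ (δ (S k k')) - δ (S (α k) k') - δ (S k (α k')) + S (α k) (α k') = 0 := by
    intro k k'
    have h0 := congrArg π (hN (ι k) (ι k'))
    simp only [flatPairing, map_add, map_sub, map_neg, map_zero, hLι, hπL, hD] at h0
    simp only [hS, map_sub]
    rw [← neg_eq_zero, ← h0]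
    abel
  -- `key` says that `k ↦ δ S(k,k') - S(k,αk')` intertwines `α` and `δ` for fixed `k'`, so it
  -- vanishes. What remains says that `S(k, ·)` is itself an intertwiner.
  have h1 : ∀ k k', δ (S k k') = S k (α k') := by
    intro k k'
    have hR := h (δ.comp (S.flip k') - S.flip (α k')) (fun k => by
      have := key k k'
      simp only [sub_apply, ContinuousLinearMap.comp_apply,
        ContinuousLinearMap.flip_apply, map_sub]
      rw [← sub_eq_zero, ← this]
      abel)
    have := congrArg (fun T : E₁ →L[ℝ] E₂ => T k) hR
    simpa [sub_eq_zero] using this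
  have h2 := congrArg (fun T : E₁ →L[ℝ] E₂ => T b) (h (S a) (h1 a))
  have h3 : S a b = 0 := h2
  rw [hS, sub_eq_zero] at h3
  exact h3

variable [FiniteDimensional ℝ E₁] [FiniteDimensional ℝ E₂]

/-- An operator field splits, near a point where it is block diagonal without intertwiners between
the blocks, off an invariant distribution which is the graph of a `C^r` map. -/
theorem exists_invariant_graph {r : ℕ∞ω} (hr : r ≠ 0) {L : E₁ × E₂ → E₁ × E₂ →L[ℝ] E₁ × E₂}
    (hL : ∀ᶠ u in 𝓝 0, ContDiffAt ℝ r L u) {A₀ : E₁ →L[ℝ] E₁} {D₀ : E₂ →L[ℝ] E₂}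
    (hL0 : L 0 = A₀.prodMap D₀) (h : NoIntertwiner A₀ D₀) :
    ∃ X : E₁ × E₂ → E₁ →L[ℝ] E₂, (∀ᶠ u in 𝓝 0, ContDiffAt ℝ r X u) ∧ X 0 = 0 ∧
      ∀ᶠ u in 𝓝 0, ∀ k, graphProj (X u) (L u (graphMap (X u) k)) = 0 := by
  let f : (E₁ × E₂) × (E₁ →L[ℝ] E₂) → E₁ →L[ℝ] E₂ := fun q =>
    (graphProj q.2).comp ((L q.1).comp (graphMap q.2))
  have hf : ∀ᶠ q in 𝓝 ((0 : E₁ × E₂), (0 : E₁ →L[ℝ] E₂)), ContDiffAt ℝ r f q := by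
    have hc : Tendsto (fun q : (E₁ × E₂) × (E₁ →L[ℝ] E₂) => q.1) (𝓝 (0, 0)) (𝓝 0) :=
      continuous_fst.tendsto _
    filter_upwards [hc.eventually hL] with q hq
    have h1 : ContDiffAt ℝ r (fun q : (E₁ × E₂) × (E₁ →L[ℝ] E₂) => L q.1) q :=
      ContDiffAt.comp q (g := L) hq contDiffAt_fst
    exact ((contDiff_graphProj (E₁ := E₁) (E₂ := E₂)).comp contDiff_snd).contDiffAt.clm_comp
      (h1.clm_comp ((contDiff_graphMap (E₁ := E₁) (E₂ := E₂)).comp contDiff_snd).contDiffAt)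
  -- At the base point the quadratic term in `H` drops out, because `L 0` is block diagonal; the
  -- equation is exactly the linear Sylvester equation.
  have hf0 : ∀ H, f (0, H) = sylvester A₀ D₀ H := fun H => by
    ext k
    simp [f, hL0, sylvester_apply]
  obtain ⟨Q, hQ⟩ := h.exists_equiv
  have hf' := (hf.self_of_nhds.differentiableAt hr).hasFDerivAt
  obtain ⟨X, hX, hX0, hXf⟩ := exists_implicit_contDiffAt hr hf (by rw [hf0, map_zero]) hf' Q
    (fun b => by
      have h1 : HasFDerivAt (fun H => f (0, H)) ((fderiv ℝ f (0, 0)).comp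
          (ContinuousLinearMap.inr ℝ (E₁ × E₂) (E₁ →L[ℝ] E₂))) 0 :=
        HasFDerivAt.comp (0 : E₁ →L[ℝ] E₂) (g := f) hf' (hasFDerivAt_prodMk_right 0 0)
      simp only [hf0] at h1
      have h2 := h1.unique (sylvester A₀ D₀).hasFDerivAt
      rw [← ContinuousLinearEquiv.coe_coe, hQ, ← h2]
      rfl)
  refine ⟨X, hX, hX0, hXf.mono fun u hu k => ?_⟩
  exact congrArg (fun T : E₁ →L[ℝ] E₂ => T k) hu

/-- A Nijenhuis operator preserves the fibres of a `C^r` submersion whose derivative at the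
origin is the second projection. -/
theorem exists_invariant_submersion {r : ℕ∞ω} (hr : r = ∞ ∨ r = ω)
    {L : E₁ × E₂ → E₁ × E₂ →L[ℝ] E₁ × E₂}
    (hL : ∀ᶠ u in 𝓝 0, ContDiffAt ℝ r L u) (hN : ∀ᶠ u in 𝓝 0, ∀ ξ η, flatPairing L L u ξ η = 0)
    {A₀ : E₁ →L[ℝ] E₁} {D₀ : E₂ →L[ℝ] E₂}
    (hL0 : L 0 = A₀.prodMap D₀) (h : NoIntertwiner A₀ D₀) :
    ∃ f : E₁ × E₂ → E₂, (∀ᶠ u in 𝓝 0, ContDiffAt ℝ r f u) ∧ f 0 = 0 ∧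
      HasFDerivAt f (ContinuousLinearMap.snd ℝ E₁ E₂) 0 ∧
      ∀ᶠ u in 𝓝 0, ∀ v, fderiv ℝ f u v = 0 → fderiv ℝ f u (L u v) = 0 := by
  have hr0 : r ≠ 0 := by rcases hr with rfl | rfl <;> simp
  obtain ⟨X, hX, hX0, hinv⟩ := exists_invariant_graph hr0 hL hL0 h
  have hnoint : ∀ᶠ u in 𝓝 0, NoIntertwiner
      ((ContinuousLinearMap.fst ℝ E₁ E₂).comp ((L u).comp (graphMap (X u))))
      ((graphProj (X u)).comp ((L u).comp (ContinuousLinearMap.inr ℝ E₁ E₂))) := by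
    have hXc := hX.self_of_nhds
    have hLc := hL.self_of_nhds
    have h1 : ContDiffAt ℝ r (fun u =>
        ((ContinuousLinearMap.fst ℝ E₁ E₂).comp ((L u).comp (graphMap (X u))),
        (graphProj (X u)).comp ((L u).comp (ContinuousLinearMap.inr ℝ E₁ E₂)))) 0 :=
      (contDiffAt_const.clm_comp (hLc.clm_comp ((contDiff_graphMap (E₁ := E₁) (E₂ := E₂)).contDiffAt.comp _ hXc))).prodMk
        (((contDiff_graphProj (E₁ := E₁) (E₂ := E₂)).contDiffAt.comp _ hXc).clm_comp (hLc.clm_comp contDiffAt_const))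
    have h2 : ((ContinuousLinearMap.fst ℝ E₁ E₂).comp ((L 0).comp (graphMap (X 0))),
        (graphProj (X 0)).comp ((L 0).comp (ContinuousLinearMap.inr ℝ E₁ E₂))) = (A₀, D₀) := by
      rw [hL0, hX0]
      ext <;> simp
    have h3 := h1.continuousAt
    rw [ContinuousAt, h2] at h3
    exact h3.eventually h.eventually
  have hsymm : ∀ᶠ u in 𝓝 0, ∀ a b, fderiv ℝ X u (a, X u a) b = fderiv ℝ X u (b, X u b) a := by
    filter_upwards [hL, hX, hinv.eventually_nhds, hN, hnoint] with u h1 h2 h3 h4 h5 a b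
    exact graph_integrable (h1.differentiableAt hr0) (h2.differentiableAt hr0) h3 h4 h5 a b
  obtain ⟨f, hf, hf0, hfX⟩ := exists_total_solution hr hX hX0 hsymm
  have hf00 : f 0 = 0 := hf0.self_of_nhds
  have hfd := (hf.self_of_nhds.differentiableAt hr0).hasFDerivAt
  have hf' : fderiv ℝ f 0 = ContinuousLinearMap.snd ℝ E₁ E₂ := by
    have h1 : HasFDerivAt (fun y : E₂ => f (0, y)) ((fderiv ℝ f 0).comp
        (ContinuousLinearMap.inr ℝ E₁ E₂)) 0 :=
      HasFDerivAt.comp (0 : E₂) (g := f) hfd (hasFDerivAt_prodMk_right 0 0)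
    have h2 := h1.unique ((hasFDerivAt_id (0 : E₂)).congr_of_eventuallyEq hf0)
    refine ContinuousLinearMap.ext fun v => ?_
    have h3 := hfX.self_of_nhds v.1
    rw [hf00] at h3
    have h3' : fderiv ℝ f 0 (v.1, 0) = 0 := by
      rw [h3]; change X 0 v.1 = 0; rw [hX0]; rfl
    have h4 : fderiv ℝ f 0 (0, v.2) = v.2 := congrArg (fun T : E₂ →L[ℝ] E₂ => T v.2) h2
    have h5 : v = (v.1, 0) + (0, v.2) := by simp
    conv_lhs => rw [h5, map_add, h3', h4, zero_add]
    rfl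
  rw [hf'] at hfd
  -- `Ψ` maps each slice of constant second coordinate onto a leaf. The second component of its
  -- local inverse labels the leaves and is the required submersion.
  let Ψ : E₁ × E₂ → E₁ × E₂ := fun z => (z.1, f z)
  have hΨ : ∀ᶠ z in 𝓝 0, ContDiffAt ℝ r Ψ z := hf.mono fun z hz => contDiffAt_fst.prodMk hz
  have hΨ' : HasFDerivAt Ψ ((ContinuousLinearEquiv.refl ℝ (E₁ × E₂) : (E₁ × E₂) ≃L[ℝ] E₁ × E₂) :
      E₁ × E₂ →L[ℝ] E₁ × E₂) 0 := hasFDerivAt_fst.prodMk hfd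
  obtain ⟨e, he0, heΨ, heΨc, hesymm⟩ := exists_openPartialHomeomorph_contDiffAt hr0 hΨ _ hΨ'
  have he00 : e 0 = 0 := by rw [heΨ]; simp [Ψ, hf00]
  have hes0 : e.symm 0 = 0 := by
    have := e.left_inv he0; rwa [he00] at this
  have ht0 : (0 : E₁ × E₂) ∈ e.target := by rw [← he00]; exact e.map_source he0
  have ht : ∀ᶠ u in 𝓝 (0 : E₁ × E₂), u ∈ e.target := e.open_target.mem_nhds ht0
  have hes : Tendsto e.symm (𝓝 0) (𝓝 0) := by
    have := (hesymm 0 ht0).continuousAt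
    rwa [ContinuousAt, hes0] at this
  have hinvd : HasFDerivAt e.symm
      ((ContinuousLinearEquiv.refl ℝ (E₁ × E₂)).symm : E₁ × E₂ →L[ℝ] E₁ × E₂) 0 := by
    refine e.hasFDerivAt_symm ht0 ?_
    rw [hes0, heΨ]; exact hΨ'
  refine ⟨fun u => (e.symm u).2, ?_, by simp [hes0], ?_, ?_⟩
  · filter_upwards [ht] with u hu using contDiffAt_snd.comp u (hesymm u hu)
  · exact hasFDerivAt_snd.comp (0 : E₁ × E₂) hinvd
  · filter_upwards [ht, hes.eventually hfX, hinv] with u hu hfXu hinvu v hv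
    have hz := e.map_target hu
    have hd1 : HasFDerivAt e.symm (fderiv ℝ e.symm u) u :=
      ((hesymm u hu).differentiableAt hr0).hasFDerivAt
    have hd2 : HasFDerivAt e (fderiv ℝ e (e.symm u)) (e.symm u) := by
      rw [heΨ]; exact ((heΨc _ hz).differentiableAt hr0).hasFDerivAt
    have hru : e (e.symm u) = u := e.right_inv hu
    have hc1 : ∀ w, fderiv ℝ e (e.symm u) (fderiv ℝ e.symm u w) = w := fun w => by
      have h1 := (hd2.comp u hd1).unique ((hasFDerivAt_id u).congr_of_eventuallyEq
        (by filter_upwards [e.open_target.mem_nhds hu] with y hy using e.right_inv hy))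
      exact congrArg (fun T : E₁ × E₂ →L[ℝ] E₁ × E₂ => T w) h1
    have hc2 : ∀ w, fderiv ℝ e.symm u (fderiv ℝ e (e.symm u) w) = w := fun w => by
      have hd1' : HasFDerivAt e.symm (fderiv ℝ e.symm u) (e (e.symm u)) := by rwa [hru]
      have h1 := (hd1'.comp (e.symm u) hd2).unique ((hasFDerivAt_id _).congr_of_eventuallyEq
        (by filter_upwards [e.open_source.mem_nhds hz] with y hy using e.left_inv hy))
      exact congrArg (fun T : E₁ × E₂ →L[ℝ] E₁ × E₂ => T w) h1
    have hd3 : ∀ w, fderiv ℝ (fun u => (e.symm u).2) u w = (fderiv ℝ e.symm u w).2 := fun w => by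
      have h1 : HasFDerivAt (fun u => (e.symm u).2) _ u := hasFDerivAt_snd.comp u hd1
      rw [h1.fderiv]; rfl
    have hfz : f (e.symm u) = u.2 := by
      have := congrArg Prod.snd hru
      rwa [heΨ] at this
    have hz1 : (e.symm u).1 = u.1 := by
      have := congrArg Prod.fst hru
      rwa [heΨ] at this
    have hd4 : ∀ k, fderiv ℝ e (e.symm u) (k, 0) = graphMap (X u) k := fun k => by
      have h1 : HasFDerivAt Ψ ((ContinuousLinearMap.fst ℝ E₁ E₂).prod (fderiv ℝ f (e.symm u)))
          (e.symm u) := by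
        refine hasFDerivAt_fst.prodMk ?_
        have := contDiffAt_snd.comp (e.symm u) (heΨc _ hz)
        exact (ContDiffAt.differentiableAt this hr0).hasFDerivAt
      rw [heΨ, h1.fderiv, ContinuousLinearMap.prod_apply, hfXu k, hfz, hz1]
      rfl
    rw [hd3] at hv ⊢
    -- The kernel of the differential of the submersion is the graph of `X u`, which `L u`
    -- preserves.
    have hv' : v = graphMap (X u) (fderiv ℝ e.symm u v).1 := by
      rw [← hd4]
      have : fderiv ℝ e.symm u v = ((fderiv ℝ e.symm u v).1, 0) := Prod.ext rfl hv
      rw [← this, hc1]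
    have hLv : L u v = graphMap (X u) (L u v).1 := by
      have h0 := hinvu (fderiv ℝ e.symm u v).1
      rw [← hv', graphProj_apply, sub_eq_zero] at h0
      exact Prod.ext rfl h0
    rw [hLv, ← hd4, hc2]

end Straightening

/-! ### Linear changes of coordinates. -/

section Conjugation

variable {E F : Type*} [NormedAddCommGroup E] [NormedSpace ℝ E]
  [NormedAddCommGroup F] [NormedSpace ℝ F]

/-- Transport of an operator field by a linear isomorphism. -/
def conjField (σ : E ≃L[ℝ] F) (L : E → E →L[ℝ] E) (u : F) : F →L[ℝ] F :=
  (σ : E →L[ℝ] F).comp ((L (σ.symm u)).comp (σ.symm : F →L[ℝ] E))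

@[simp] theorem conjField_apply (σ : E ≃L[ℝ] F) (L : E → E →L[ℝ] E) (u v : F) :
    conjField σ L u v = σ (L (σ.symm u) (σ.symm v)) := rfl

theorem ContDiffAt.conjField {r : ℕ∞ω} {σ : E ≃L[ℝ] F} {L : E → E →L[ℝ] E} {u : F}
    (hL : ContDiffAt ℝ r L (σ.symm u)) : ContDiffAt ℝ r (conjField σ L) u :=
  contDiffAt_const.clm_comp
    ((ContDiffAt.comp u (g := L) hL σ.symm.contDiff.contDiffAt).clm_comp contDiffAt_const)

theorem fderiv_conjField {σ : E ≃L[ℝ] F} {L : E → E →L[ℝ] E} {u : F}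
    (hL : DifferentiableAt ℝ L (σ.symm u)) (w v : F) :
    fderiv ℝ (conjField σ L) u w v = σ (fderiv ℝ L (σ.symm u) (σ.symm w) (σ.symm v)) := by
  have h1 : HasFDerivAt (fun u => L (σ.symm u))
      ((fderiv ℝ L (σ.symm u)).comp (σ.symm : F →L[ℝ] E)) u :=
    HasFDerivAt.comp u (g := L) hL.hasFDerivAt σ.symm.hasFDerivAt
  have h2 : HasFDerivAt (conjField σ L) _ u := (hasFDerivAt_const (σ : E →L[ℝ] F) u).clm_comp
    (h1.clm_comp (hasFDerivAt_const (σ.symm : F →L[ℝ] E) u))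
  rw [h2.fderiv]
  simp

/-- A linear change has no second derivative, so the expression transforms as a tensor. It is
applied to the exchange of the two factors. -/
theorem flatPairing_conjField {σ : E ≃L[ℝ] F} {L : E → E →L[ℝ] E} {u : F}
    (hL : DifferentiableAt ℝ L (σ.symm u)) (ξ η : F) :
    flatPairing (conjField σ L) (conjField σ L) u ξ η =
      σ (flatPairing L L (σ.symm u) (σ.symm ξ) (σ.symm η)) := by
  simp [flatPairing, fderiv_conjField hL]

end Conjugation

/-! ### Both invariant foliations as coordinate foliations. -/

section Straightening

universe u
variable {E₁ E₂ : Type u} [NormedAddCommGroup E₁] [NormedSpace ℝ E₁]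
  [NormedAddCommGroup E₂] [NormedSpace ℝ E₂]
variable [FiniteDimensional ℝ E₁] [FiniteDimensional ℝ E₂]

/-- Coordinates in which a Nijenhuis operator preserves both coordinate distributions. -/
theorem exists_straightening {r : ℕ∞ω} (hr : r = ∞ ∨ r = ω)
    {L : E₁ × E₂ → E₁ × E₂ →L[ℝ] E₁ × E₂}
    (hL : ∀ᶠ u in 𝓝 0, ContDiffAt ℝ r L u) (hN : ∀ᶠ u in 𝓝 0, ∀ ξ η, flatPairing L L u ξ η = 0)
    {A₀ : E₁ →L[ℝ] E₁} {D₀ : E₂ →L[ℝ] E₂} (hL0 : L 0 = A₀.prodMap D₀)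
    (h : NoIntertwiner A₀ D₀) (h' : NoIntertwiner D₀ A₀) :
    ∃ Φ : OpenPartialHomeomorph (E₁ × E₂) (E₁ × E₂), 0 ∈ Φ.source ∧ Φ 0 = 0 ∧
      (∀ u ∈ Φ.source, ContDiffAt ℝ r Φ u) ∧ (∀ u ∈ Φ.target, ContDiffAt ℝ r Φ.symm u) ∧
      fderiv ℝ Φ 0 = ContinuousLinearMap.id ℝ _ ∧
      ∀ u ∈ Φ.source, ∀ v, ((fderiv ℝ Φ u v).1 = 0 → (fderiv ℝ Φ u (L u v)).1 = 0) ∧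
        ((fderiv ℝ Φ u v).2 = 0 → (fderiv ℝ Φ u (L u v)).2 = 0) := by
  have hr0 : r ≠ 0 := by rcases hr with rfl | rfl <;> simp
  obtain ⟨f₂, hf₂, hf₂0, hf₂', hinv₂⟩ := exists_invariant_submersion hr hL hN hL0 h
  let σ : (E₁ × E₂) ≃L[ℝ] (E₂ × E₁) := ContinuousLinearEquiv.prodComm ℝ E₁ E₂
  have hσ : Tendsto σ.symm (𝓝 0) (𝓝 0) := by simpa using σ.symm.continuous.tendsto 0
  have hσ' : Tendsto σ (𝓝 0) (𝓝 0) := by simpa using σ.continuous.tendsto 0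
  obtain ⟨f₁, hf₁, hf₁0, hf₁', hinv₁⟩ := exists_invariant_submersion (L := conjField σ L) hr
    ((hσ.eventually hL).mono fun u hu => ContDiffAt.conjField hu)
    (by
      filter_upwards [hσ.eventually (hL.and hN)] with u hu ξ η
      rw [flatPairing_conjField (hu.1.differentiableAt hr0), hu.2, map_zero])
    (A₀ := D₀) (D₀ := A₀) (by
      refine ContinuousLinearMap.ext fun v => ?_
      rw [conjField_apply, map_zero, hL0]
      rfl) h'
  -- The two leaf labels are the new coordinates. Their differentials at `0` are the two
  -- projections, so `Φ` has identity derivative there.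
  let Φ : E₁ × E₂ → E₁ × E₂ := fun u => (f₁ (σ u), f₂ u)
  have hΦ : ∀ᶠ u in 𝓝 0, ContDiffAt ℝ r Φ u := by
    filter_upwards [hσ'.eventually hf₁, hf₂] with u h1 h2
    exact (ContDiffAt.comp u (g := f₁) h1 σ.contDiff.contDiffAt).prodMk h2
  have hd₁ : ∀ u, DifferentiableAt ℝ f₁ (σ u) → HasFDerivAt (fun u => f₁ (σ u))
      ((fderiv ℝ f₁ (σ u)).comp (σ : E₁ × E₂ →L[ℝ] E₂ × E₁)) u := fun u hu =>
    HasFDerivAt.comp u (g := f₁) hu.hasFDerivAt σ.hasFDerivAt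
  have hΦ0 : HasFDerivAt Φ ((ContinuousLinearEquiv.refl ℝ (E₁ × E₂) : (E₁ × E₂) ≃L[ℝ] E₁ × E₂) :
      E₁ × E₂ →L[ℝ] E₁ × E₂) 0 := by
    have h1 := hd₁ 0 (by rw [map_zero]; exact hf₁'.differentiableAt)
    rw [map_zero, hf₁'.fderiv] at h1
    exact h1.prodMk hf₂'
  have hinv : ∀ᶠ u in 𝓝 0, ContDiffAt ℝ r Φ u ∧
      ∀ v, ((fderiv ℝ Φ u v).1 = 0 → (fderiv ℝ Φ u (L u v)).1 = 0) ∧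
        ((fderiv ℝ Φ u v).2 = 0 → (fderiv ℝ Φ u (L u v)).2 = 0) := by
    filter_upwards [hσ'.eventually (hf₁.and hinv₁), hf₂, hinv₂, hΦ] with u ⟨h1, h2⟩ h3 h4 h5
    have hd : HasFDerivAt Φ _ u := (hd₁ u (h1.differentiableAt hr0)).prodMk
      (h3.differentiableAt hr0).hasFDerivAt
    refine ⟨h5, fun v => ?_⟩
    rw [hd.fderiv]
    refine ⟨fun hv => ?_, fun hv => h4 v hv⟩
    have := h2 (σ v) hv
    rw [conjField_apply, σ.symm_apply_apply, σ.symm_apply_apply] at this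
    exact this
  obtain ⟨s, hs, hso, h0s⟩ := mem_nhds_iff.1 hinv
  obtain ⟨e, he0, heΦ, heΦc, hesymm⟩ := exists_openPartialHomeomorph_contDiffAt hr0 hΦ _ hΦ0
  refine ⟨e.restrOpen s hso, ⟨he0, h0s⟩, ?_, ?_, ?_, ?_, ?_⟩
  · change e 0 = 0
    rw [heΦ]
    simp [Φ, hf₁0, hf₂0]
  · intro u hu
    exact (hs hu.2).1.congr_of_eventuallyEq (Eventually.of_forall fun x => congrFun heΦ x)
  · intro u hu
    exact hesymm u hu.1
  · have : ((e.restrOpen s hso : OpenPartialHomeomorph _ _) : E₁ × E₂ → E₁ × E₂) = Φ := heΦ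
    rw [this, hΦ0.fderiv]
    rfl
  · have : ((e.restrOpen s hso : OpenPartialHomeomorph _ _) : E₁ × E₂ → E₁ × E₂) = Φ := heΦ
    intro u hu v
    rw [this]
    exact (hs hu.2).2 v

end Straightening

/-! ### Coprime annihilating polynomials exclude intertwiners. -/

section Coprime

variable {E₁ E₂ : Type*} [NormedAddCommGroup E₁] [NormedSpace ℝ E₁]
  [NormedAddCommGroup E₂] [NormedSpace ℝ E₂]

/-- An intertwiner satisfies `s(δ) R = R s(α)` for every polynomial `s`. With `a p + b q = 1` this
gives `R = a(δ) p(δ) R + b(δ) q(δ) R = a(δ) R p(α) + 0 = 0`. -/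
theorem noIntertwiner_of_isCoprime {α : E₁ →L[ℝ] E₁} {δ : E₂ →L[ℝ] E₂} {p q : Polynomial ℝ}
    (hpq : IsCoprime p q) (hp : Polynomial.aeval (α : E₁ →ₗ[ℝ] E₁) p = 0)
    (hq : Polynomial.aeval (δ : E₂ →ₗ[ℝ] E₂) q = 0) : NoIntertwiner α δ := by
  intro R hR
  have h1 : ∀ (s : Polynomial ℝ) (k : E₁), Polynomial.aeval (δ : E₂ →ₗ[ℝ] E₂) s (R k) =
      R (Polynomial.aeval (α : E₁ →ₗ[ℝ] E₁) s k) := by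
    intro s
    induction s using Polynomial.induction_on' with
    | add s t hs ht => intro k; simp [hs, ht]
    | monomial n c =>
      intro k
      simp only [Polynomial.aeval_monomial, Module.End.mul_apply, Module.algebraMap_end_apply,
        map_smul]
      congr 1
      induction n generalizing k with
      | zero => simp
      | succ n ih => rw [pow_succ, pow_succ, Module.End.mul_apply, Module.End.mul_apply,
          ContinuousLinearMap.coe_coe, ContinuousLinearMap.coe_coe, hR, ih]
  obtain ⟨a, b, hab⟩ := hpq
  ext k
  have h2 := congrArg (fun s => Polynomial.aeval (δ : E₂ →ₗ[ℝ] E₂) s (R k)) hab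
  simp only [map_add, map_mul, hq, mul_zero, add_zero, map_one, Module.End.mul_apply,
    Module.End.one_apply, h1 p, hp] at h2
  simpa using h2.symm

/-- The transpose `θ ↦ θ ∘ δ` of an operator. -/
def transposeL : (E₂ →L[ℝ] E₂) →L[ℝ] (E₂ →L[ℝ] ℝ) →L[ℝ] (E₂ →L[ℝ] ℝ) :=
  (ContinuousLinearMap.compL ℝ E₂ E₂ ℝ).flip

/-- An operator and its transpose have the same annihilating polynomials, so the absence of
intertwiners extends to the transposed block that conservation laws involve. -/
theorem aeval_transposeL {δ : E₂ →L[ℝ] E₂} {q : Polynomial ℝ}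
    (hq : Polynomial.aeval (δ : E₂ →ₗ[ℝ] E₂) q = 0) :
    Polynomial.aeval (transposeL δ : (E₂ →L[ℝ] ℝ) →ₗ[ℝ] (E₂ →L[ℝ] ℝ)) q = 0 := by
  have h1 : ∀ (s : Polynomial ℝ) (θ : E₂ →L[ℝ] ℝ) (y : E₂),
      Polynomial.aeval (transposeL δ : (E₂ →L[ℝ] ℝ) →ₗ[ℝ] (E₂ →L[ℝ] ℝ)) s θ y =
      θ (Polynomial.aeval (δ : E₂ →ₗ[ℝ] E₂) s y) := by
    intro s
    induction s using Polynomial.induction_on' with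
    | add s t hs ht => intro θ y; simp [hs, ht]
    | monomial n c =>
      intro θ y
      simp only [Polynomial.aeval_monomial, Module.End.mul_apply, Module.algebraMap_end_apply,
        map_smul, smul_apply]
      congr 1
      induction n generalizing θ with
      | zero => simp
      | succ n ih => rw [pow_succ, pow_succ', Module.End.mul_apply, Module.End.mul_apply,
          ContinuousLinearMap.coe_coe, ContinuousLinearMap.coe_coe, ih]; rfl
  ext θ y
  rw [h1, hq]
  simp

end Coprime

/-! ### Block diagonal fields, symmetries and conservation laws in coordinates. -/

section FlatSplitting

variable {E₁ E₂ : Type*} [NormedAddCommGroup E₁] [NormedSpace ℝ E₁]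
  [NormedAddCommGroup E₂] [NormedSpace ℝ E₂]

/-- The first diagonal block of an operator. -/
def block₁ (T : E₁ × E₂ →L[ℝ] E₁ × E₂) : E₁ →L[ℝ] E₁ :=
  (ContinuousLinearMap.fst ℝ E₁ E₂).comp (T.comp (ContinuousLinearMap.inl ℝ E₁ E₂))

/-- The second diagonal block of an operator. -/
def block₂ (T : E₁ × E₂ →L[ℝ] E₁ × E₂) : E₂ →L[ℝ] E₂ :=
  (ContinuousLinearMap.snd ℝ E₁ E₂).comp (T.comp (ContinuousLinearMap.inr ℝ E₁ E₂))

@[simp] theorem block₁_apply (T : E₁ × E₂ →L[ℝ] E₁ × E₂) (x : E₁) :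
    block₁ T x = (T (x, 0)).1 := rfl

@[simp] theorem block₂_apply (T : E₁ × E₂ →L[ℝ] E₁ × E₂) (y : E₂) :
    block₂ T y = (T (0, y)).2 := rfl

@[simp] theorem block₁_prodMap (A : E₁ →L[ℝ] E₁) (D : E₂ →L[ℝ] E₂) :
    block₁ (A.prodMap D) = A := rfl

@[simp] theorem block₂_prodMap (A : E₁ →L[ℝ] E₁) (D : E₂ →L[ℝ] E₂) :
    block₂ (A.prodMap D) = D := rfl

theorem contDiff_block₁ {r : ℕ∞ω} : ContDiff ℝ r
    (block₁ : (E₁ × E₂ →L[ℝ] E₁ × E₂) → (E₁ →L[ℝ] E₁)) :=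
  contDiff_const.clm_comp (contDiff_id.clm_comp contDiff_const)

theorem contDiff_block₂ {r : ℕ∞ω} : ContDiff ℝ r
    (block₂ : (E₁ × E₂ →L[ℝ] E₁ × E₂) → (E₂ →L[ℝ] E₂)) :=
  contDiff_const.clm_comp (contDiff_id.clm_comp contDiff_const)

/-- The operator preserves both factors of the product. -/
def IsBlockDiag (T : E₁ × E₂ →L[ℝ] E₁ × E₂) : Prop :=
  (∀ y, (T (0, y)).1 = 0) ∧ ∀ x, (T (x, 0)).2 = 0

theorem IsBlockDiag.apply {T : E₁ × E₂ →L[ℝ] E₁ × E₂} (h : IsBlockDiag T) (v : E₁ × E₂) :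
    T v = (block₁ T v.1, block₂ T v.2) := by
  have hv : v = (v.1, 0) + (0, v.2) := by simp
  conv_lhs => rw [hv, map_add]
  ext <;> simp [h.1, h.2]

theorem IsBlockDiag.apply_inl {T : E₁ × E₂ →L[ℝ] E₁ × E₂} (h : IsBlockDiag T) (x : E₁) :
    T (x, 0) = (block₁ T x, 0) := Prod.ext rfl (h.2 x)

theorem IsBlockDiag.apply_inr {T : E₁ × E₂ →L[ℝ] E₁ × E₂} (h : IsBlockDiag T) (y : E₂) :
    T (0, y) = (0, block₂ T y) := Prod.ext (h.1 y) rfl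

theorem IsBlockDiag.eq_prodMap {T : E₁ × E₂ →L[ℝ] E₁ × E₂} (h : IsBlockDiag T) :
    T = (block₁ T).prodMap (block₂ T) := ContinuousLinearMap.ext h.apply

theorem isBlockDiag_prodMap (A : E₁ →L[ℝ] E₁) (D : E₂ →L[ℝ] E₂) : IsBlockDiag (A.prodMap D) := by
  constructor <;> intro <;> simp

/-- An operator commuting with a block diagonal one without intertwiners is block diagonal. -/
theorem isBlockDiag_of_commute {T A : E₁ × E₂ →L[ℝ] E₁ × E₂} (hT : IsBlockDiag T)
    (h : NoIntertwiner (block₁ T) (block₂ T)) (h' : NoIntertwiner (block₂ T) (block₁ T))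
    (hc : ∀ v, T (A v) = A (T v)) : IsBlockDiag A := by
  constructor
  · intro y
    have := h' ((ContinuousLinearMap.fst ℝ E₁ E₂).comp (A.comp (ContinuousLinearMap.inr ℝ E₁ E₂)))
      (fun y => by
        have h1 := congrArg Prod.fst (hc (0, y))
        rw [hT.apply (A (0, y)), hT.apply_inr] at h1
        exact h1)
    exact congrArg (fun R : E₂ →L[ℝ] E₁ => R y) this
  · intro x
    have := h ((ContinuousLinearMap.snd ℝ E₁ E₂).comp (A.comp (ContinuousLinearMap.inl ℝ E₁ E₂)))
      (fun x => by
        have h1 := congrArg Prod.snd (hc (x, 0))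
        rw [hT.apply (A (x, 0)), hT.apply_inl] at h1
        exact h1)
    exact congrArg (fun R : E₁ →L[ℝ] E₂ => R x) this

theorem hasFDerivAt_eval {E F : Type*} [NormedAddCommGroup E] [NormedSpace ℝ E]
    [NormedAddCommGroup F] [NormedSpace ℝ F] {G : Type*} [NormedAddCommGroup G] [NormedSpace ℝ G]
    {A : E → F →L[ℝ] G} {u : E} (hA : DifferentiableAt ℝ A u) (v : F) :
    HasFDerivAt (fun u => A u v) ((fderiv ℝ A u).flip v) u := by
  refine (hA.hasFDerivAt.clm_apply (hasFDerivAt_const v u)).congr_fderiv ?_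
  ext w; simp

theorem isBlockDiag_fderiv {A : E₁ × E₂ → E₁ × E₂ →L[ℝ] E₁ × E₂} {u : E₁ × E₂}
    (hA : DifferentiableAt ℝ A u) (h : ∀ᶠ u' in 𝓝 u, IsBlockDiag (A u')) (w : E₁ × E₂) :
    IsBlockDiag (fderiv ℝ A u w) := by
  constructor
  · intro y
    have h1 := hasFDerivAt_fst.comp u (hasFDerivAt_eval hA (0, y))
    have h2 := h1.unique ((hasFDerivAt_const (0 : E₁) u).congr_of_eventuallyEq
      (h.mono fun u' hu' => hu'.1 y))
    exact congrArg (fun R : E₁ × E₂ →L[ℝ] E₁ => R w) h2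
  · intro x
    have h1 := hasFDerivAt_snd.comp u (hasFDerivAt_eval hA (x, 0))
    have h2 := h1.unique ((hasFDerivAt_const (0 : E₂) u).congr_of_eventuallyEq
      (h.mono fun u' hu' => hu'.2 x))
    exact congrArg (fun R : E₁ × E₂ →L[ℝ] E₂ => R w) h2

/-- The diagonal blocks of a Nijenhuis operator are constant in the complementary directions. -/
theorem fderiv_block_eq_zero_of_nijenhuis {L : E₁ × E₂ → E₁ × E₂ →L[ℝ] E₁ × E₂} {u : E₁ × E₂}
    (hL : DifferentiableAt ℝ L u) (hdiag : ∀ᶠ u' in 𝓝 u, IsBlockDiag (L u'))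
    (hN : ∀ ξ η, flatPairing L L u ξ η = 0)
    (h : NoIntertwiner (block₁ (L u)) (block₂ (L u)))
    (h' : NoIntertwiner (block₂ (L u)) (block₁ (L u))) :
    (∀ x y, (fderiv ℝ L u (0, y) (x, 0)).1 = 0) ∧ ∀ x y, (fderiv ℝ L u (x, 0) (0, y)).2 = 0 := by
  have hd := isBlockDiag_fderiv hL hdiag
  have hLu := hdiag.self_of_nhds
  have e1 : ∀ x, L u (x, 0) = ((block₁ (L u)) x, 0) := hLu.apply_inl
  have e2 : ∀ y, L u (0, y) = (0, (block₂ (L u)) y) := hLu.apply_inr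
  constructor
  · intro x y
    have := h' ((ContinuousLinearMap.fst ℝ E₁ E₂).comp (((fderiv ℝ L u).flip (x, 0)).comp
      -- On `(x, 0)`, `(0, y)` only two terms of the torsion have a component in `E₁`; they say that
      -- `y ↦ ∂_y L₁ x` intertwines the two blocks.
      (ContinuousLinearMap.inr ℝ E₁ E₂))) (fun y => by
        have h1 := congrArg Prod.fst (hN (x, 0) (0, y))
        rw [flatPairing, e1, e2, hLu.apply (fderiv ℝ L u (0, y) (x, 0)),
          hLu.apply (fderiv ℝ L u (x, 0) (0, y))] at h1
        simp only [Prod.fst_add, Prod.fst_sub, Prod.fst_neg, (hd _).1, Prod.fst_zero, map_zero,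
          add_zero, sub_zero] at h1
        rw [neg_add_eq_zero] at h1
        exact h1)
    exact congrArg (fun R : E₂ →L[ℝ] E₁ => R y) this
  · intro x y
    have := h ((ContinuousLinearMap.snd ℝ E₁ E₂).comp (((fderiv ℝ L u).flip (0, y)).comp
      (ContinuousLinearMap.inl ℝ E₁ E₂))) (fun x => by
        have h1 := congrArg Prod.snd (hN (x, 0) (0, y))
        rw [flatPairing, e1, e2, hLu.apply (fderiv ℝ L u (0, y) (x, 0)),
          hLu.apply (fderiv ℝ L u (x, 0) (0, y))] at h1
        simp only [Prod.snd_add, Prod.snd_sub, Prod.snd_neg, (hd _).2, Prod.snd_zero, map_zero,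
          neg_zero, zero_add, add_zero] at h1
        rw [sub_eq_zero] at h1
        exact h1)
    exact congrArg (fun R : E₁ →L[ℝ] E₂ => R x) this

/-- Polarisation: a symmetry constrains only the diagonal of the bilinear form, and this is all that
survives on mixed arguments. -/
theorem flatPairing_add_swap {E : Type*} [NormedAddCommGroup E] [NormedSpace ℝ E]
    {L A : E → E →L[ℝ] E} {u : E} (h : ∀ ξ, flatPairing L A u ξ ξ = 0) (ξ η : E) :
    flatPairing L A u ξ η + flatPairing L A u η ξ = 0 := by
  have h1 := h (ξ + η)
  have h2 := h ξ
  have h3 := h η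
  simp only [flatPairing, map_add, add_apply] at h1 h2 h3 ⊢
  calc _ = _ - _ - _ := ?_
    _ = (0 : E) - 0 - 0 := congrArg₂ (· - ·) (congrArg₂ (· - ·) h1 h2) h3
    _ = 0 := by simp
  abel

/-- The diagonal blocks of a symmetry are constant in the complementary directions. -/
theorem fderiv_block_eq_zero_of_symmetry {L A : E₁ × E₂ → E₁ × E₂ →L[ℝ] E₁ × E₂} {u : E₁ × E₂}
    (hL : DifferentiableAt ℝ L u) (hA : DifferentiableAt ℝ A u)
    (hdiag : ∀ᶠ u' in 𝓝 u, IsBlockDiag (L u')) (hdiagA : ∀ᶠ u' in 𝓝 u, IsBlockDiag (A u'))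
    (hL₁ : ∀ x y, (fderiv ℝ L u (0, y) (x, 0)).1 = 0)
    (hL₂ : ∀ x y, (fderiv ℝ L u (x, 0) (0, y)).2 = 0)
    (hs : ∀ ξ, flatPairing L A u ξ ξ = 0)
    (h : NoIntertwiner (block₁ (L u)) (block₂ (L u)))
    (h' : NoIntertwiner (block₂ (L u)) (block₁ (L u))) :
    (∀ x y, (fderiv ℝ A u (0, y) (x, 0)).1 = 0) ∧ ∀ x y, (fderiv ℝ A u (x, 0) (0, y)).2 = 0 := by
  have hd := isBlockDiag_fderiv hL hdiag
  have hdA := isBlockDiag_fderiv hA hdiagA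
  have hLu := hdiag.self_of_nhds
  have hAu := hdiagA.self_of_nhds
  have e1 : ∀ x, L u (x, 0) = ((block₁ (L u)) x, 0) := hLu.apply_inl
  have e2 : ∀ y, L u (0, y) = (0, (block₂ (L u)) y) := hLu.apply_inr
  have a1 : ∀ x, A u (x, 0) = ((block₁ (A u)) x, 0) := hAu.apply_inl
  have a2 : ∀ y, A u (0, y) = (0, (block₂ (A u)) y) := hAu.apply_inr
  have z1 : ∀ x y, fderiv ℝ L u (0, y) (x, 0) = 0 := fun x y =>
    Prod.ext (hL₁ x y) ((hd _).2 x)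
  have z2 : ∀ x y, fderiv ℝ L u (x, 0) (0, y) = 0 := fun x y =>
    Prod.ext ((hd _).1 y) (hL₂ x y)
  -- The first two terms lie in `E₂` and the last two in `E₁`, so the single polarised identity
  -- decouples into one intertwining relation for each block.
  have key : ∀ x y, L u (fderiv ℝ A u (x, 0) (0, y)) - fderiv ℝ A u (block₁ (L u) x, 0) (0, y) +
      (L u (fderiv ℝ A u (0, y) (x, 0)) - fderiv ℝ A u (0, block₂ (L u) y) (x, 0)) = 0 := by
    intro x y
    have h1 := flatPairing_add_swap hs (x, 0) (0, y)
    simpa only [flatPairing, e1, e2, a1, a2, z1, z2, map_zero, neg_zero, zero_add, add_zero] using h1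
  constructor
  · intro x y
    have := h' ((ContinuousLinearMap.fst ℝ E₁ E₂).comp (((fderiv ℝ A u).flip (x, 0)).comp
      (ContinuousLinearMap.inr ℝ E₁ E₂))) (fun y => by
        have h1 := congrArg Prod.fst (key x y)
        rw [hLu.apply (fderiv ℝ A u (0, y) (x, 0)),
          hLu.apply (fderiv ℝ A u (x, 0) (0, y))] at h1
        simp only [Prod.fst_add, Prod.fst_sub, (hdA _).1, Prod.fst_zero, map_zero,
          sub_zero, zero_add] at h1
        exact sub_eq_zero.1 h1)
    exact congrArg (fun R : E₂ →L[ℝ] E₁ => R y) this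
  · intro x y
    have := h ((ContinuousLinearMap.snd ℝ E₁ E₂).comp (((fderiv ℝ A u).flip (0, y)).comp
      (ContinuousLinearMap.inl ℝ E₁ E₂))) (fun x => by
        have h1 := congrArg Prod.snd (key x y)
        rw [hLu.apply (fderiv ℝ A u (0, y) (x, 0)),
          hLu.apply (fderiv ℝ A u (x, 0) (0, y))] at h1
        simp only [Prod.snd_add, Prod.snd_sub, (hdA _).2, Prod.snd_zero, map_zero,
          sub_zero, add_zero] at h1
        exact sub_eq_zero.1 h1)
    exact congrArg (fun R : E₁ →L[ℝ] E₂ => R x) this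

variable {F : Type*} [NormedAddCommGroup F] [NormedSpace ℝ F]

theorem eq_of_fderiv_inl_eq_zero {f : E₁ × E₂ → F} {V : Set E₁} (hV : IsOpen V)
    (hV' : IsPreconnected V) {y : E₂} (hf : ∀ x ∈ V, DifferentiableAt ℝ f (x, y))
    (h : ∀ x ∈ V, ∀ ξ, fderiv ℝ f (x, y) (ξ, 0) = 0) {x x' : E₁} (hx : x ∈ V) (hx' : x' ∈ V) :
    f (x, y) = f (x', y) := by
  have hd : ∀ x ∈ V, HasFDerivAt (fun x => f (x, y)) (0 : E₁ →L[ℝ] F) x := fun x hx => by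
    have h1 : HasFDerivAt (fun x => f (x, y)) _ x :=
      HasFDerivAt.comp x (g := f) (hf x hx).hasFDerivAt (hasFDerivAt_prodMk_left x y)
    refine h1.congr_fderiv ?_
    ext ξ
    exact h x hx ξ
  exact hV.is_const_of_fderiv_eq_zero hV'
    (fun x hx => (hd x hx).differentiableAt.differentiableWithinAt)
    (fun x hx => (hd x hx).fderiv) hx hx'

theorem eq_of_fderiv_inr_eq_zero {f : E₁ × E₂ → F} {V : Set E₂} (hV : IsOpen V)
    (hV' : IsPreconnected V) {x : E₁} (hf : ∀ y ∈ V, DifferentiableAt ℝ f (x, y))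
    (h : ∀ y ∈ V, ∀ η, fderiv ℝ f (x, y) (0, η) = 0) {y y' : E₂} (hy : y ∈ V) (hy' : y' ∈ V) :
    f (x, y) = f (x, y') := by
  have hd : ∀ y ∈ V, HasFDerivAt (fun y => f (x, y)) (0 : E₂ →L[ℝ] F) y := fun y hy => by
    have h1 : HasFDerivAt (fun y => f (x, y)) _ y :=
      HasFDerivAt.comp y (g := f) (hf y hy).hasFDerivAt (hasFDerivAt_prodMk_right x y)
    refine h1.congr_fderiv ?_
    ext ξ
    exact h y hy ξ
  exact hV.is_const_of_fderiv_eq_zero hV'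
    (fun y hy => (hd y hy).differentiableAt.differentiableWithinAt)
    (fun y hy => (hd y hy).fderiv) hy hy'

/-- A block diagonal operator field whose blocks are constant in the complementary directions
is a product. -/
theorem eq_prodMap_of_fderiv_block {A : E₁ × E₂ → E₁ × E₂ →L[ℝ] E₁ × E₂} {V₁ : Set E₁} {V₂ : Set E₂}
    (hV₁ : IsOpen V₁) (hV₂ : IsOpen V₂) (hV₁' : IsPreconnected V₁) (hV₂' : IsPreconnected V₂)
    (hA : ∀ u ∈ V₁ ×ˢ V₂, DifferentiableAt ℝ A u) (hdiag : ∀ u ∈ V₁ ×ˢ V₂, IsBlockDiag (A u))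
    (h : ∀ u ∈ V₁ ×ˢ V₂, (∀ x y, (fderiv ℝ A u (0, y) (x, 0)).1 = 0) ∧
      ∀ x y, (fderiv ℝ A u (x, 0) (0, y)).2 = 0) {a : E₁} {b : E₂} (ha : a ∈ V₁) (hb : b ∈ V₂) :
    ∀ u ∈ V₁ ×ˢ V₂, A u = (block₁ (A (u.1, b))).prodMap (block₂ (A (a, u.2))) := by
  rintro ⟨x, y⟩ ⟨hx, hy⟩
  simp only at hx hy
  rw [(hdiag (x, y) ⟨hx, hy⟩).eq_prodMap]
  congr 1
  · ext ξ
    exact eq_of_fderiv_inr_eq_zero (f := fun u => (A u (ξ, 0)).1) hV₂ hV₂'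
      (fun y hy => (hasFDerivAt_fst.comp _ (hasFDerivAt_eval (hA (x, y) ⟨hx, hy⟩) _)).differentiableAt)
      (fun y hy η => by
        have h1 : HasFDerivAt (fun u => (A u (ξ, 0)).1) _ (x, y) :=
          hasFDerivAt_fst.comp _ (hasFDerivAt_eval (hA (x, y) ⟨hx, hy⟩) _)
        rw [h1.fderiv]
        exact (h (x, y) ⟨hx, hy⟩).1 ξ η) hy hb
  · ext η
    exact eq_of_fderiv_inl_eq_zero (f := fun u => (A u (0, η)).2) hV₁ hV₁'
      (fun x hx => (hasFDerivAt_snd.comp _ (hasFDerivAt_eval (hA (x, y) ⟨hx, hy⟩) _)).differentiableAt)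
      (fun x hx ξ => by
        have h1 : HasFDerivAt (fun u => (A u (0, η)).2) _ (x, y) :=
          hasFDerivAt_snd.comp _ (hasFDerivAt_eval (hA (x, y) ⟨hx, hy⟩) _)
        rw [h1.fderiv]
        exact (h (x, y) ⟨hx, hy⟩).2 ξ η) hx ha

theorem fderiv_of_eventually_prodMap {L : E₁ × E₂ → E₁ × E₂ →L[ℝ] E₁ × E₂}
    {L₁ : E₁ → E₁ →L[ℝ] E₁} {L₂ : E₂ → E₂ →L[ℝ] E₂} {u : E₁ × E₂}
    (h : ∀ᶠ u' in 𝓝 u, L u' = (L₁ u'.1).prodMap (L₂ u'.2))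
    (hL : DifferentiableAt ℝ L u) (h₁ : DifferentiableAt ℝ L₁ u.1) (h₂ : DifferentiableAt ℝ L₂ u.2)
    (w v : E₁ × E₂) : fderiv ℝ L u w v = (fderiv ℝ L₁ u.1 w.1 v.1, fderiv ℝ L₂ u.2 w.2 v.2) := by
  have h1 := hasFDerivAt_eval hL v
  have h2 : HasFDerivAt (fun u' : E₁ × E₂ => (L₁ u'.1 v.1, L₂ u'.2 v.2)) _ u :=
    (HasFDerivAt.comp u (g := fun x => L₁ x v.1) (hasFDerivAt_eval h₁ v.1) hasFDerivAt_fst).prodMk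
      (HasFDerivAt.comp u (g := fun x => L₂ x v.2) (hasFDerivAt_eval h₂ v.2) hasFDerivAt_snd)
  have h3 := h1.unique (h2.congr_of_eventuallyEq (h.mono fun u' hu' => by
    simp only [hu']; rfl))
  exact congrArg (fun R : E₁ × E₂ →L[ℝ] E₁ × E₂ => R w) h3

theorem flatPairing_of_eventually_prodMap {L A : E₁ × E₂ → E₁ × E₂ →L[ℝ] E₁ × E₂}
    {L₁ A₁ : E₁ → E₁ →L[ℝ] E₁} {L₂ A₂ : E₂ → E₂ →L[ℝ] E₂} {u : E₁ × E₂}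
    (h : ∀ᶠ u' in 𝓝 u, L u' = (L₁ u'.1).prodMap (L₂ u'.2))
    (hA' : ∀ᶠ u' in 𝓝 u, A u' = (A₁ u'.1).prodMap (A₂ u'.2))
    (hL : DifferentiableAt ℝ L u) (h₁ : DifferentiableAt ℝ L₁ u.1) (h₂ : DifferentiableAt ℝ L₂ u.2)
    (hA : DifferentiableAt ℝ A u) (hA₁ : DifferentiableAt ℝ A₁ u.1)
    (hA₂ : DifferentiableAt ℝ A₂ u.2) (ξ η : E₁ × E₂) :
    flatPairing L A u ξ η =
      (flatPairing L₁ A₁ u.1 ξ.1 η.1, flatPairing L₂ A₂ u.2 ξ.2 η.2) := by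
  simp only [flatPairing, fderiv_of_eventually_prodMap h hL h₁ h₂,
    fderiv_of_eventually_prodMap hA' hA hA₁ hA₂, h.self_of_nhds, hA'.self_of_nhds]
  rfl

/-- The mixed second derivatives of a conservation law vanish. -/
theorem mixed_fderiv_eq_zero {L : E₁ × E₂ → E₁ × E₂ →L[ℝ] E₁ × E₂} {f : E₁ × E₂ → ℝ} {u : E₁ × E₂}
    (hL : DifferentiableAt ℝ L u) (hf : DifferentiableAt ℝ (fderiv ℝ f) u)
    (hsymm : ∀ ξ η, fderiv ℝ (fderiv ℝ f) u ξ η = fderiv ℝ (fderiv ℝ f) u η ξ)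
    (hdiag : ∀ᶠ u' in 𝓝 u, IsBlockDiag (L u'))
    (hL₁ : ∀ x y, (fderiv ℝ L u (0, y) (x, 0)).1 = 0)
    (hL₂ : ∀ x y, (fderiv ℝ L u (x, 0) (0, y)).2 = 0)
    (hc : ∀ ξ η, fderiv ℝ (fun u => (fderiv ℝ f u).comp (L u)) u ξ η =
      fderiv ℝ (fun u => (fderiv ℝ f u).comp (L u)) u η ξ)
    (h : NoIntertwiner (block₁ (L u)) (transposeL (block₂ (L u)))) (x : E₁) (y : E₂) :
    fderiv ℝ (fderiv ℝ f) u (x, 0) (0, y) = 0 := by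
  have hd := isBlockDiag_fderiv hL hdiag
  have hLu := hdiag.self_of_nhds
  have z1 : ∀ x y, fderiv ℝ L u (0, y) (x, 0) = 0 := fun x y =>
    Prod.ext (hL₁ x y) ((hd _).2 x)
  have z2 : ∀ x y, fderiv ℝ L u (x, 0) (0, y) = 0 := fun x y =>
    Prod.ext ((hd _).1 y) (hL₂ x y)
  have hθ : HasFDerivAt (fun u => (fderiv ℝ f u).comp (L u)) _ u :=
    hf.hasFDerivAt.clm_comp hL.hasFDerivAt
  -- Closedness of `L^*df` on mixed arguments: the derivatives of `L` drop out, and the Hessian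
  -- pairing between the factors intertwines `block₁` with the transpose of `block₂`.
  have key : ∀ x y, fderiv ℝ (fderiv ℝ f) u (x, 0) (0, block₂ (L u) y) =
      fderiv ℝ (fderiv ℝ f) u (block₁ (L u) x, 0) (0, y) := by
    intro x y
    have h1 := hc (x, 0) (0, y)
    rw [hθ.fderiv] at h1
    simp only [add_apply, ContinuousLinearMap.comp_apply, ContinuousLinearMap.compL_apply,
      ContinuousLinearMap.flip_apply, z1, z2, map_zero, zero_add] at h1
    rw [hLu.apply_inr, hLu.apply_inl, hsymm (0, y)] at h1
    exact h1
  have := h ((ContinuousLinearMap.compL ℝ E₂ (E₁ × E₂) ℝ).flip (ContinuousLinearMap.inr ℝ E₁ E₂)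
    |>.comp ((fderiv ℝ (fderiv ℝ f) u).comp (ContinuousLinearMap.inl ℝ E₁ E₂)))
    (fun x => by ext y; exact key x y)
  exact congrArg (fun R : E₁ →L[ℝ] E₂ →L[ℝ] ℝ => R x y) this

end FlatSplitting

/-! ### The manifold notions on a vector space. -/

section VectorSpace

variable {V : Type*} [NormedAddCommGroup V] [NormedSpace ℝ V]

theorem VField.SmoothAt.differentiableAt {ξ : V → V} {x : V}
    (h : VField.SmoothAt 𝓘(ℝ, V) (M := V) ξ x) : DifferentiableAt ℝ ξ x :=
  (contMDiffAt_vectorSpace_iff_contDiffAt.1 h).differentiableAt (by simp)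

theorem opField_contMDiffOn_of_contDiffOn {r : ℕ∞ω} {A : V → V →L[ℝ] V} {W : Set V}
    (h : ContDiffOn ℝ r A W) : OpField.ContMDiffOn 𝓘(ℝ, V) (M := V) r A W := by
  intro x hx
  refine (contMDiffWithinAt_hom_bundle _).2 ⟨contMDiffWithinAt_id, ?_⟩
  have h1 := (h x hx).contMDiffWithinAt
  refine h1.congr (fun y _ => ?_) ?_ <;> exact inCoordinates_tangent_bundle_core_model_space _ _ _ _ _

theorem lieBracket_apply_apply {L A : V → V →L[ℝ] V} {ξ η : V → V} {x : V}
    (hL : DifferentiableAt ℝ L x) (hA : DifferentiableAt ℝ A x)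
    (hξ : DifferentiableAt ℝ ξ x) (hη : DifferentiableAt ℝ η x) :
    lieBracket ℝ (fun y => L y (ξ y)) (fun y => A y (η y)) x =
      fderiv ℝ A x (L x (ξ x)) (η x) + A x (fderiv ℝ η x (L x (ξ x)))
        - fderiv ℝ L x (A x (η x)) (ξ x) - L x (fderiv ℝ ξ x (A x (η x))) := by
  rw [lieBracket, (hL.hasFDerivAt.clm_apply hξ.hasFDerivAt).fderiv,
    (hA.hasFDerivAt.clm_apply hη.hasFDerivAt).fderiv]
  simp only [add_apply, ContinuousLinearMap.comp_apply, ContinuousLinearMap.flip_apply]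
  abel

theorem lieBracket_apply_left {L : V → V →L[ℝ] V} {ξ η : V → V} {x : V}
    (hL : DifferentiableAt ℝ L x) (hξ : DifferentiableAt ℝ ξ x) :
    lieBracket ℝ (fun y => L y (ξ y)) η x =
      fderiv ℝ η x (L x (ξ x)) - fderiv ℝ L x (η x) (ξ x) - L x (fderiv ℝ ξ x (η x)) := by
  rw [lieBracket, (hL.hasFDerivAt.clm_apply hξ.hasFDerivAt).fderiv]
  simp only [add_apply, ContinuousLinearMap.comp_apply, ContinuousLinearMap.flip_apply]
  abel

theorem lieBracket_apply_right {A : V → V →L[ℝ] V} {ξ η : V → V} {x : V}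
    (hA : DifferentiableAt ℝ A x) (hη : DifferentiableAt ℝ η x) :
    lieBracket ℝ ξ (fun y => A y (η y)) x =
      fderiv ℝ A x (ξ x) (η x) + A x (fderiv ℝ η x (ξ x)) - fderiv ℝ ξ x (A x (η x)) := by
  rw [lieBracket, (hA.hasFDerivAt.clm_apply hη.hasFDerivAt).fderiv]
  simp only [add_apply, ContinuousLinearMap.comp_apply, ContinuousLinearMap.flip_apply]
  abel

theorem mlieBracket_vectorSpace (ξ η : V → V) (x : V) :
    mlieBracket 𝓘(ℝ, V) ξ η x = lieBracket ℝ ξ η x := by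
  have h : mlieBracket 𝓘(ℝ, V) ξ η x = lieBracketWithin ℝ ξ η Set.univ x :=
    congrFun (mlieBracketWithin_eq_lieBracketWithin (𝕜 := ℝ) (E := V) (V := ξ) (W := η)
      (s := Set.univ)) x
  exact h.trans (by rw [lieBracketWithin_univ])

/-- On a vector space the pairing of commuting operator fields is a tensor. -/
theorem pairing_vectorSpace {L A : V → V →L[ℝ] V} {x : V}
    (hL : DifferentiableAt ℝ L x) (hA : DifferentiableAt ℝ A x)
    (hc : ∀ v, L x (A x v) = A x (L x v)) {ξ η : V → V}
    (hξ : DifferentiableAt ℝ ξ x) (hη : DifferentiableAt ℝ η x) :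
    pairing 𝓘(ℝ, V) (M := V) L A ξ η x = flatPairing L A x (ξ x) (η x) := by
  have h1 := lieBracket_apply_left (η := η) hL hξ
  have h2 := lieBracket_apply_right (ξ := ξ) hA hη
  have h3 := lieBracket_apply_apply hL hA hξ hη
  have e : pairing 𝓘(ℝ, V) (M := V) L A ξ η x =
      A x (lieBracket ℝ (fun y => L y (ξ y)) η x) + L x (lieBracket ℝ ξ (fun y => A y (η y)) x)
      - lieBracket ℝ (fun y => L y (ξ y)) (fun y => A y (η y)) x
      - L x (A x (lieBracket ℝ ξ η x)) := by
    simp only [← mlieBracket_vectorSpace]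
    rfl
  rw [e, h1, h2, h3, lieBracket, flatPairing]
  simp only [map_sub, map_add, hc]
  abel

/-- Lets the Nijenhuis condition be treated as the case `A = L` of the pairing. -/
theorem torsion_eq_neg_pairing {E H : Type*} [NormedAddCommGroup E] [NormedSpace ℝ E]
    [TopologicalSpace H] (I : ModelWithCorners ℝ E H) {M : Type*} [TopologicalSpace M]
    [ChartedSpace H M] (L : OpField I M) (ξ η : VField I M) (x : M) :
    torsion I L ξ η x = - pairing I L L ξ η x := by
  rw [torsion, pairing]
  abel

theorem isNijenhuisOn_vectorSpace {r : ℕ∞ω} (hr : r ≠ 0) {L : V → V →L[ℝ] V} {W : Set V}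
    (hW : IsOpen W) (hL : ContDiffOn ℝ r L W)
    (h : ∀ x ∈ W, ∀ ξ η, flatPairing L L x ξ η = 0) :
    IsNijenhuisOn 𝓘(ℝ, V) (M := V) r L W where
  contMDiffOn := opField_contMDiffOn_of_contDiffOn hL
  torsion_eq_zero x hx ξ η hξ hη := by
    have hd := (hL.contDiffAt (hW.mem_nhds hx)).differentiableAt hr
    exact (torsion_eq_neg_pairing _ _ _ _ _).trans (neg_eq_zero.2 ((pairing_vectorSpace hd hd
      (fun _ => rfl) hξ.differentiableAt hη.differentiableAt).trans (h x hx _ _)))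

theorem isSymmetryOn_vectorSpace {r : ℕ∞ω} (hr : r ≠ 0) {L A : V → V →L[ℝ] V} {W : Set V}
    (hW : IsOpen W) (hL : ContDiffOn ℝ r L W) (hA : ContDiffOn ℝ r A W)
    (hc : ∀ x ∈ W, ∀ v, L x (A x v) = A x (L x v))
    (h : ∀ x ∈ W, ∀ ξ, flatPairing L A x ξ ξ = 0) :
    IsSymmetryOn 𝓘(ℝ, V) (M := V) r L A W where
  contMDiffOn := opField_contMDiffOn_of_contDiffOn hA
  comm x hx := ContinuousLinearMap.ext (hc x hx)
  pairing_self x hx ξ hξ := by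
    have hd := (hL.contDiffAt (hW.mem_nhds hx)).differentiableAt hr
    have hd' := (hA.contDiffAt (hW.mem_nhds hx)).differentiableAt hr
    exact (pairing_vectorSpace hd hd' (hc x hx) hξ.differentiableAt hξ.differentiableAt).trans
      (h x hx _)

theorem isStrongSymmetryOn_vectorSpace {r : ℕ∞ω} (hr : r ≠ 0) {L A : V → V →L[ℝ] V} {W : Set V}
    (hW : IsOpen W) (hL : ContDiffOn ℝ r L W) (hA : ContDiffOn ℝ r A W)
    (hc : ∀ x ∈ W, ∀ v, L x (A x v) = A x (L x v))
    (h : ∀ x ∈ W, ∀ ξ η, flatPairing A L x ξ η = 0) :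
    IsStrongSymmetryOn 𝓘(ℝ, V) (M := V) r L A W where
  contMDiffOn := opField_contMDiffOn_of_contDiffOn hA
  comm x hx := ContinuousLinearMap.ext fun v => (hc x hx v).symm
  pairing_eq_zero x hx ξ η hξ hη := by
    have hd := (hL.contDiffAt (hW.mem_nhds hx)).differentiableAt hr
    have hd' := (hA.contDiffAt (hW.mem_nhds hx)).differentiableAt hr
    exact (pairing_vectorSpace hd' hd (fun v => (hc x hx v).symm) hξ.differentiableAt
      hη.differentiableAt).trans (h x hx _ _)

theorem extDerivOneForm_vectorSpace {θ : V → V →L[ℝ] ℝ} {x : V} (hθ : DifferentiableAt ℝ θ x)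
    {ξ η : V → V} (hξ : DifferentiableAt ℝ ξ x) (hη : DifferentiableAt ℝ η x) :
    extDerivOneForm 𝓘(ℝ, V) (M := V) θ ξ η x =
      fderiv ℝ θ x (ξ x) (η x) - fderiv ℝ θ x (η x) (ξ x) := by
  have e : extDerivOneForm 𝓘(ℝ, V) (M := V) θ ξ η x =
      fderiv ℝ (fun y => θ y (η y)) x (ξ x) - fderiv ℝ (fun y => θ y (ξ y)) x (η x)
        - θ x (lieBracket ℝ ξ η x) := by
    rw [← mlieBracket_vectorSpace, ← mfderiv_eq_fderiv, ← mfderiv_eq_fderiv]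
    rfl
  rw [e, (hθ.hasFDerivAt.clm_apply hξ.hasFDerivAt).fderiv,
    (hθ.hasFDerivAt.clm_apply hη.hasFDerivAt).fderiv, lieBracket]
  simp only [add_apply, ContinuousLinearMap.comp_apply, ContinuousLinearMap.flip_apply, map_sub]
  abel

theorem isConservationLawOn_vectorSpace {L : V → V →L[ℝ] V} {f : V → ℝ} {W : Set V}
    (hL : ∀ x ∈ W, DifferentiableAt ℝ L x) (hf : ∀ x ∈ W, ContDiffAt ℝ 2 f x)
    (h : ∀ x ∈ W, ∀ ξ η, fderiv ℝ (fun x => (fderiv ℝ f x).comp (L x)) x ξ η =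
      fderiv ℝ (fun x => (fderiv ℝ f x).comp (L x)) x η ξ) :
    IsConservationLawOn 𝓘(ℝ, V) (M := V) L (differential 𝓘(ℝ, V) f) W := by
  have e : differential 𝓘(ℝ, V) f = fderiv ℝ f := by
    funext x; exact mfderiv_eq_fderiv
  have hd : ∀ x ∈ W, DifferentiableAt ℝ (fderiv ℝ f) x := fun x hx =>
    ((hf x hx).fderiv_right (m := 1) (by norm_num)).differentiableAt (by norm_num)
  rw [e]
  refine ⟨fun x hx ξ η hξ hη => ?_, fun x hx ξ η hξ hη => ?_⟩
  · refine (extDerivOneForm_vectorSpace (hd x hx) hξ.differentiableAt hη.differentiableAt).trans ?_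
    rw [sub_eq_zero]
    exact ((hf x hx).isSymmSndFDerivAt (by simp)) _ _
  · refine (extDerivOneForm_vectorSpace (θ := fun x => (fderiv ℝ f x).comp (L x))
      ((hd x hx).clm_comp (hL x hx)) hξ.differentiableAt hη.differentiableAt).trans ?_
    rw [sub_eq_zero]
    exact h x hx _ _

end VectorSpace

/-! ### Operator fields, brackets and closed forms in a coordinate system. -/

section Coordinates

variable {E : Type*} [NormedAddCommGroup E] [NormedSpace ℝ E]
  {M : Type*} [TopologicalSpace M] [ChartedSpace E M]
  {E₁ E₂ : Type*} [NormedAddCommGroup E₁] [NormedSpace ℝ E₁]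
  [NormedAddCommGroup E₂] [NormedSpace ℝ E₂] {r : ℕ∞ω}
  {e : OpenPartialHomeomorph M (E₁ × E₂)}

/-- The matrix of an operator field at `x` with respect to the coordinates `e`. -/
def conjAt (e : OpenPartialHomeomorph M (E₁ × E₂)) (A : OpField 𝓘(ℝ, E) M) (x : M) :
    E₁ × E₂ →L[ℝ] E₁ × E₂ :=
  (components 𝓘(ℝ, E) e x).comp ((A x).comp (components 𝓘(ℝ, E) e x).inverse)

/-- The operator field in the coordinates `e`. -/
def coordRep (e : OpenPartialHomeomorph M (E₁ × E₂)) (A : OpField 𝓘(ℝ, E) M) (u : E₁ × E₂) :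
    E₁ × E₂ →L[ℝ] E₁ × E₂ := conjAt e A (e.symm u)

theorem coordRep_apply_self (A : OpField 𝓘(ℝ, E) M) {x : M} (hx : x ∈ e.source) :
    coordRep e A (e x) = conjAt e A x := by
  rw [coordRep, e.left_inv hx]

theorem IsCoordinateSystem.contMDiffAt (he : IsCoordinateSystem 𝓘(ℝ, E) r e) {x : M}
    (hx : x ∈ e.source) : ContMDiffAt 𝓘(ℝ, E) 𝓘(ℝ, E₁ × E₂) r e x :=
  (he.1 x hx).contMDiffAt (e.open_source.mem_nhds hx)

theorem IsCoordinateSystem.contMDiffAt_symm (he : IsCoordinateSystem 𝓘(ℝ, E) r e) {u : E₁ × E₂}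
    (hu : u ∈ e.target) : ContMDiffAt 𝓘(ℝ, E₁ × E₂) 𝓘(ℝ, E) r e.symm u :=
  (he.2 u hu).contMDiffAt (e.open_target.mem_nhds hu)

theorem IsCoordinateSystem.mdifferentiable (hr : r ≠ 0) (he : IsCoordinateSystem 𝓘(ℝ, E) r e) :
    e.MDifferentiable 𝓘(ℝ, E) 𝓘(ℝ, E₁ × E₂) :=
  ⟨he.1.mdifferentiableOn hr, he.2.mdifferentiableOn hr⟩

theorem IsCoordinateSystem.isInvertible (hr : r ≠ 0) (he : IsCoordinateSystem 𝓘(ℝ, E) r e) {x : M}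
    (hx : x ∈ e.source) : (components 𝓘(ℝ, E) e x).IsInvertible :=
  ⟨(he.mdifferentiable hr).mfderiv hx, rfl⟩

theorem IsCoordinateSystem.inverse_symm (hr : r ≠ 0) (he : IsCoordinateSystem 𝓘(ℝ, E) r e)
    {u : E₁ × E₂} (hu : u ∈ e.target) :
    (mfderiv 𝓘(ℝ, E₁ × E₂) 𝓘(ℝ, E) e.symm u).IsInvertible ∧
    (mfderiv 𝓘(ℝ, E₁ × E₂) 𝓘(ℝ, E) e.symm u).inverse =
      components 𝓘(ℝ, E) e (e.symm u) := by
  have hd := he.mdifferentiable hr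
  have hi : (mfderiv 𝓘(ℝ, E₁ × E₂) 𝓘(ℝ, E) e.symm u).IsInvertible := ⟨hd.symm.mfderiv hu, rfl⟩
  refine ⟨hi, ContinuousLinearMap.ext fun w => ?_⟩
  obtain ⟨v, rfl⟩ := hi.bijective.2 w
  rw [hi.inverse_apply_self]
  have h := congrArg (fun T => T v) (hd.comp_symm_deriv hu)
  exact h.symm

theorem IsCoordinateSystem.components_apply (hr : r ≠ 0) (he : IsCoordinateSystem 𝓘(ℝ, E) r e)
    (A : OpField 𝓘(ℝ, E) M) {x : M} (hx : x ∈ e.source) (v : TangentSpace 𝓘(ℝ, E) x) :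
    components 𝓘(ℝ, E) e x (A x v) = coordRep e A (e x) (components 𝓘(ℝ, E) e x v) := by
  rw [coordRep_apply_self A hx, conjAt, ContinuousLinearMap.comp_apply,
    ContinuousLinearMap.comp_apply, (he.isInvertible hr hx).inverse_apply_self]

/-- The vector field on `M` with the given components. -/
def fieldOf (e : OpenPartialHomeomorph M (E₁ × E₂)) (ξ : E₁ × E₂ → E₁ × E₂) : VField 𝓘(ℝ, E) M :=
  mpullback 𝓘(ℝ, E) 𝓘(ℝ, E₁ × E₂) e ξ

theorem IsCoordinateSystem.components_fieldOf (hr : r ≠ 0) (he : IsCoordinateSystem 𝓘(ℝ, E) r e)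
    (ξ : E₁ × E₂ → E₁ × E₂) {x : M} (hx : x ∈ e.source) :
    components 𝓘(ℝ, E) e x (fieldOf e ξ x) = ξ (e x) :=
  (he.isInvertible hr hx).self_apply_inverse _

theorem IsCoordinateSystem.app_fieldOf (hr : r ≠ 0) (he : IsCoordinateSystem 𝓘(ℝ, E) r e)
    (A : OpField 𝓘(ℝ, E) M) (ξ : E₁ × E₂ → E₁ × E₂) {x : M} (hx : x ∈ e.source) :
    A x (fieldOf e ξ x) = fieldOf e (fun u => coordRep e A u (ξ u)) x := by
  refine (he.isInvertible hr hx).injective ?_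
  rw [he.components_apply hr A hx, he.components_fieldOf hr _ hx, he.components_fieldOf hr _ hx]

theorem IsCoordinateSystem.coordRep_comm (hr : r ≠ 0)
    (he : IsCoordinateSystem 𝓘(ℝ, E) r e) {x : M} (hx : x ∈ e.source) {L A : OpField 𝓘(ℝ, E) M}
    (hc : (L x).comp (A x) = (A x).comp (L x)) (v : E₁ × E₂) :
    coordRep e L (e x) (coordRep e A (e x) v) = coordRep e A (e x) (coordRep e L (e x) v) := by
  obtain ⟨w, rfl⟩ := (he.isInvertible hr hx).bijective.2 v
  have h1 := congrArg (components 𝓘(ℝ, E) e x) (congrArg (fun T => T w) hc)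
  have h2 : ∀ B C : OpField 𝓘(ℝ, E) M, components 𝓘(ℝ, E) e x (B x (C x w)) =
      coordRep e B (e x) (coordRep e C (e x) (components 𝓘(ℝ, E) e x w)) := fun B C => by
    rw [he.components_apply hr, he.components_apply hr] <;> exact hx
  exact (h2 L A).symm.trans (h1.trans (h2 A L))

theorem IsCoordinateSystem.differential_eq (hr : r ≠ 0)
    (he : IsCoordinateSystem 𝓘(ℝ, E) r e) {x : M} (hx : x ∈ e.source) {g : M → ℝ}
    {ĝ : E₁ × E₂ → ℝ} (hg : DifferentiableAt ℝ ĝ (e x)) (h : g =ᶠ[𝓝 x] fun y => ĝ (e y)) :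
    differential 𝓘(ℝ, E) g x = (fderiv ℝ ĝ (e x)).comp (components 𝓘(ℝ, E) e x) := by
  have h1 : differential 𝓘(ℝ, E) g x = mfderiv 𝓘(ℝ, E) 𝓘(ℝ, ℝ) (ĝ ∘ e) x := h.mfderiv_eq
  rw [h1, mfderiv_comp x hg.mdifferentiableAt ((he.contMDiffAt hx).mdifferentiableAt hr),
    mfderiv_eq_fderiv]
  rfl

variable [IsManifold 𝓘(ℝ, E) ∞ M] [CompleteSpace E]

/-- Makes the coordinate vector fields admissible test fields in the definitions; they are the only
test fields needed on the manifold. -/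
theorem IsCoordinateSystem.smoothAt_const (hr : r = ∞ ∨ r = ω)
    (he : IsCoordinateSystem 𝓘(ℝ, E) r e) (c : E₁ × E₂) {x : M} (hx : x ∈ e.source) :
    VField.SmoothAt 𝓘(ℝ, E) (fieldOf e fun _ => c) x := by
  have hr0 : r ≠ 0 := by rcases hr with rfl | rfl <;> simp
  have hc : ContMDiffAt 𝓘(ℝ, E) 𝓘(ℝ, E₁ × E₂) ∞ e x :=
    (he.contMDiffAt hx).of_le (by rcases hr with rfl | rfl <;> simp)
  exact ContMDiffAt.mpullback_vectorField_preimage (m := ∞)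
    (contMDiffAt_vectorSpace_iff_contDiffAt.2 contDiffAt_const) hc (he.isInvertible hr0 hx) (by simp)

/-- In finite dimensions regularity may be tested on constant vectors `c`: the coordinate field of
`c` is moved to the manifold, `A` is applied, and the result is moved back. Differentiating the
coordinates costs one order, harmless because `r + 1 ≤ r` for both values of `r`. -/
theorem IsCoordinateSystem.contDiffOn_coordRep [FiniteDimensional ℝ E₁] [FiniteDimensional ℝ E₂]
    (hr : r = ∞ ∨ r = ω)
    (he : IsCoordinateSystem 𝓘(ℝ, E) r e) {A : OpField 𝓘(ℝ, E) M} {W : Set M} (hW : IsOpen W)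
    (hA : OpField.ContMDiffOn 𝓘(ℝ, E) r A W) :
    ContDiffOn ℝ r (coordRep e A) (e.target ∩ e.symm ⁻¹' W) := by
  have hr0 : r ≠ 0 := by rcases hr with rfl | rfl <;> simp
  have hrr : r + 1 ≤ r := by rcases hr with rfl | rfl <;> simp
  rw [contDiffOn_clm_apply]
  rintro c u ⟨hu, huW⟩
  have hx := e.map_target hu
  have h1 : ContMDiffAt 𝓘(ℝ, E) (𝓘(ℝ, E).prod 𝓘(ℝ, E)) r
      (fun y => (Bundle.TotalSpace.mk' E y (fieldOf e (fun _ => c) y) : TangentBundle 𝓘(ℝ, E) M))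
      (e.symm u) :=
    ContMDiffAt.mpullback_vectorField_preimage (m := r)
      (contMDiffAt_vectorSpace_iff_contDiffAt.2 contDiffAt_const) (he.contMDiffAt hx)
      (he.isInvertible hr0 hx) hrr
  have h2 := ContMDiffAt.clm_bundle_apply ((hA _ huW).contMDiffAt (hW.mem_nhds huW)) h1
  have h3 := ContMDiffAt.mpullback_vectorField_preimage (m := r) (f := e.symm) h2
    (he.contMDiffAt_symm hu) (he.inverse_symm hr0 hu).1 hrr
  have h4 := contMDiffAt_vectorSpace_iff_contDiffAt.1 h3
  refine (h4.congr_of_eventuallyEq ?_).contDiffWithinAt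
  filter_upwards [e.open_target.mem_nhds hu] with v hv
  have h5 : mpullback 𝓘(ℝ, E₁ × E₂) 𝓘(ℝ, E) e.symm (fun m => A m (fieldOf e (fun _ => c) m)) v =
      components 𝓘(ℝ, E) e (e.symm v) (A (e.symm v) (fieldOf e (fun _ => c) (e.symm v))) := by
    rw [← (he.inverse_symm hr0 hv).2]; rfl
  refine Eq.trans ?_ h5.symm
  rw [he.components_apply hr0 A (e.map_target hv), he.components_fieldOf hr0 _ (e.map_target hv),
    e.right_inv hv]

/-- Naturality of the Lie bracket under the diffeomorphism `e`. -/
theorem IsCoordinateSystem.components_mlieBracket (hr : r = ∞ ∨ r = ω)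
    (he : IsCoordinateSystem 𝓘(ℝ, E) r e) {x : M} (hx : x ∈ e.source) {ξ η : E₁ × E₂ → E₁ × E₂}
    (hξ : ContDiffAt ℝ 1 ξ (e x)) (hη : ContDiffAt ℝ 1 η (e x)) :
    components 𝓘(ℝ, E) e x (mlieBracket 𝓘(ℝ, E) (fieldOf e ξ) (fieldOf e η) x) =
      lieBracket ℝ ξ η (e x) := by
  have hr0 : r ≠ 0 := by rcases hr with rfl | rfl <;> simp
  have : IsManifold 𝓘(ℝ, E) (minSmoothness ℝ 2) M := by
    rw [minSmoothness_of_isRCLikeNormedField]; infer_instance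
  have h2 : (minSmoothness ℝ 2 : ℕ∞ω) ≤ r := by
    rw [minSmoothness_of_isRCLikeNormedField]
    rcases hr with rfl | rfl
    · exact ENat.LEInfty.out
    · exact le_top
  have h := mpullback_mlieBracket (I := 𝓘(ℝ, E)) (I' := 𝓘(ℝ, E₁ × E₂)) (f := e) (x₀ := x) (V := ξ)
    (W := η) (n := r)
    ((contMDiffAt_vectorSpace_iff_contDiffAt.2 hξ).mdifferentiableAt one_ne_zero)
    ((contMDiffAt_vectorSpace_iff_contDiffAt.2 hη).mdifferentiableAt one_ne_zero)
    (he.contMDiffAt hx) h2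
  have h1 : mlieBracket 𝓘(ℝ, E) (fieldOf e ξ) (fieldOf e η) x =
      (components 𝓘(ℝ, E) e x).inverse (lieBracket ℝ ξ η (e x)) := by
    rw [← mlieBracket_vectorSpace]
    exact h.symm
  rw [h1, (he.isInvertible hr0 hx).self_apply_inverse]

/-- The pairing of operator fields on constant vector fields, computed in coordinates. -/
theorem IsCoordinateSystem.components_pairing (hr : r = ∞ ∨ r = ω)
    (he : IsCoordinateSystem 𝓘(ℝ, E) r e) {x : M} (hx : x ∈ e.source) {L A : OpField 𝓘(ℝ, E) M}
    (hL : ContDiffAt ℝ 1 (coordRep e L) (e x)) (hA : ContDiffAt ℝ 1 (coordRep e A) (e x)) (ξ η : E₁ × E₂) :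
    components 𝓘(ℝ, E) e x (pairing 𝓘(ℝ, E) L A (fieldOf e fun _ => ξ) (fieldOf e fun _ => η) x) =
      flatPairing (coordRep e L) (coordRep e A) (e x) ξ η := by
  have hr0 : r ≠ 0 := by rcases hr with rfl | rfl <;> simp
  have happ : ∀ (B : OpField 𝓘(ℝ, E) M) (c : E₁ × E₂),
      OpField.app 𝓘(ℝ, E) B (fieldOf e fun _ => c) =ᶠ[𝓝 x] fieldOf e fun u => coordRep e B u c :=
    fun B c => by
      filter_upwards [e.open_source.mem_nhds hx] with y hy
      exact he.app_fieldOf hr0 B _ hy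
  have hLd : ContDiffAt ℝ 1 (fun u => coordRep e L u ξ) (e x) := hL.clm_apply contDiffAt_const
  have hAd : ContDiffAt ℝ 1 (fun u => coordRep e A u η) (e x) := hA.clm_apply contDiffAt_const
  have hξ : ContDiffAt ℝ 1 (fun _ : E₁ × E₂ => ξ) (e x) := contDiffAt_const
  have hη : ContDiffAt ℝ 1 (fun _ : E₁ × E₂ => η) (e x) := contDiffAt_const
  have b₁ := (congrArg (components 𝓘(ℝ, E) e x) ((happ L ξ).mlieBracket_vectorField_eq
    (EventuallyEq.refl _ (fieldOf e fun _ => η)))).trans (he.components_mlieBracket hr hx hLd hη)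
  have b₂ := (congrArg (components 𝓘(ℝ, E) e x) (EventuallyEq.mlieBracket_vectorField_eq
    (EventuallyEq.refl _ (fieldOf e fun _ => ξ)) (happ A η))).trans
    (he.components_mlieBracket hr hx hξ hAd)
  have b₃ := (congrArg (components 𝓘(ℝ, E) e x) ((happ L ξ).mlieBracket_vectorField_eq
    (happ A η))).trans (he.components_mlieBracket hr hx hLd hAd)
  have b₄ := he.components_mlieBracket hr hx hξ hη
  rw [pairing]
  simp only [map_sub, map_add, he.components_apply hr0 _ hx]
  rw [b₁, b₂, b₃, b₄]
  have h1 := lieBracket_apply_left (η := fun _ => η) (hL.differentiableAt one_ne_zero)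
    (hξ.differentiableAt one_ne_zero)
  have h2 := lieBracket_apply_right (ξ := fun _ => ξ) (hA.differentiableAt one_ne_zero)
    (hη.differentiableAt one_ne_zero)
  have h3 := lieBracket_apply_apply (hL.differentiableAt one_ne_zero)
    (hA.differentiableAt one_ne_zero) (hξ.differentiableAt one_ne_zero)
    (hη.differentiableAt one_ne_zero)
  rw [h1, h2, h3, lieBracket, flatPairing]
  simp only [map_sub, map_add, fderiv_fun_const, Pi.zero_apply, zero_apply, map_zero]
  abel

/-- Closedness of a `1`-form, expressed in coordinates. -/
theorem IsCoordinateSystem.fderiv_symm_of_extDeriv_eq_zero (hr : r = ∞ ∨ r = ω)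
    (he : IsCoordinateSystem 𝓘(ℝ, E) r e) {x : M} (hx : x ∈ e.source) {θ : OneForm 𝓘(ℝ, E) M}
    {θ' : E₁ × E₂ → E₁ × E₂ →L[ℝ] ℝ} (hθ' : DifferentiableAt ℝ θ' (e x))
    (hθ : ∀ᶠ y in 𝓝 x, θ y = (θ' (e y)).comp (components 𝓘(ℝ, E) e y)) (ξ η : E₁ × E₂)
    (h : extDerivOneForm 𝓘(ℝ, E) θ (fieldOf e fun _ => ξ) (fieldOf e fun _ => η) x = 0) :
    fderiv ℝ θ' (e x) ξ η = fderiv ℝ θ' (e x) η ξ := by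
  have hr0 : r ≠ 0 := by rcases hr with rfl | rfl <;> simp
  have hev : ∀ c d : E₁ × E₂, differential 𝓘(ℝ, E) (fun y => θ y (fieldOf e (fun _ => c) y)) x
      (fieldOf e (fun _ => d) x) = fderiv ℝ θ' (e x) d c := by
    intro c d
    have hd := hθ'.hasFDerivAt.clm_apply (hasFDerivAt_const c (e x))
    have h1 := he.differential_eq hr0 hx (g := fun y => θ y (fieldOf e (fun _ => c) y))
      hd.differentiableAt (by
        filter_upwards [hθ, e.open_source.mem_nhds hx] with y hy hys
        rw [hy, ContinuousLinearMap.comp_apply, he.components_fieldOf hr0 _ hys])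
    rw [h1, ContinuousLinearMap.comp_apply, he.components_fieldOf hr0 _ hx, hd.fderiv]
    simp
  -- Coordinate fields commute, so the bracket term of the exterior derivative disappears.
  have hb : mlieBracket 𝓘(ℝ, E) (fieldOf e fun _ => ξ) (fieldOf e fun _ => η) x = 0 := by
    refine (he.isInvertible hr0 hx).injective ?_
    rw [he.components_mlieBracket hr hx contDiffAt_const contDiffAt_const, lieBracket]
    simp
  rw [extDerivOneForm, hev, hev, hb, map_zero, sub_zero, sub_eq_zero] at h
  exact h

end Coordinates

/-! ### Splitting an endomorphism by coprime factors of its characteristic polynomial. -/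

section PrimaryDecomposition

open Polynomial

variable {V : Type*} [AddCommGroup V] [Module ℝ V] [FiniteDimensional ℝ V]

/-- Over `ℂ` the roots of the characteristic polynomial are eigenvalues, hence roots of every
annihilating polynomial. A common root with `q` would be a common root of `p` and `q`. -/
theorem isCoprime_charpoly_of_aeval_eq_zero {T : V →ₗ[ℝ] V} {p q : ℝ[X]} (hpq : IsCoprime p q)
    (hp : aeval T p = 0) : IsCoprime T.charpoly q := by
  refine (isCoprime_iff_aeval_ne_zero_of_isAlgClosed ℝ ℂ _ _).2 fun z => ?_
  by_contra! h
  have h1 : (T.baseChange ℂ).charpoly.IsRoot z := by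
    rw [LinearMap.charpoly_baseChange, IsRoot.def, eval_map_algebraMap]
    exact h.1
  have h2 := (Module.End.hasEigenvalue_iff_isRoot_charpoly _ _).2 h1
  have h3 : aeval (T.baseChange ℂ) (p.map (algebraMap ℝ ℂ)) = 0 := by
    rw [aeval_map_algebraMap]
    have := aeval_algHom_apply (Module.End.baseChangeHom ℝ ℂ V) T p
    rw [hp, map_zero] at this
    exact this
  have h4 := (Module.End.isRoot_of_hasEigenvalue h2).dvd (minpoly.dvd ℂ _ h3)
  rw [IsRoot.def, eval_map_algebraMap] at h4
  rcases (isCoprime_iff_aeval_ne_zero_of_isAlgClosed ℝ ℂ p q).1 hpq z with h5 | h5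
  · exact h5 h4
  · exact h5 h.2

/-- Each of `p₁`, `q₁` divides the other by coprimality with the remaining factor. This identifies
the characteristic polynomials of the restrictions from their product alone. -/
theorem eq_of_mul_eq_mul_of_isCoprime {p₁ p₂ q₁ q₂ : ℝ[X]} (hp₁ : p₁.Monic)
    (hq₁ : q₁.Monic) (h : p₁ * p₂ = q₁ * q₂) (h₁ : IsCoprime p₁ q₂) (h₂ : IsCoprime p₂ q₁) :
    p₁ = q₁ ∧ p₂ = q₂ := by
  have e : p₁ = q₁ := eq_of_monic_of_associated hp₁ hq₁ (associated_of_dvd_dvd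
    (h₁.dvd_of_dvd_mul_right (h ▸ dvd_mul_right _ _))
    (h₂.symm.dvd_of_dvd_mul_right (h ▸ dvd_mul_right _ _)))
  subst e
  exact ⟨rfl, mul_left_cancel₀ hp₁.ne_zero h⟩

/-- The splitting of an operator given by coprime factors of the characteristic polynomial. -/
theorem exists_prodMap_of_charpoly_eq_mul {E₁ E₂ : Type*} [AddCommGroup E₁] [Module ℝ E₁]
    [FiniteDimensional ℝ E₁] [AddCommGroup E₂] [Module ℝ E₂] [FiniteDimensional ℝ E₂]
    {T : V →ₗ[ℝ] V} {χ₁ χ₂ : ℝ[X]}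
    (hχ₁ : χ₁.Monic) (hχ : IsCoprime χ₁ χ₂) (hT : T.charpoly = χ₁ * χ₂)
    (hE₁ : Module.finrank ℝ E₁ = χ₁.natDegree) (hE₂ : Module.finrank ℝ E₂ = χ₂.natDegree) :
    ∃ (ψ : V ≃ₗ[ℝ] E₁ × E₂) (A₀ : E₁ →ₗ[ℝ] E₁) (D₀ : E₂ →ₗ[ℝ] E₂),
      (∀ v, ψ (T v) = (A₀ (ψ v).1, D₀ (ψ v).2)) ∧ A₀.charpoly = χ₁ ∧ D₀.charpoly = χ₂ := by
  set K₁ := LinearMap.ker (aeval T χ₁)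
  set K₂ := LinearMap.ker (aeval T χ₂)
  have hK : IsCompl K₁ K₂ := ⟨disjoint_ker_aeval_of_isCoprime T hχ, by
    rw [codisjoint_iff, sup_ker_aeval_eq_ker_aeval_mul_of_coprime T hχ, ← hT,
      LinearMap.aeval_self_charpoly, LinearMap.ker_zero]⟩
  have hinv : ∀ (s : ℝ[X]), ∀ x ∈ LinearMap.ker (aeval T s), T x ∈ LinearMap.ker (aeval T s) := by
    intro s x hx
    rw [LinearMap.mem_ker] at hx ⊢
    have h : aeval T s * T = T * aeval T s := by
      have := congrArg (aeval T) (mul_comm s X)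
      simpa using this
    rw [← Module.End.mul_apply, h, Module.End.mul_apply, hx, map_zero]
  let T₁ : K₁ →ₗ[ℝ] K₁ := T.restrict (hinv χ₁)
  let T₂ : K₂ →ₗ[ℝ] K₂ := T.restrict (hinv χ₂)
  have ha : ∀ s : ℝ[X], aeval (T.restrict (hinv s)) s = 0 := by
    intro s
    ext x
    have h1 : ∀ t : ℝ[X], ((aeval (T.restrict (hinv s)) t x : LinearMap.ker (aeval T s)) : V) =
        aeval T t x := by
      intro t
      induction t using Polynomial.induction_on' with
      | add t t' h h' => simp [h, h']
      | monomial n c =>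
        simp only [aeval_monomial, Module.End.mul_apply, Module.algebraMap_end_apply,
          Submodule.coe_smul]
        rw [Module.End.pow_restrict n]
        rfl
    rw [h1]
    exact x.2
  let e := Submodule.prodEquivOfIsCompl K₁ K₂ hK
  have he : e.symm.conj T = T₁.prodMap T₂ := by
    refine LinearMap.ext fun w => ?_
    rw [LinearEquiv.conj_apply_apply, LinearEquiv.symm_apply_eq, LinearEquiv.symm_symm]
    simp [e, T₁, T₂, Submodule.coe_prodEquivOfIsCompl']
  have hmul : T₁.charpoly * T₂.charpoly = χ₁ * χ₂ := by
    rw [← LinearMap.charpoly_prodMap, ← he, LinearEquiv.charpoly_conj, hT]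
  obtain ⟨c₁, c₂⟩ := eq_of_mul_eq_mul_of_isCoprime T₁.charpoly_monic hχ₁ hmul
    (isCoprime_charpoly_of_aeval_eq_zero hχ (ha χ₁))
    (isCoprime_charpoly_of_aeval_eq_zero hχ.symm (ha χ₂))
  -- The dimension of the kernel is the degree of its characteristic polynomial, now known to be
  -- `χ₁`.
  let φ₁ : K₁ ≃ₗ[ℝ] E₁ := LinearEquiv.ofFinrankEq _ _ (by
    rw [hE₁, ← c₁, LinearMap.charpoly_natDegree])
  let φ₂ : K₂ ≃ₗ[ℝ] E₂ := LinearEquiv.ofFinrankEq _ _ (by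
    rw [hE₂, ← c₂, LinearMap.charpoly_natDegree])
  refine ⟨e.symm.trans (φ₁.prodCongr φ₂), φ₁.conj T₁, φ₂.conj T₂, fun v => ?_,
    by rw [LinearEquiv.charpoly_conj, c₁], by rw [LinearEquiv.charpoly_conj, c₂]⟩
  have h2 := congrArg (fun S => S (e.symm v)) he
  simp only [LinearEquiv.conj_apply_apply, LinearEquiv.symm_symm, LinearEquiv.apply_symm_apply,
    LinearMap.prodMap_apply] at h2
  simp [LinearEquiv.conj_apply_apply, h2]

end PrimaryDecomposition

/-! ### Split operator fields over a product of connected open sets. -/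

section SplitsOn

variable {E₁ E₂ : Type*} [NormedAddCommGroup E₁] [NormedSpace ℝ E₁]
  [NormedAddCommGroup E₂] [NormedSpace ℝ E₂] {r : ℕ∞ω}
  {L A : E₁ × E₂ → E₁ × E₂ →L[ℝ] E₁ × E₂} {L₁ A₁ : E₁ → E₁ →L[ℝ] E₁} {L₂ A₂ : E₂ → E₂ →L[ℝ] E₂}
  {V₁ : Set E₁} {V₂ : Set E₂}

/-- On `V₁ × V₂` the operator field `L` has the form `diag(L₁(u₁), L₂(u₂))`, and all these operator
fields are of class `C^r`. -/
structure SplitsOn (r : ℕ∞ω) (L : E₁ × E₂ → E₁ × E₂ →L[ℝ] E₁ × E₂) (L₁ : E₁ → E₁ →L[ℝ] E₁)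
    (L₂ : E₂ → E₂ →L[ℝ] E₂) (V₁ : Set E₁) (V₂ : Set E₂) : Prop where
  contDiffOn : ContDiffOn ℝ r L (V₁ ×ˢ V₂)
  contDiffOn₁ : ContDiffOn ℝ r L₁ V₁
  contDiffOn₂ : ContDiffOn ℝ r L₂ V₂
  eq : ∀ u ∈ V₁ ×ˢ V₂, L u = (L₁ u.1).prodMap (L₂ u.2)

theorem SplitsOn.mono (h : SplitsOn r L L₁ L₂ V₁ V₂) {W₁ : Set E₁} {W₂ : Set E₂} (h₁ : W₁ ⊆ V₁)
    (h₂ : W₂ ⊆ V₂) : SplitsOn r L L₁ L₂ W₁ W₂ :=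
  ⟨h.contDiffOn.mono (Set.prod_mono h₁ h₂), h.contDiffOn₁.mono h₁, h.contDiffOn₂.mono h₂,
    fun u hu => h.eq u (Set.prod_mono h₁ h₂ hu)⟩

theorem SplitsOn.eventually_eq (h : SplitsOn r L L₁ L₂ V₁ V₂) (hV₁ : IsOpen V₁) (hV₂ : IsOpen V₂)
    {u : E₁ × E₂} (hu : u ∈ V₁ ×ˢ V₂) : ∀ᶠ u' in 𝓝 u, L u' = (L₁ u'.1).prodMap (L₂ u'.2) := by
  filter_upwards [(hV₁.prod hV₂).mem_nhds hu] with u' hu' using h.eq u' hu'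

theorem SplitsOn.differentiableAt (h : SplitsOn r L L₁ L₂ V₁ V₂) (hr : r ≠ 0) (hV₁ : IsOpen V₁)
    (hV₂ : IsOpen V₂) {u : E₁ × E₂} (hu : u ∈ V₁ ×ˢ V₂) :
    DifferentiableAt ℝ L u ∧ DifferentiableAt ℝ L₁ u.1 ∧ DifferentiableAt ℝ L₂ u.2 :=
  ⟨(h.contDiffOn.contDiffAt ((hV₁.prod hV₂).mem_nhds hu)).differentiableAt hr,
    (h.contDiffOn₁.contDiffAt (hV₁.mem_nhds hu.1)).differentiableAt hr,
    (h.contDiffOn₂.contDiffAt (hV₂.mem_nhds hu.2)).differentiableAt hr⟩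

theorem SplitsOn.flatPairing_eq (hL : SplitsOn r L L₁ L₂ V₁ V₂) (hA : SplitsOn r A A₁ A₂ V₁ V₂)
    (hr : r ≠ 0) (hV₁ : IsOpen V₁) (hV₂ : IsOpen V₂) {u : E₁ × E₂} (hu : u ∈ V₁ ×ˢ V₂)
    (ξ η : E₁ × E₂) : flatPairing L A u ξ η =
      (flatPairing L₁ A₁ u.1 ξ.1 η.1, flatPairing L₂ A₂ u.2 ξ.2 η.2) := by
  obtain ⟨a, a₁, a₂⟩ := hL.differentiableAt hr hV₁ hV₂ hu
  obtain ⟨b, b₁, b₂⟩ := hA.differentiableAt hr hV₁ hV₂ hu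
  exact flatPairing_of_eventually_prodMap (hL.eventually_eq hV₁ hV₂ hu)
    (hA.eventually_eq hV₁ hV₂ hu) a a₁ a₂ b b₁ b₂ ξ η

theorem SplitsOn.fderiv_block_eq_zero (h : SplitsOn r L L₁ L₂ V₁ V₂) (hr : r ≠ 0)
    (hV₁ : IsOpen V₁) (hV₂ : IsOpen V₂) {u : E₁ × E₂} (hu : u ∈ V₁ ×ˢ V₂) :
    (∀ x y, (fderiv ℝ L u (0, y) (x, 0)).1 = 0) ∧ ∀ x y, (fderiv ℝ L u (x, 0) (0, y)).2 = 0 := by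
  obtain ⟨a, a₁, a₂⟩ := h.differentiableAt hr hV₁ hV₂ hu
  have h1 := fderiv_of_eventually_prodMap (h.eventually_eq hV₁ hV₂ hu) a a₁ a₂
  exact ⟨fun x y => by simp [h1], fun x y => by simp [h1]⟩

theorem exists_splitsOn_of_fderiv_block (hr : r ≠ 0) (hV₁ : IsOpen V₁) (hV₂ : IsOpen V₂)
    (hV₁' : IsConnected V₁) (hV₂' : IsConnected V₂) (hA : ContDiffOn ℝ r A (V₁ ×ˢ V₂))
    (hdiag : ∀ u ∈ V₁ ×ˢ V₂, IsBlockDiag (A u))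
    (h : ∀ u ∈ V₁ ×ˢ V₂, (∀ x y, (fderiv ℝ A u (0, y) (x, 0)).1 = 0) ∧
      ∀ x y, (fderiv ℝ A u (x, 0) (0, y)).2 = 0) :
    ∃ A₁ A₂, SplitsOn r A A₁ A₂ V₁ V₂ := by
  obtain ⟨a, ha⟩ := hV₁'.1
  obtain ⟨b, hb⟩ := hV₂'.1
  -- Each block is read off on the slice where the other variable is frozen at a base point.
  refine ⟨fun x => block₁ (A (x, b)), fun y => block₂ (A (a, y)), hA, ?_, ?_,
    eq_prodMap_of_fderiv_block hV₁ hV₂ hV₁'.isPreconnected hV₂'.isPreconnected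
      (fun u hu => (hA.contDiffAt ((hV₁.prod hV₂).mem_nhds hu)).differentiableAt hr) hdiag h ha hb⟩
  · exact contDiff_block₁.comp_contDiffOn (hA.comp (contDiffOn_id.prodMk contDiffOn_const)
      fun x hx => ⟨hx, hb⟩)
  · exact contDiff_block₂.comp_contDiffOn (hA.comp (contDiffOn_const.prodMk contDiffOn_id)
      fun y hy => ⟨ha, hy⟩)

theorem exists_splitsOn_of_nijenhuis (hr : r ≠ 0) (hV₁ : IsOpen V₁) (hV₂ : IsOpen V₂)
    (hV₁' : IsConnected V₁) (hV₂' : IsConnected V₂) (hL : ContDiffOn ℝ r L (V₁ ×ˢ V₂))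
    (hdiag : ∀ u ∈ V₁ ×ˢ V₂, IsBlockDiag (L u))
    (hN : ∀ u ∈ V₁ ×ˢ V₂, ∀ ξ η, flatPairing L L u ξ η = 0)
    (h : ∀ u ∈ V₁ ×ˢ V₂, NoIntertwiner (block₁ (L u)) (block₂ (L u)))
    (h' : ∀ u ∈ V₁ ×ˢ V₂, NoIntertwiner (block₂ (L u)) (block₁ (L u))) :
    ∃ L₁ L₂, SplitsOn r L L₁ L₂ V₁ V₂ := by
  refine exists_splitsOn_of_fderiv_block hr hV₁ hV₂ hV₁' hV₂' hL hdiag fun u hu => ?_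
  have hn := (hV₁.prod hV₂).mem_nhds hu
  exact fderiv_block_eq_zero_of_nijenhuis ((hL.contDiffAt hn).differentiableAt hr)
    (by filter_upwards [hn] with u' hu' using hdiag u' hu') (hN u hu) (h u hu) (h' u hu)

theorem SplitsOn.isBlockDiag (h : SplitsOn r L L₁ L₂ V₁ V₂) {u : E₁ × E₂} (hu : u ∈ V₁ ×ˢ V₂) :
    IsBlockDiag (L u) := by
  rw [h.eq u hu]
  exact isBlockDiag_prodMap _ _

theorem SplitsOn.exists_of_symmetry (hL : SplitsOn r L L₁ L₂ V₁ V₂) (hr : r ≠ 0) (hV₁ : IsOpen V₁)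
    (hV₂ : IsOpen V₂) (hV₁' : IsConnected V₁) (hV₂' : IsConnected V₂)
    (h : ∀ u ∈ V₁ ×ˢ V₂, NoIntertwiner (block₁ (L u)) (block₂ (L u)))
    (h' : ∀ u ∈ V₁ ×ˢ V₂, NoIntertwiner (block₂ (L u)) (block₁ (L u)))
    (hA : ContDiffOn ℝ r A (V₁ ×ˢ V₂)) (hc : ∀ u ∈ V₁ ×ˢ V₂, ∀ v, L u (A u v) = A u (L u v))
    (hs : ∀ u ∈ V₁ ×ˢ V₂, ∀ ξ, flatPairing L A u ξ ξ = 0) :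
    ∃ A₁ A₂, SplitsOn r A A₁ A₂ V₁ V₂ ∧
      (∀ x ∈ V₁, ∀ v, L₁ x (A₁ x v) = A₁ x (L₁ x v)) ∧
      ∀ y ∈ V₂, ∀ v, L₂ y (A₂ y v) = A₂ y (L₂ y v) := by
  have hd : ∀ u ∈ V₁ ×ˢ V₂, IsBlockDiag (A u) := fun u hu =>
    isBlockDiag_of_commute (hL.isBlockDiag hu) (h u hu) (h' u hu) (hc u hu)
  obtain ⟨A₁, A₂, hA'⟩ := exists_splitsOn_of_fderiv_block hr hV₁ hV₂ hV₁' hV₂' hA hd fun u hu => by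
    have hn := (hV₁.prod hV₂).mem_nhds hu
    obtain ⟨h₁, h₂⟩ := hL.fderiv_block_eq_zero hr hV₁ hV₂ hu
    exact fderiv_block_eq_zero_of_symmetry (hL.differentiableAt hr hV₁ hV₂ hu).1
      ((hA.contDiffAt hn).differentiableAt hr)
      (by filter_upwards [hn] with u' hu' using hL.isBlockDiag hu')
      (by filter_upwards [hn] with u' hu' using hd u' hu') h₁ h₂ (hs u hu) (h u hu) (h' u hu)
  obtain ⟨a, ha⟩ := hV₁'.1
  obtain ⟨b, hb⟩ := hV₂'.1
  refine ⟨A₁, A₂, hA', fun x hx v => ?_, fun y hy v => ?_⟩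
  · have h1 := hc (x, b) ⟨hx, hb⟩ (v, 0)
    rw [hL.eq _ ⟨hx, hb⟩, hA'.eq _ ⟨hx, hb⟩] at h1
    exact congrArg Prod.fst h1
  · have h1 := hc (a, y) ⟨ha, hy⟩ (0, v)
    rw [hL.eq _ ⟨ha, hy⟩, hA'.eq _ ⟨ha, hy⟩] at h1
    exact congrArg Prod.snd h1

/-- This antisymmetry under exchange of operators and arguments shows that strong symmetries are
symmetries, so their splitting needs no separate argument. -/
theorem flatPairing_swap {E : Type*} [NormedAddCommGroup E] [NormedSpace ℝ E]
    (L A : E → E →L[ℝ] E) (u ξ η : E) : flatPairing L A u ξ η = - flatPairing A L u η ξ := by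
  rw [flatPairing, flatPairing]
  abel

/-- A function whose differential is a conservation law of a split operator field separates. -/
theorem SplitsOn.exists_of_conservationLaw (hL : SplitsOn r L L₁ L₂ V₁ V₂) (hr : 2 ≤ r)
    (hV₁ : IsOpen V₁) (hV₂ : IsOpen V₂) (hV₁' : IsConnected V₁) (hV₂' : IsConnected V₂)
    (h : ∀ u ∈ V₁ ×ˢ V₂, NoIntertwiner (block₁ (L u)) (transposeL (block₂ (L u))))
    {f : E₁ × E₂ → ℝ} (hf : ContDiffOn ℝ r f (V₁ ×ˢ V₂))
    (hc : ∀ u ∈ V₁ ×ˢ V₂, ∀ ξ η, fderiv ℝ (fun u => (fderiv ℝ f u).comp (L u)) u ξ η =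
      fderiv ℝ (fun u => (fderiv ℝ f u).comp (L u)) u η ξ) :
    ∃ (f₁ : E₁ → ℝ) (f₂ : E₂ → ℝ), ContDiffOn ℝ r f₁ V₁ ∧ ContDiffOn ℝ r f₂ V₂ ∧
      (∀ x ∈ V₁, ∀ ξ η, fderiv ℝ (fun x => (fderiv ℝ f₁ x).comp (L₁ x)) x ξ η =
        fderiv ℝ (fun x => (fderiv ℝ f₁ x).comp (L₁ x)) x η ξ) ∧
      (∀ y ∈ V₂, ∀ ξ η, fderiv ℝ (fun y => (fderiv ℝ f₂ y).comp (L₂ y)) y ξ η =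
        fderiv ℝ (fun y => (fderiv ℝ f₂ y).comp (L₂ y)) y η ξ) ∧
      ∀ u ∈ V₁ ×ˢ V₂, ∀ ξ, fderiv ℝ f u ξ = fderiv ℝ f₁ u.1 ξ.1 + fderiv ℝ f₂ u.2 ξ.2 := by
  obtain ⟨a, ha⟩ := hV₁'.1
  obtain ⟨b, hb⟩ := hV₂'.1
  have hr0 : r ≠ 0 := by rintro rfl; simp at hr
  have hf2 : ∀ u ∈ V₁ ×ˢ V₂, ContDiffAt ℝ 2 f u := fun u hu =>
    (hf.contDiffAt ((hV₁.prod hV₂).mem_nhds hu)).of_le hr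
  have hf1 : ∀ u ∈ V₁ ×ˢ V₂, DifferentiableAt ℝ f u := fun u hu =>
    (hf2 u hu).differentiableAt (by norm_num)
  have hdf : ∀ u ∈ V₁ ×ˢ V₂, DifferentiableAt ℝ (fderiv ℝ f) u := fun u hu =>
    ((hf2 u hu).fderiv_right (m := 1) (by norm_num)).differentiableAt (by norm_num)
  have hsym : ∀ u ∈ V₁ ×ˢ V₂, ∀ ξ η, fderiv ℝ (fderiv ℝ f) u ξ η = fderiv ℝ (fderiv ℝ f) u η ξ :=
    fun u hu ξ η => ((hf2 u hu).isSymmSndFDerivAt (by simp)) _ _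
  have hmix : ∀ u ∈ V₁ ×ˢ V₂, ∀ x y, fderiv ℝ (fderiv ℝ f) u (x, 0) (0, y) = 0 :=
    fun u hu x y => by
      obtain ⟨h₁, h₂⟩ := hL.fderiv_block_eq_zero hr0 hV₁ hV₂ hu
      exact mixed_fderiv_eq_zero (hL.differentiableAt hr0 hV₁ hV₂ hu).1 (hdf u hu) (hsym u hu)
        (by filter_upwards [(hV₁.prod hV₂).mem_nhds hu] with u' hu' using hL.isBlockDiag hu')
        h₁ h₂ (hc u hu) (h u hu) x y
  have hd₁ : ∀ x ∈ V₁, fderiv ℝ (fun x => f (x, b)) x =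
      (fderiv ℝ f (x, b)).comp (ContinuousLinearMap.inl ℝ E₁ E₂) := fun x hx =>
    ((hf1 (x, b) ⟨hx, hb⟩).hasFDerivAt.comp x (hasFDerivAt_prodMk_left x b)).fderiv
  have hd₂ : ∀ y ∈ V₂, fderiv ℝ (fun y => f (a, y)) y =
      (fderiv ℝ f (a, y)).comp (ContinuousLinearMap.inr ℝ E₁ E₂) := fun y hy =>
    ((hf1 (a, y) ⟨ha, hy⟩).hasFDerivAt.comp y (hasFDerivAt_prodMk_right a y)).fderiv
  have hθ : ∀ u ∈ V₁ ×ˢ V₂, DifferentiableAt ℝ (fun u => (fderiv ℝ f u).comp (L u)) u :=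
    fun u hu => (hdf u hu).clm_comp (hL.differentiableAt hr0 hV₁ hV₂ hu).1
  refine ⟨fun x => f (x, b), fun y => f (a, y),
    hf.comp (contDiffOn_id.prodMk contDiffOn_const) fun x hx => ⟨hx, hb⟩,
    hf.comp (contDiffOn_const.prodMk contDiffOn_id) fun y hy => ⟨ha, hy⟩,
    fun x hx => ?_, fun y hy => ?_, fun u hu ξ => ?_⟩
  -- Because `L` preserves the first factor, `L₁^*df₁` is the restriction of `L^*df` to the slice
  -- `u₂ = b`, and restrictions of closed forms are closed.
  · have h1 : (fun x => (fderiv ℝ (fun x => f (x, b)) x).comp (L₁ x)) =ᶠ[𝓝 x]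
        fun x => ((fderiv ℝ f (x, b)).comp (L (x, b))).comp (ContinuousLinearMap.inl ℝ E₁ E₂) := by
      filter_upwards [hV₁.mem_nhds hx] with x' hx'
      ext v
      simp only [hd₁ x' hx', hL.eq (x', b) ⟨hx', hb⟩, ContinuousLinearMap.comp_apply]
      congr 1
      simp [ContinuousLinearMap.prodMap]
    have h0 : HasFDerivAt (fun x => (fderiv ℝ f (x, b)).comp (L (x, b)))
        ((fderiv ℝ (fun u => (fderiv ℝ f u).comp (L u)) (x, b)).comp
          (ContinuousLinearMap.inl ℝ E₁ E₂)) x :=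
      HasFDerivAt.comp (g := fun u => (fderiv ℝ f u).comp (L u)) x
        (hθ (x, b) ⟨hx, hb⟩).hasFDerivAt (hasFDerivAt_prodMk_left x b)
    have h2 := h0.clm_comp (hasFDerivAt_const (ContinuousLinearMap.inl ℝ E₁ E₂) x)
    intro ξ η
    have h3 : ∀ ξ η, fderiv ℝ (fun x => (fderiv ℝ (fun x => f (x, b)) x).comp (L₁ x)) x ξ η =
        fderiv ℝ (fun u => (fderiv ℝ f u).comp (L u)) (x, b) (ξ, 0) (η, 0) := fun ξ η => by
      rw [h1.fderiv_eq]
      refine (congrArg (fun T => T ξ η) h2.fderiv).trans ?_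
      simp
    rw [h3, h3]
    exact hc _ ⟨hx, hb⟩ _ _
  · have h1 : (fun y => (fderiv ℝ (fun y => f (a, y)) y).comp (L₂ y)) =ᶠ[𝓝 y]
        fun y => ((fderiv ℝ f (a, y)).comp (L (a, y))).comp (ContinuousLinearMap.inr ℝ E₁ E₂) := by
      filter_upwards [hV₂.mem_nhds hy] with y' hy'
      ext v
      simp only [hd₂ y' hy', hL.eq (a, y') ⟨ha, hy'⟩, ContinuousLinearMap.comp_apply]
      congr 1
      simp [ContinuousLinearMap.prodMap]
    have h0 : HasFDerivAt (fun y => (fderiv ℝ f (a, y)).comp (L (a, y)))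
        ((fderiv ℝ (fun u => (fderiv ℝ f u).comp (L u)) (a, y)).comp
          (ContinuousLinearMap.inr ℝ E₁ E₂)) y :=
      HasFDerivAt.comp (g := fun u => (fderiv ℝ f u).comp (L u)) y
        (hθ (a, y) ⟨ha, hy⟩).hasFDerivAt (hasFDerivAt_prodMk_right a y)
    have h2 := h0.clm_comp (hasFDerivAt_const (ContinuousLinearMap.inr ℝ E₁ E₂) y)
    intro ξ η
    have h3 : ∀ ξ η, fderiv ℝ (fun y => (fderiv ℝ (fun y => f (a, y)) y).comp (L₂ y)) y ξ η =
        fderiv ℝ (fun u => (fderiv ℝ f u).comp (L u)) (a, y) (0, ξ) (0, η) := fun ξ η => by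
      rw [h1.fderiv_eq]
      refine (congrArg (fun T => T ξ η) h2.fderiv).trans ?_
      simp
    rw [h3, h3]
    exact hc _ ⟨ha, hy⟩ _ _
  -- Vanishing mixed derivatives make each partial differential of `f` independent of the other
  -- variable, so it may be evaluated on the frozen slice.
  · have h1 : fderiv ℝ f (u.1, u.2) (ξ.1, 0) = fderiv ℝ f (u.1, b) (ξ.1, 0) :=
      eq_of_fderiv_inr_eq_zero (f := fun u => fderiv ℝ f u (ξ.1, 0)) hV₂ hV₂'.isPreconnected
        (fun y hy => (hasFDerivAt_eval (hdf (u.1, y) ⟨hu.1, hy⟩) _).differentiableAt)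
        (fun y hy η => by
          rw [(hasFDerivAt_eval (hdf (u.1, y) ⟨hu.1, hy⟩) _).fderiv,
            ContinuousLinearMap.flip_apply, hsym (u.1, y) ⟨hu.1, hy⟩]
          exact hmix (u.1, y) ⟨hu.1, hy⟩ _ _) hu.2 hb
    have h2 : fderiv ℝ f (u.1, u.2) (0, ξ.2) = fderiv ℝ f (a, u.2) (0, ξ.2) :=
      eq_of_fderiv_inl_eq_zero (f := fun u => fderiv ℝ f u (0, ξ.2)) hV₁ hV₁'.isPreconnected
        (fun x hx => (hasFDerivAt_eval (hdf (x, u.2) ⟨hx, hu.2⟩) _).differentiableAt)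
        (fun x hx η => by
          rw [(hasFDerivAt_eval (hdf (x, u.2) ⟨hx, hu.2⟩) _).fderiv,
            ContinuousLinearMap.flip_apply]
          exact hmix (x, u.2) ⟨hx, hu.2⟩ _ _) hu.1 ha
    rw [hd₁ _ hu.1, hd₂ _ hu.2]
    have h3 : ξ = (ξ.1, 0) + (0, ξ.2) := by simp
    rw [h3, map_add]
    simpa using congrArg₂ (· + ·) h1 h2

end SplitsOn

/-! ### From conditions on the manifold to conditions on coordinate representations. -/

section Transfer

variable {E : Type*} [NormedAddCommGroup E] [NormedSpace ℝ E] [CompleteSpace E]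
  {M : Type*} [TopologicalSpace M] [ChartedSpace E M] [IsManifold 𝓘(ℝ, E) ∞ M]
  {E₁ E₂ : Type*} [NormedAddCommGroup E₁] [NormedSpace ℝ E₁]
  [NormedAddCommGroup E₂] [NormedSpace ℝ E₂] {r : ℕ∞ω}
  {e : OpenPartialHomeomorph M (E₁ × E₂)} {L A : OpField 𝓘(ℝ, E) M} {W : Set M}

theorem IsCoordinateSystem.flatPairing_eq_zero_of_torsion (hr : r = ∞ ∨ r = ω)
    (he : IsCoordinateSystem 𝓘(ℝ, E) r e) (hL : IsNijenhuisOn 𝓘(ℝ, E) r L W) {x : M}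
    (hx : x ∈ e.source) (hxW : x ∈ W) (hd : ContDiffAt ℝ 1 (coordRep e L) (e x)) (ξ η : E₁ × E₂) :
    flatPairing (coordRep e L) (coordRep e L) (e x) ξ η = 0 := by
  have h := hL.torsion_eq_zero x hxW _ _ (he.smoothAt_const hr ξ hx) (he.smoothAt_const hr η hx)
  rw [torsion_eq_neg_pairing, neg_eq_zero] at h
  rw [← he.components_pairing hr hx hd hd, h, map_zero]

theorem IsCoordinateSystem.flatPairing_self_eq_zero_of_symmetry (hr : r = ∞ ∨ r = ω)
    (he : IsCoordinateSystem 𝓘(ℝ, E) r e) (hA : IsSymmetryOn 𝓘(ℝ, E) r L A W) {x : M}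
    (hx : x ∈ e.source) (hxW : x ∈ W) (hd : ContDiffAt ℝ 1 (coordRep e L) (e x))
    (hd' : ContDiffAt ℝ 1 (coordRep e A) (e x)) (ξ : E₁ × E₂) :
    flatPairing (coordRep e L) (coordRep e A) (e x) ξ ξ = 0 := by
  have h := hA.pairing_self x hxW _ (he.smoothAt_const hr ξ hx)
  rw [← he.components_pairing hr hx hd hd', h, map_zero]

theorem IsCoordinateSystem.flatPairing_eq_zero_of_strongSymmetry (hr : r = ∞ ∨ r = ω)
    (he : IsCoordinateSystem 𝓘(ℝ, E) r e) (hA : IsStrongSymmetryOn 𝓘(ℝ, E) r L A W) {x : M}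
    (hx : x ∈ e.source) (hxW : x ∈ W) (hd : ContDiffAt ℝ 1 (coordRep e L) (e x))
    (hd' : ContDiffAt ℝ 1 (coordRep e A) (e x)) (ξ η : E₁ × E₂) :
    flatPairing (coordRep e A) (coordRep e L) (e x) ξ η = 0 := by
  have h := hA.pairing_eq_zero x hxW _ _ (he.smoothAt_const hr ξ hx) (he.smoothAt_const hr η hx)
  rw [← he.components_pairing hr hx hd' hd, h, map_zero]

theorem IsCoordinateSystem.fderiv_symm_of_conservationLaw (hr : r = ∞ ∨ r = ω)
    (he : IsCoordinateSystem 𝓘(ℝ, E) r e) {f : M → ℝ} (hW : IsOpen W)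
    (hf : ContMDiffOn 𝓘(ℝ, E) 𝓘(ℝ, ℝ) r f W)
    (hc : IsConservationLawOn 𝓘(ℝ, E) L (differential 𝓘(ℝ, E) f) W) {x : M}
    (hx : x ∈ e.source) (hxW : x ∈ W) (hd : DifferentiableAt ℝ (coordRep e L) (e x))
    (ξ η : E₁ × E₂) :
    fderiv ℝ (fun u => (fderiv ℝ (f ∘ e.symm) u).comp (coordRep e L u)) (e x) ξ η =
      fderiv ℝ (fun u => (fderiv ℝ (f ∘ e.symm) u).comp (coordRep e L u)) (e x) η ξ := by
  have hr0 : r ≠ 0 := by rcases hr with rfl | rfl <;> simp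
  have hr2 : 2 ≤ r := by
    rcases hr with rfl | rfl
    · exact ENat.LEInfty.out
    · exact le_top
  have hfc : ∀ y ∈ e.source, y ∈ W → ContDiffAt ℝ r (f ∘ e.symm) (e y) := fun y hy hyW => by
    refine ContMDiffAt.contDiffAt ?_
    refine ContMDiffAt.comp (e y) (I' := 𝓘(ℝ, E)) ?_ (he.contMDiffAt_symm (e.map_source hy))
    rw [e.left_inv hy]
    exact (hf y hyW).contMDiffAt (hW.mem_nhds hyW)
  refine he.fderiv_symm_of_extDeriv_eq_zero hr hx (θ := OneForm.pull 𝓘(ℝ, E) L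
    (differential 𝓘(ℝ, E) f)) ?_ ?_ ξ η (hc.2 x hxW _ _ (he.smoothAt_const hr ξ hx)
      (he.smoothAt_const hr η hx))
  · refine DifferentiableAt.clm_comp ?_ hd
    exact (((hfc x hx hxW).of_le hr2).fderiv_right (m := 1) (by norm_num)).differentiableAt
      (by norm_num)
  · filter_upwards [e.open_source.mem_nhds hx, hW.mem_nhds hxW] with y hy hyW
    have h1 := he.differential_eq hr0 hy (g := f) ((hfc y hy hyW).differentiableAt hr0) (by
      filter_upwards [e.open_source.mem_nhds hy] with z hz
      rw [Function.comp_apply, e.left_inv hz])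
    refine ContinuousLinearMap.ext fun v => ?_
    rw [OneForm.pull, h1]
    simp only [ContinuousLinearMap.comp_apply]
    rw [he.components_apply hr0 L hy]

end Transfer

/-! ### Construction and composition of coordinate systems. -/

section Straightening

variable {E : Type*} [NormedAddCommGroup E] [NormedSpace ℝ E]
  {M : Type*} [TopologicalSpace M] [ChartedSpace E M]
  {E₁ E₂ : Type*} [NormedAddCommGroup E₁] [NormedSpace ℝ E₁]
  [NormedAddCommGroup E₂] [NormedSpace ℝ E₂] {r : ℕ∞ω}
  {e : OpenPartialHomeomorph M (E₁ × E₂)}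

/-- There are coordinates centred at a point with any prescribed differential there. -/
theorem exists_coordinateSystem [IsManifold 𝓘(ℝ, E) r M] (hr : r ≠ 0) (p : M) (ψ : E ≃L[ℝ] E₁ × E₂) :
    ∃ e : OpenPartialHomeomorph M (E₁ × E₂), p ∈ e.source ∧ IsCoordinateSystem 𝓘(ℝ, E) r e ∧
      e p = 0 ∧ components 𝓘(ℝ, E) e p = (ψ : E →L[ℝ] E₁ × E₂) := by
  have hM : IsManifold 𝓘(ℝ, E) 1 M := IsManifold.of_le (ENat.one_le_iff_ne_zero_withTop.2 hr)
  have hp := mem_chart_source E p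
  have hd : (chartAt E p).MDifferentiable 𝓘(ℝ, E) 𝓘(ℝ, E) :=
    mdifferentiable_chart p
  let c : E ≃L[ℝ] E := hd.mfderiv hp
  -- Undoing the differential of the chart first makes the final differential at `p` equal to `ψ`.
  let φ : E ≃L[ℝ] E₁ × E₂ := c.symm.trans ψ
  let t : E ≃ₜ E₁ × E₂ := φ.toHomeomorph.trans (Homeomorph.subRight (φ (chartAt E p p)))
  have ht : ContDiff ℝ r t := φ.contDiff.sub contDiff_const
  have ht' : ContDiff ℝ r t.symm := φ.symm.contDiff.comp (contDiff_id.add contDiff_const)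
  refine ⟨(chartAt E p).transHomeomorph t, hp, ⟨?_, ?_⟩, ?_, ?_⟩
  · exact ht.contMDiff.comp_contMDiffOn (contMDiffOn_chart (I := 𝓘(ℝ, E)))
  · exact (contMDiffOn_chart_symm (I := 𝓘(ℝ, E)) (x := p)).comp ht'.contMDiff.contMDiffOn
      fun u hu => hu
  · simp [t]
  · have h1 : HasFDerivAt t (φ : E →L[ℝ] E₁ × E₂) (chartAt E p p) :=
      φ.hasFDerivAt.sub_const _
    have h2 := (h1.hasMFDerivAt.comp p (hd.mdifferentiableAt hp).hasMFDerivAt).mfderiv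
    refine Eq.trans h2 (ContinuousLinearMap.ext fun v => ?_)
    exact congrArg ψ (c.symm_apply_apply v)

theorem IsCoordinateSystem.trans (hr : r ≠ 0) (he : IsCoordinateSystem 𝓘(ℝ, E) r e)
    {Φ : OpenPartialHomeomorph (E₁ × E₂) (E₁ × E₂)} (h : ∀ u ∈ Φ.source, ContDiffAt ℝ r Φ u)
    (h' : ∀ u ∈ Φ.target, ContDiffAt ℝ r Φ.symm u) :
    IsCoordinateSystem 𝓘(ℝ, E) r (e.trans Φ) ∧ ∀ x ∈ (e.trans Φ).source,
      components 𝓘(ℝ, E) (e.trans Φ) x = (fderiv ℝ Φ (e x)).comp (components 𝓘(ℝ, E) e x) := by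
  refine ⟨⟨fun x hx => ?_, fun u hu => ?_⟩, fun x hx => ?_⟩
  · rw [OpenPartialHomeomorph.trans_source] at hx
    exact ((h _ hx.2).contMDiffAt.comp x (he.contMDiffAt hx.1)).contMDiffWithinAt
  · rw [OpenPartialHomeomorph.trans_target] at hu
    exact ((he.contMDiffAt_symm hu.2).comp u (h' _ hu.1).contMDiffAt).contMDiffWithinAt
  · rw [OpenPartialHomeomorph.trans_source] at hx
    have h1 := ((h _ hx.2).differentiableAt hr).hasFDerivAt
    exact (h1.hasMFDerivAt.comp x
      ((he.contMDiffAt hx.1).mdifferentiableAt hr).hasMFDerivAt).mfderiv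

end Straightening

/-! ### Block diagonal coordinates around a point of the manifold. -/

section Local

universe u v w

variable {E : Type u} [NormedAddCommGroup E] [NormedSpace ℝ E] [CompleteSpace E]
  {M : Type v} [TopologicalSpace M] [ChartedSpace E M] [IsManifold 𝓘(ℝ, E) ∞ M]
  {E₁ E₂ : Type w} [NormedAddCommGroup E₁] [NormedSpace ℝ E₁] [FiniteDimensional ℝ E₁]
  [NormedAddCommGroup E₂] [NormedSpace ℝ E₂] [FiniteDimensional ℝ E₂] {r : ℕ∞ω}
  {L : OpField 𝓘(ℝ, E) M}

theorem IsCoordinateSystem.contDiffAt_coordRep (hr : r = ∞ ∨ r = ω)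
    {e : OpenPartialHomeomorph M (E₁ × E₂)} (he : IsCoordinateSystem 𝓘(ℝ, E) r e)
    {A : OpField 𝓘(ℝ, E) M} {W : Set M} (hW : IsOpen W) (hA : OpField.ContMDiffOn 𝓘(ℝ, E) r A W)
    {u : E₁ × E₂} (hu : u ∈ e.target) (huW : e.symm u ∈ W) : ContDiffAt ℝ r (coordRep e A) u :=
  (he.contDiffOn_coordRep hr hW hA).contDiffAt
    ((e.symm.isOpen_inter_preimage hW).mem_nhds ⟨hu, huW⟩)

/-- Coordinates in which a Nijenhuis operator is block diagonal. -/
theorem exists_blockDiag_coordinates [IsManifold 𝓘(ℝ, E) r M] (hr : r = ∞ ∨ r = ω)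
    (hL : IsNijenhuisOn 𝓘(ℝ, E) r L Set.univ) (p : M) (ψ : E ≃L[ℝ] E₁ × E₂)
    {A₀ : E₁ →L[ℝ] E₁} {D₀ : E₂ →L[ℝ] E₂}
    (hψ : ∀ v : E, ψ ((L p : E →L[ℝ] E) v) = (A₀ (ψ v).1, D₀ (ψ v).2)) (h : NoIntertwiner A₀ D₀)
    (h' : NoIntertwiner D₀ A₀) :
    ∃ e : OpenPartialHomeomorph M (E₁ × E₂), p ∈ e.source ∧ IsCoordinateSystem 𝓘(ℝ, E) r e ∧
      e p = 0 ∧ coordRep e L 0 = A₀.prodMap D₀ ∧ ∀ u ∈ e.target, IsBlockDiag (coordRep e L u) := by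
  have hr0 : r ≠ 0 := by rcases hr with rfl | rfl <;> simp
  have hr1 : 1 ≤ r := ENat.one_le_iff_ne_zero_withTop.2 hr0
  obtain ⟨e, hpe, he, hep, hcomp⟩ := exists_coordinateSystem (r := r) hr0 p ψ
  have h0 : (0 : E₁ × E₂) ∈ e.target := hep ▸ e.map_source hpe
  -- Stated for any coordinates with differential `ψ` at `p`, since it serves both before and after
  -- composing with `Φ`, whose derivative at `0` is the identity.
  have hval : ∀ e' : OpenPartialHomeomorph M (E₁ × E₂), p ∈ e'.source →
      IsCoordinateSystem 𝓘(ℝ, E) r e' → components 𝓘(ℝ, E) e' p = (ψ : E →L[ℝ] E₁ × E₂) →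
      coordRep e' L (e' p) = A₀.prodMap D₀ := by
    intro e' hp' he' hc'
    refine ContinuousLinearMap.ext fun w => ?_
    have h1 := he'.components_apply hr0 L hp' (ψ.symm w)
    rw [hc'] at h1
    have h2 := h1.symm.trans (hψ (ψ.symm w))
    rw [ContinuousLinearEquiv.apply_symm_apply] at h2
    have h3 : (ψ : E →L[ℝ] E₁ × E₂) (ψ.symm w) = w := ψ.apply_symm_apply w
    exact (congrArg (coordRep e' L (e' p)) h3).symm.trans h2
  have hsm : ∀ u ∈ e.target, ContDiffAt ℝ r (coordRep e L) u := fun u hu =>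
    he.contDiffAt_coordRep hr isOpen_univ hL.contMDiffOn hu (Set.mem_univ _)
  obtain ⟨Φ, hΦ0, hΦz, hΦ, hΦ', hid, hstr⟩ := exists_straightening (L := coordRep e L) hr
    (by filter_upwards [e.open_target.mem_nhds h0] with u hu using hsm u hu)
    (by
      filter_upwards [e.open_target.mem_nhds h0] with u hu ξ η
      have h1 := he.flatPairing_eq_zero_of_torsion hr hL (e.map_target hu) (Set.mem_univ _)
        (by rw [e.right_inv hu]; exact (hsm u hu).of_le hr1) ξ η
      rwa [e.right_inv hu] at h1)
    (hep ▸ hval e hpe he hcomp) h h'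
  obtain ⟨ht, htc⟩ := he.trans hr0 hΦ hΦ'
  have hpt : p ∈ (e.trans Φ).source := by
    rw [OpenPartialHomeomorph.trans_source]
    exact ⟨hpe, by rw [Set.mem_preimage, hep]; exact hΦ0⟩
  have hpt0 : (e.trans Φ) p = 0 := by
    rw [OpenPartialHomeomorph.coe_trans, Function.comp_apply, hep, hΦz]
  refine ⟨e.trans Φ, hpt, ht, hpt0, ?_, fun u hu => ?_⟩
  · rw [← hpt0]
    refine hval _ hpt ht ?_
    rw [htc p hpt, hep, hid, hcomp]
    rfl
  · have hx := (e.trans Φ).map_target hu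
    set x := (e.trans Φ).symm u with hxd
    have hux : (e.trans Φ) x = u := (e.trans Φ).right_inv hu
    have hx' := hx
    rw [OpenPartialHomeomorph.trans_source] at hx'
    have key : ∀ v, coordRep (e.trans Φ) L u (components 𝓘(ℝ, E) (e.trans Φ) x v) =
        fderiv ℝ Φ (e x) (coordRep e L (e x) (components 𝓘(ℝ, E) e x v)) := fun v => by
      rw [← hux, ← ht.components_apply hr0 L hx, htc x hx, ContinuousLinearMap.comp_apply,
        he.components_apply hr0 L hx'.1]
    have hs := hstr (e x) hx'.2
    constructor
    · intro y
      obtain ⟨v, hv⟩ := (ht.isInvertible hr0 hx).bijective.2 (0, y)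
      rw [← hv, key]
      refine (hs _).1 ?_
      rw [htc x hx, ContinuousLinearMap.comp_apply] at hv
      rw [hv]
    · intro y
      obtain ⟨v, hv⟩ := (ht.isInvertible hr0 hx).bijective.2 (y, 0)
      rw [← hv, key]
      refine (hs _).2 ?_
      rw [htc x hx, ContinuousLinearMap.comp_apply] at hv
      rw [hv]

end Local

/-! ### Shrinking to a product neighbourhood where the blocks have no intertwiners. -/

section Product

universe u v w

variable {E : Type u} [NormedAddCommGroup E] [NormedSpace ℝ E]
  {M : Type v} [TopologicalSpace M] [ChartedSpace E M]
  {E₁ E₂ : Type w} [NormedAddCommGroup E₁] [NormedSpace ℝ E₁]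
  [NormedAddCommGroup E₂] [NormedSpace ℝ E₂] {r : ℕ∞ω}

theorem IsCoordinateSystem.exists_restrict {e : OpenPartialHomeomorph M (E₁ × E₂)}
    (he : IsCoordinateSystem 𝓘(ℝ, E) r e) {s : Set (E₁ × E₂)} (hs : IsOpen s) (hse : s ⊆ e.target) :
    ∃ e' : OpenPartialHomeomorph M (E₁ × E₂), IsCoordinateSystem 𝓘(ℝ, E) r e' ∧ e'.target = s ∧
      (∀ x, e' x = e x) ∧ e'.source = e.source ∩ e ⁻¹' s ∧
      ∀ A : OpField 𝓘(ℝ, E) M, coordRep e' A = coordRep e A := by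
  have ht : (e.symm.restrOpen s hs).symm.target = s := by
    change e.target ∩ s = s
    exact Set.inter_eq_right.2 hse
  have hs' : (e.symm.restrOpen s hs).symm.source = e.source ∩ e ⁻¹' s := rfl
  refine ⟨(e.symm.restrOpen s hs).symm, ⟨?_, ?_⟩, ht, fun x => rfl, hs', fun A => rfl⟩
  · rw [hs']
    exact he.1.mono Set.inter_subset_left
  · rw [ht]
    exact he.2.mono hse

variable [CompleteSpace E] [IsManifold 𝓘(ℝ, E) ∞ M] [FiniteDimensional ℝ E₁]
  [FiniteDimensional ℝ E₂] {L : OpField 𝓘(ℝ, E) M}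

/-- Coordinates in which a Nijenhuis operator splits. -/
theorem exists_splitsOn_coordinates [IsManifold 𝓘(ℝ, E) r M] (hr : r = ∞ ∨ r = ω)
    (hL : IsNijenhuisOn 𝓘(ℝ, E) r L Set.univ) (p : M) (ψ : E ≃L[ℝ] E₁ × E₂)
    {A₀ : E₁ →L[ℝ] E₁} {D₀ : E₂ →L[ℝ] E₂}
    (hψ : ∀ v : E, ψ ((L p : E →L[ℝ] E) v) = (A₀ (ψ v).1, D₀ (ψ v).2)) (h : NoIntertwiner A₀ D₀)
    (h' : NoIntertwiner D₀ A₀) (h'' : NoIntertwiner A₀ (transposeL D₀)) :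
    ∃ (e : OpenPartialHomeomorph M (E₁ × E₂)) (U₁ : Set E₁) (U₂ : Set E₂)
      (L₁ : E₁ → E₁ →L[ℝ] E₁) (L₂ : E₂ → E₂ →L[ℝ] E₂),
      p ∈ e.source ∧ IsCoordinateSystem 𝓘(ℝ, E) r e ∧ e.target = U₁ ×ˢ U₂ ∧
      IsOpen U₁ ∧ IsOpen U₂ ∧ IsConnected U₁ ∧ IsConnected U₂ ∧
      coordRep e L (e p) = A₀.prodMap D₀ ∧ SplitsOn r (coordRep e L) L₁ L₂ U₁ U₂ ∧
      (∀ u ∈ U₁ ×ˢ U₂, ∀ ξ η, flatPairing (coordRep e L) (coordRep e L) u ξ η = 0) ∧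
      ∀ u ∈ U₁ ×ˢ U₂, NoIntertwiner (block₁ (coordRep e L u)) (block₂ (coordRep e L u)) ∧
        NoIntertwiner (block₂ (coordRep e L u)) (block₁ (coordRep e L u)) ∧
        NoIntertwiner (block₁ (coordRep e L u)) (transposeL (block₂ (coordRep e L u))) := by
  have hr0 : r ≠ 0 := by rcases hr with rfl | rfl <;> simp
  have hr1 : 1 ≤ r := ENat.one_le_iff_ne_zero_withTop.2 hr0
  obtain ⟨e₀, hp₀, he₀, hep₀, hval, hdiag⟩ := exists_blockDiag_coordinates hr hL p ψ hψ h h'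
  have h0 : (0 : E₁ × E₂) ∈ e₀.target := hep₀ ▸ e₀.map_source hp₀
  have hsm : ∀ u ∈ e₀.target, ContDiffAt ℝ r (coordRep e₀ L) u := fun u hu =>
    he₀.contDiffAt_coordRep hr isOpen_univ hL.contMDiffOn hu (Set.mem_univ _)
  have hc := (hsm 0 h0).continuousAt
  have hc₁ : ContinuousAt (fun u => block₁ (coordRep e₀ L u)) 0 :=
    (contDiff_block₁ (E₁ := E₁) (E₂ := E₂) (r := 0)).continuous.continuousAt.comp hc
  have hc₂ : ContinuousAt (fun u => block₂ (coordRep e₀ L u)) 0 :=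
    (contDiff_block₂ (E₁ := E₁) (E₂ := E₂) (r := 0)).continuous.continuousAt.comp hc
  have hc₃ : ContinuousAt (fun u => transposeL (block₂ (coordRep e₀ L u))) 0 :=
    (transposeL (E₂ := E₂)).continuous.continuousAt.comp hc₂
  have v₁ : block₁ (coordRep e₀ L 0) = A₀ := by rw [hval, block₁_prodMap]
  have v₂ : block₂ (coordRep e₀ L 0) = D₀ := by rw [hval, block₂_prodMap]
  have n₁ := (hc₁.prodMk hc₂).eventually (NoIntertwiner.eventually (by rwa [v₁, v₂]))
  have n₂ := (hc₂.prodMk hc₁).eventually (NoIntertwiner.eventually (by rwa [v₁, v₂]))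
  have n₃ := (hc₁.prodMk hc₃).eventually (NoIntertwiner.eventually (by rwa [v₁, v₂]))
  have n₀ : ∀ᶠ u in 𝓝 0, u ∈ e₀.target := e₀.open_target.mem_nhds h0
  obtain ⟨ε, hε, hball⟩ := Metric.eventually_nhds_iff_ball.1 (n₀.and (n₁.and (n₂.and n₃)))
  -- In the sup norm a ball is a product of balls, which are convex and hence connected.
  have hb : Metric.ball (0 : E₁ × E₂) ε = Metric.ball (0 : E₁) ε ×ˢ Metric.ball (0 : E₂) ε :=
    (ball_prod_same _ _ _).symm
  obtain ⟨e, he, htar, hcoe, hsrc, hrep⟩ := he₀.exists_restrict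
    (Metric.isOpen_ball (x := (0 : E₁ × E₂)) (ε := ε)) fun u hu => (hball u hu).1
  have hpe : p ∈ e.source := by
    rw [hsrc]
    exact ⟨hp₀, by rw [Set.mem_preimage, hep₀]; exact Metric.mem_ball_self hε⟩
  rw [hb] at htar hball
  have c₁ : IsConnected (Metric.ball (0 : E₁) ε) :=
    (convex_ball _ _).isConnected ⟨0, Metric.mem_ball_self hε⟩
  have c₂ : IsConnected (Metric.ball (0 : E₂) ε) :=
    (convex_ball _ _).isConnected ⟨0, Metric.mem_ball_self hε⟩
  have hN : ∀ u ∈ Metric.ball (0 : E₁) ε ×ˢ Metric.ball (0 : E₂) ε, ∀ ξ η,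
      flatPairing (coordRep e L) (coordRep e L) u ξ η = 0 := fun u hu ξ η => by
    have hu' := (hball u hu).1
    have h1 := he₀.flatPairing_eq_zero_of_torsion hr hL (e₀.map_target hu') (Set.mem_univ _)
      (by rw [e₀.right_inv hu']; exact (hsm u hu').of_le hr1) ξ η
    rwa [e₀.right_inv hu', ← hrep L] at h1
  obtain ⟨L₁, L₂, hs⟩ := exists_splitsOn_of_nijenhuis (L := coordRep e L) hr0 Metric.isOpen_ball
    Metric.isOpen_ball c₁ c₂
    (fun u hu => by rw [hrep]; exact (hsm u (hball u hu).1).contDiffWithinAt)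
    (fun u hu => by rw [hrep]; exact hdiag u (hball u hu).1) hN
    (fun u hu => by rw [hrep]; exact (hball u hu).2.1)
    (fun u hu => by rw [hrep]; exact (hball u hu).2.2.1)
  refine ⟨e, _, _, L₁, L₂, hpe, he, htar, Metric.isOpen_ball, Metric.isOpen_ball, c₁, c₂, ?_, hs,
    hN, fun u hu => ?_⟩
  · rw [hrep, hcoe, hep₀, hval]
  · rw [hrep]; exact (hball u hu).2

end Product

theorem forall_mem_of_forall_mem_source {X Y : Type*} [TopologicalSpace X] [TopologicalSpace Y]
    {e : OpenPartialHomeomorph X Y} {s : Set Y} {P : Y → Prop} (hs : s ⊆ e.target)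
    (h : ∀ x ∈ e.source ∩ e ⁻¹' s, P (e x)) : ∀ u ∈ s, P u := fun u hu => by
  have hu' := hs hu
  have h1 := h (e.symm u) ⟨e.map_target hu', by rwa [Set.mem_preimage, e.right_inv hu']⟩
  rwa [e.right_inv hu'] at h1

/-! ### The factor operators, conservation laws, symmetries and strong symmetries. -/

section Consequences

variable {E : Type*} [NormedAddCommGroup E] [NormedSpace ℝ E]
  {M : Type*} [TopologicalSpace M] [ChartedSpace E M]
  {E₁ E₂ : Type*} [NormedAddCommGroup E₁] [NormedSpace ℝ E₁]
  [NormedAddCommGroup E₂] [NormedSpace ℝ E₂] {r : ℕ∞ω}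
  {e : OpenPartialHomeomorph M (E₁ × E₂)} {L A : OpField 𝓘(ℝ, E) M}
  {L₁ A₁ : E₁ → E₁ →L[ℝ] E₁} {L₂ A₂ : E₂ → E₂ →L[ℝ] E₂} {V₁ : Set E₁} {V₂ : Set E₂}

theorem SplitsOn.isBlockDiagonalOn (hr : r ≠ 0) (he : IsCoordinateSystem 𝓘(ℝ, E) r e)
    (hA : SplitsOn r (coordRep e A) A₁ A₂ V₁ V₂) :
    IsBlockDiagonalOn 𝓘(ℝ, E) e A A₁ A₂ (e.source ∩ e ⁻¹' (V₁ ×ˢ V₂)) := by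
  rintro x ⟨hx, hxV⟩ v
  rw [he.components_apply hr A hx, hA.eq _ hxV]
  rfl

theorem SplitsOn.isNijenhuisOn (hr : r ≠ 0) (hV₁ : IsOpen V₁) (hV₂ : IsOpen V₂)
    (hV₁' : V₁.Nonempty) (hV₂' : V₂.Nonempty) {L : E₁ × E₂ → E₁ × E₂ →L[ℝ] E₁ × E₂}
    (hL : SplitsOn r L L₁ L₂ V₁ V₂)
    (hN : ∀ u ∈ V₁ ×ˢ V₂, ∀ ξ η, flatPairing L L u ξ η = 0) :
    IsNijenhuisOn 𝓘(ℝ, E₁) (M := E₁) r L₁ V₁ ∧ IsNijenhuisOn 𝓘(ℝ, E₂) (M := E₂) r L₂ V₂ := by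
  obtain ⟨a, ha⟩ := hV₁'
  obtain ⟨b, hb⟩ := hV₂'
  refine ⟨isNijenhuisOn_vectorSpace hr hV₁ hL.contDiffOn₁ fun x hx ξ η => ?_,
    isNijenhuisOn_vectorSpace hr hV₂ hL.contDiffOn₂ fun y hy ξ η => ?_⟩
  · have h := hN (x, b) ⟨hx, hb⟩ (ξ, 0) (η, 0)
    rw [hL.flatPairing_eq hL hr hV₁ hV₂ ⟨hx, hb⟩] at h
    exact congrArg Prod.fst h
  · have h := hN (a, y) ⟨ha, hy⟩ (0, ξ) (0, η)
    rw [hL.flatPairing_eq hL hr hV₁ hV₂ ⟨ha, hy⟩] at h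
    exact congrArg Prod.snd h

variable [CompleteSpace E] [IsManifold 𝓘(ℝ, E) ∞ M]

theorem SplitsOn.exists_isConservationLawOn (hr : r = ∞ ∨ r = ω)
    (he : IsCoordinateSystem 𝓘(ℝ, E) r e)
    (hV₁ : IsOpen V₁) (hV₂ : IsOpen V₂) (hV₁' : IsConnected V₁) (hV₂' : IsConnected V₂)
    (htar : V₁ ×ˢ V₂ ⊆ e.target) (hL : SplitsOn r (coordRep e L) L₁ L₂ V₁ V₂)
    (h : ∀ u ∈ V₁ ×ˢ V₂,
      NoIntertwiner (block₁ (coordRep e L u)) (transposeL (block₂ (coordRep e L u)))) {f : M → ℝ}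
    (hf : ContMDiffOn 𝓘(ℝ, E) 𝓘(ℝ, ℝ) r f (e.source ∩ e ⁻¹' (V₁ ×ˢ V₂)))
    (hc : IsConservationLawOn 𝓘(ℝ, E) L (differential 𝓘(ℝ, E) f)
      (e.source ∩ e ⁻¹' (V₁ ×ˢ V₂))) :
    ∃ (f₁ : E₁ → ℝ) (f₂ : E₂ → ℝ), ContDiffOn ℝ r f₁ V₁ ∧ ContDiffOn ℝ r f₂ V₂ ∧
      IsConservationLawOn 𝓘(ℝ, E₁) (M := E₁) L₁ (differential 𝓘(ℝ, E₁) f₁) V₁ ∧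
      IsConservationLawOn 𝓘(ℝ, E₂) (M := E₂) L₂ (differential 𝓘(ℝ, E₂) f₂) V₂ ∧
      ∀ x ∈ e.source ∩ e ⁻¹' (V₁ ×ˢ V₂), differential 𝓘(ℝ, E) f x =
        differential 𝓘(ℝ, E) (fun y => f₁ (e y).1 + f₂ (e y).2) x := by
  have hr0 : r ≠ 0 := by rcases hr with rfl | rfl <;> simp
  have hr2 : 2 ≤ r := by
    rcases hr with rfl | rfl
    · exact ENat.LEInfty.out
    · exact le_top
  have hW := e.isOpen_inter_preimage (hV₁.prod hV₂)
  have hfs : ContDiffOn ℝ r (f ∘ e.symm) (V₁ ×ˢ V₂) := by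
    refine ContMDiffOn.contDiffOn (hf.comp (he.2.mono htar) fun u hu => ?_)
    exact ⟨e.map_target (htar hu), by rwa [Set.mem_preimage, e.right_inv (htar hu)]⟩
  obtain ⟨f₁, f₂, s₁, s₂, c₁, c₂, hsum⟩ := hL.exists_of_conservationLaw hr2 hV₁ hV₂ hV₁' hV₂' h hfs
    (forall_mem_of_forall_mem_source htar fun x hx =>
      he.fderiv_symm_of_conservationLaw hr hW hf hc hx.1 hx
        (hL.differentiableAt hr0 hV₁ hV₂ hx.2).1)
  refine ⟨f₁, f₂, s₁, s₂, isConservationLawOn_vectorSpace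
    (fun x hx => (hL.contDiffOn₁.contDiffAt (hV₁.mem_nhds hx)).differentiableAt hr0)
    (fun x hx => (s₁.contDiffAt (hV₁.mem_nhds hx)).of_le hr2) c₁, isConservationLawOn_vectorSpace
    (fun x hx => (hL.contDiffOn₂.contDiffAt (hV₂.mem_nhds hx)).differentiableAt hr0)
    (fun x hx => (s₂.contDiffAt (hV₂.mem_nhds hx)).of_le hr2) c₂, fun x hx => ?_⟩
  have d₁ := (((s₁.contDiffAt (hV₁.mem_nhds hx.2.1)).differentiableAt hr0).hasFDerivAt.comp (e x)
    hasFDerivAt_fst).add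
    (((s₂.contDiffAt (hV₂.mem_nhds hx.2.2)).differentiableAt hr0).hasFDerivAt.comp (e x)
    hasFDerivAt_snd)
  have d₀ := (hfs.contDiffAt ((hV₁.prod hV₂).mem_nhds hx.2)).differentiableAt hr0
  rw [he.differential_eq hr0 hx.1 (g := f) d₀ (by
      filter_upwards [e.open_source.mem_nhds hx.1] with y hy
      rw [Function.comp_apply, e.left_inv hy]),
    he.differential_eq hr0 hx.1 (g := fun y => f₁ (e y).1 + f₂ (e y).2) d₁.differentiableAt
      (Eventually.of_forall fun _ => rfl), d₁.fderiv]
  congr 1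
  exact ContinuousLinearMap.ext fun v => hsum _ hx.2 v

variable [FiniteDimensional ℝ E₁] [FiniteDimensional ℝ E₂]

theorem IsCoordinateSystem.contDiffOn_coordRep_prod (hr : r = ∞ ∨ r = ω)
    (he : IsCoordinateSystem 𝓘(ℝ, E) r e) (hV₁ : IsOpen V₁) (hV₂ : IsOpen V₂)
    (htar : V₁ ×ˢ V₂ ⊆ e.target)
    (hA : OpField.ContMDiffOn 𝓘(ℝ, E) r A (e.source ∩ e ⁻¹' (V₁ ×ˢ V₂))) :
    ContDiffOn ℝ r (coordRep e A) (V₁ ×ˢ V₂) :=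
  (he.contDiffOn_coordRep hr (e.isOpen_inter_preimage (hV₁.prod hV₂)) hA).mono fun u hu =>
    ⟨htar hu, e.map_target (htar hu), by rwa [Set.mem_preimage, e.right_inv (htar hu)]⟩

theorem SplitsOn.exists_isSymmetryOn (hr : r = ∞ ∨ r = ω) (he : IsCoordinateSystem 𝓘(ℝ, E) r e)
    (hV₁ : IsOpen V₁) (hV₂ : IsOpen V₂) (hV₁' : IsConnected V₁) (hV₂' : IsConnected V₂)
    (htar : V₁ ×ˢ V₂ ⊆ e.target) (hL : SplitsOn r (coordRep e L) L₁ L₂ V₁ V₂)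
    (h : ∀ u ∈ V₁ ×ˢ V₂, NoIntertwiner (block₁ (coordRep e L u)) (block₂ (coordRep e L u)))
    (h' : ∀ u ∈ V₁ ×ˢ V₂, NoIntertwiner (block₂ (coordRep e L u)) (block₁ (coordRep e L u)))
    (hA : IsSymmetryOn 𝓘(ℝ, E) r L A (e.source ∩ e ⁻¹' (V₁ ×ˢ V₂))) :
    ∃ (A₁ : OpField 𝓘(ℝ, E₁) E₁) (A₂ : OpField 𝓘(ℝ, E₂) E₂),
      IsSymmetryOn 𝓘(ℝ, E₁) (M := E₁) r L₁ A₁ V₁ ∧ IsSymmetryOn 𝓘(ℝ, E₂) (M := E₂) r L₂ A₂ V₂ ∧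
      IsBlockDiagonalOn 𝓘(ℝ, E) e A A₁ A₂ (e.source ∩ e ⁻¹' (V₁ ×ˢ V₂)) := by
  have hr0 : r ≠ 0 := by rcases hr with rfl | rfl <;> simp
  have hr1 : 1 ≤ r := ENat.one_le_iff_ne_zero_withTop.2 hr0
  have hAs := he.contDiffOn_coordRep_prod hr hV₁ hV₂ htar hA.contMDiffOn
  have hd : ∀ {B : E₁ × E₂ → E₁ × E₂ →L[ℝ] E₁ × E₂}, ContDiffOn ℝ r B (V₁ ×ˢ V₂) →
      ∀ u ∈ V₁ ×ˢ V₂, ContDiffAt ℝ 1 B u := fun hB u hu =>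
    (hB.contDiffAt ((hV₁.prod hV₂).mem_nhds hu)).of_le hr1
  have hp : ∀ u ∈ V₁ ×ˢ V₂, ∀ ξ, flatPairing (coordRep e L) (coordRep e A) u ξ ξ = 0 :=
    forall_mem_of_forall_mem_source htar fun x hx =>
      he.flatPairing_self_eq_zero_of_symmetry hr hA hx.1 hx (hd hL.contDiffOn _ hx.2) (hd hAs _ hx.2)
  obtain ⟨A₁, A₂, hs, hc₁, hc₂⟩ := hL.exists_of_symmetry hr0 hV₁ hV₂ hV₁' hV₂' h h' hAs
    (forall_mem_of_forall_mem_source htar fun x hx => he.coordRep_comm hr0 hx.1 (hA.comm x hx)) hp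
  obtain ⟨a, ha⟩ := hV₁'.1
  obtain ⟨b, hb⟩ := hV₂'.1
  refine ⟨A₁, A₂, isSymmetryOn_vectorSpace hr0 hV₁ hL.contDiffOn₁ hs.contDiffOn₁ hc₁ fun x hx ξ => ?_,
    isSymmetryOn_vectorSpace hr0 hV₂ hL.contDiffOn₂ hs.contDiffOn₂ hc₂ fun y hy ξ => ?_,
    hs.isBlockDiagonalOn hr0 he⟩
  · have h := hp (x, b) ⟨hx, hb⟩ (ξ, 0)
    rw [hL.flatPairing_eq hs hr0 hV₁ hV₂ ⟨hx, hb⟩] at h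
    exact congrArg Prod.fst h
  · have h := hp (a, y) ⟨ha, hy⟩ (0, ξ)
    rw [hL.flatPairing_eq hs hr0 hV₁ hV₂ ⟨ha, hy⟩] at h
    exact congrArg Prod.snd h

theorem SplitsOn.exists_isStrongSymmetryOn (hr : r = ∞ ∨ r = ω)
    (he : IsCoordinateSystem 𝓘(ℝ, E) r e)
    (hV₁ : IsOpen V₁) (hV₂ : IsOpen V₂) (hV₁' : IsConnected V₁) (hV₂' : IsConnected V₂)
    (htar : V₁ ×ˢ V₂ ⊆ e.target) (hL : SplitsOn r (coordRep e L) L₁ L₂ V₁ V₂)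
    (h : ∀ u ∈ V₁ ×ˢ V₂, NoIntertwiner (block₁ (coordRep e L u)) (block₂ (coordRep e L u)))
    (h' : ∀ u ∈ V₁ ×ˢ V₂, NoIntertwiner (block₂ (coordRep e L u)) (block₁ (coordRep e L u)))
    (hA : IsStrongSymmetryOn 𝓘(ℝ, E) r L A (e.source ∩ e ⁻¹' (V₁ ×ˢ V₂))) :
    ∃ (A₁ : OpField 𝓘(ℝ, E₁) E₁) (A₂ : OpField 𝓘(ℝ, E₂) E₂),
      IsStrongSymmetryOn 𝓘(ℝ, E₁) (M := E₁) r L₁ A₁ V₁ ∧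
      IsStrongSymmetryOn 𝓘(ℝ, E₂) (M := E₂) r L₂ A₂ V₂ ∧
      IsBlockDiagonalOn 𝓘(ℝ, E) e A A₁ A₂ (e.source ∩ e ⁻¹' (V₁ ×ˢ V₂)) := by
  have hr0 : r ≠ 0 := by rcases hr with rfl | rfl <;> simp
  have hr1 : 1 ≤ r := ENat.one_le_iff_ne_zero_withTop.2 hr0
  have hAs := he.contDiffOn_coordRep_prod hr hV₁ hV₂ htar hA.contMDiffOn
  have hd : ∀ {B : E₁ × E₂ → E₁ × E₂ →L[ℝ] E₁ × E₂}, ContDiffOn ℝ r B (V₁ ×ˢ V₂) →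
      ∀ u ∈ V₁ ×ˢ V₂, ContDiffAt ℝ 1 B u := fun hB u hu =>
    (hB.contDiffAt ((hV₁.prod hV₂).mem_nhds hu)).of_le hr1
  have hp : ∀ u ∈ V₁ ×ˢ V₂, ∀ ξ η, flatPairing (coordRep e A) (coordRep e L) u ξ η = 0 :=
    forall_mem_of_forall_mem_source htar fun x hx =>
      he.flatPairing_eq_zero_of_strongSymmetry hr hA hx.1 hx (hd hL.contDiffOn _ hx.2)
        (hd hAs _ hx.2)
  obtain ⟨A₁, A₂, hs, hc₁, hc₂⟩ := hL.exists_of_symmetry hr0 hV₁ hV₂ hV₁' hV₂' h h' hAs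
    (forall_mem_of_forall_mem_source htar fun x hx =>
      he.coordRep_comm hr0 hx.1 (hA.comm x hx).symm)
    -- The definitions of symmetry and strong symmetry take the two operators in opposite order;
    -- antisymmetry reconciles them.
    fun u hu ξ => by rw [flatPairing_swap, hp u hu, neg_zero]
  obtain ⟨a, ha⟩ := hV₁'.1
  obtain ⟨b, hb⟩ := hV₂'.1
  refine ⟨A₁, A₂,
    isStrongSymmetryOn_vectorSpace hr0 hV₁ hL.contDiffOn₁ hs.contDiffOn₁ hc₁ fun x hx ξ η => ?_,
    isStrongSymmetryOn_vectorSpace hr0 hV₂ hL.contDiffOn₂ hs.contDiffOn₂ hc₂ fun y hy ξ η => ?_,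
    hs.isBlockDiagonalOn hr0 he⟩
  · have h := hp (x, b) ⟨hx, hb⟩ (ξ, 0) (η, 0)
    rw [hs.flatPairing_eq hL hr0 hV₁ hV₂ ⟨hx, hb⟩] at h
    exact congrArg Prod.fst h
  · have h := hp (a, y) ⟨ha, hy⟩ (0, ξ) (0, η)
    rw [hs.flatPairing_eq hL hr0 hV₁ hV₂ ⟨ha, hy⟩] at h
    exact congrArg Prod.snd h

end Consequences

end NijenhuisSplitting

end

/-! ### The splitting theorem. -/

open NijenhuisSplitting in
theorem theorem1p1 (r : ℕ∞ω) (hr : r = ∞ ∨ r = ω)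
    (n : ℕ) {M : Type*} [TopologicalSpace M] [ChartedSpace (EuclideanSpace ℝ (Fin n)) M]
    [IsManifold (𝓡 n) ∞ M] [IsManifold (𝓡 n) r M]
    (L : OpField (𝓡 n) M) (hL : IsNijenhuisOn (𝓡 n) r L Set.univ) (p : M)
    (χ₁ χ₂ : Polynomial ℝ) (hχ₁ : χ₁.Monic) (hχ₂ : χ₂.Monic) (hχ : IsCoprime χ₁ χ₂)
    (hLχ : charpolyAt (𝓡 n) L p = χ₁ * χ₂)
    (m₁ m₂ : ℕ) (hm₁ : m₁ = χ₁.natDegree) (hm₂ : m₂ = χ₂.natDegree) :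
    ∃ (e : OpenPartialHomeomorph M (EuclideanSpace ℝ (Fin m₁) × EuclideanSpace ℝ (Fin m₂)))
      (U₁ : Set (EuclideanSpace ℝ (Fin m₁))) (U₂ : Set (EuclideanSpace ℝ (Fin m₂))),
      p ∈ e.source ∧ IsCoordinateSystem (𝓡 n) r e ∧
      e.target = U₁ ×ˢ U₂ ∧ IsOpen U₁ ∧ IsOpen U₂ ∧ IsConnected U₁ ∧ IsConnected U₂ ∧
      ∃ (L₁ : OpField (𝓡 m₁) (EuclideanSpace ℝ (Fin m₁)))
        (L₂ : OpField (𝓡 m₂) (EuclideanSpace ℝ (Fin m₂))),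
        -- the splitting of `L`
        (IsNijenhuisOn (𝓡 m₁) r L₁ U₁ ∧ IsNijenhuisOn (𝓡 m₂) r L₂ U₂ ∧
          IsBlockDiagonalOn (𝓡 n) e L L₁ L₂ e.source ∧
          charpolyAt (𝓡 m₁) L₁ (e p).1 = χ₁ ∧ charpolyAt (𝓡 m₂) L₂ (e p).2 = χ₂) ∧
        -- objects defined on the whole coordinate neighbourhood (`V₁ = U₁`, `V₂ = U₂`)
        -- or only on a smaller product domain
        ∀ (V₁ : Set (EuclideanSpace ℝ (Fin m₁))) (V₂ : Set (EuclideanSpace ℝ (Fin m₂))),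
          V₁ ⊆ U₁ → V₂ ⊆ U₂ → IsOpen V₁ → IsOpen V₂ → IsConnected V₁ → IsConnected V₂ →
          -- conservation laws
          (∀ f : M → ℝ, ContMDiffOn (𝓡 n) 𝓘(ℝ, ℝ) r f (e.source ∩ e ⁻¹' (V₁ ×ˢ V₂)) →
            IsConservationLawOn (𝓡 n) L (differential (𝓡 n) f)
              (e.source ∩ e ⁻¹' (V₁ ×ˢ V₂)) →
            ∃ (f₁ : EuclideanSpace ℝ (Fin m₁) → ℝ) (f₂ : EuclideanSpace ℝ (Fin m₂) → ℝ),
              ContDiffOn ℝ r f₁ V₁ ∧ ContDiffOn ℝ r f₂ V₂ ∧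
              IsConservationLawOn (𝓡 m₁) L₁ (differential (𝓡 m₁) f₁) V₁ ∧
              IsConservationLawOn (𝓡 m₂) L₂ (differential (𝓡 m₂) f₂) V₂ ∧
              ∀ x ∈ e.source ∩ e ⁻¹' (V₁ ×ˢ V₂), differential (𝓡 n) f x =
                differential (𝓡 n) (fun y => f₁ (e y).1 + f₂ (e y).2) x) ∧
          -- symmetries
          (∀ A : OpField (𝓡 n) M,
            IsSymmetryOn (𝓡 n) r L A (e.source ∩ e ⁻¹' (V₁ ×ˢ V₂)) →
            ∃ (A₁ : OpField (𝓡 m₁) (EuclideanSpace ℝ (Fin m₁)))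
              (A₂ : OpField (𝓡 m₂) (EuclideanSpace ℝ (Fin m₂))),
              IsSymmetryOn (𝓡 m₁) r L₁ A₁ V₁ ∧ IsSymmetryOn (𝓡 m₂) r L₂ A₂ V₂ ∧
              IsBlockDiagonalOn (𝓡 n) e A A₁ A₂ (e.source ∩ e ⁻¹' (V₁ ×ˢ V₂))) ∧
          -- strong symmetries
          (∀ A : OpField (𝓡 n) M,
            IsStrongSymmetryOn (𝓡 n) r L A (e.source ∩ e ⁻¹' (V₁ ×ˢ V₂)) →
            ∃ (A₁ : OpField (𝓡 m₁) (EuclideanSpace ℝ (Fin m₁)))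
              (A₂ : OpField (𝓡 m₂) (EuclideanSpace ℝ (Fin m₂))),
              IsStrongSymmetryOn (𝓡 m₁) r L₁ A₁ V₁ ∧ IsStrongSymmetryOn (𝓡 m₂) r L₂ A₂ V₂ ∧
              IsBlockDiagonalOn (𝓡 n) e A A₁ A₂ (e.source ∩ e ⁻¹' (V₁ ×ˢ V₂))) := by
  have hr0 : r ≠ 0 := by rcases hr with rfl | rfl <;> simp
  obtain ⟨ψ, A₀, D₀, hψ, hA₀, hD₀⟩ := exists_prodMap_of_charpoly_eq_mul
    (V := EuclideanSpace ℝ (Fin n)) (E₁ := EuclideanSpace ℝ (Fin m₁))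
    (E₂ := EuclideanSpace ℝ (Fin m₂)) hχ₁ hχ hLχ
    (by rw [finrank_euclideanSpace_fin, hm₁]) (by rw [finrank_euclideanSpace_fin, hm₂])
  have hA : Polynomial.aeval A₀ χ₁ = 0 := hA₀ ▸ A₀.aeval_self_charpoly
  have hD : Polynomial.aeval D₀ χ₂ = 0 := hD₀ ▸ D₀.aeval_self_charpoly
  obtain ⟨e, U₁, U₂, L₁, L₂, hpe, he, htar, hU₁, hU₂, hU₁', hU₂', hval, hs, hN, hI⟩ :=
    exists_splitsOn_coordinates hr hL p ψ.toContinuousLinearEquiv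
      (A₀ := LinearMap.toContinuousLinearMap A₀) (D₀ := LinearMap.toContinuousLinearMap D₀) hψ
      (noIntertwiner_of_isCoprime hχ hA hD) (noIntertwiner_of_isCoprime hχ.symm hD hA)
      (noIntertwiner_of_isCoprime hχ hA (aeval_transposeL hD))
  have hpU : e p ∈ U₁ ×ˢ U₂ := htar ▸ e.map_source hpe
  -- Comparing the two block forms of `L` at `p` identifies the factors there with `A₀` and `D₀`,
  -- hence their characteristic polynomials with `χ₁` and `χ₂`.
  have hpL := (hs.eq _ hpU).symm.trans hval
  have hb : IsBlockDiagonalOn (𝓡 n) e L L₁ L₂ e.source := fun x hx =>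
    hs.isBlockDiagonalOn hr0 he x ⟨hx, htar ▸ e.map_source hx⟩
  obtain ⟨hN₁, hN₂⟩ := hs.isNijenhuisOn hr0 hU₁ hU₂ hU₁'.1 hU₂'.1 hN
  have hc₁ : L₁ (e p).1 = LinearMap.toContinuousLinearMap A₀ := congrArg block₁ hpL
  have hc₂ : L₂ (e p).2 = LinearMap.toContinuousLinearMap D₀ := congrArg block₂ hpL
  refine ⟨e, U₁, U₂, hpe, he, htar, hU₁, hU₂, hU₁', hU₂', L₁, L₂, ⟨hN₁, hN₂, hb, ?_, ?_⟩, ?_⟩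
  · exact (congrArg (fun T : _ →L[ℝ] _ => T.toLinearMap.charpoly) hc₁).trans hA₀
  · exact (congrArg (fun T : _ →L[ℝ] _ => T.toLinearMap.charpoly) hc₂).trans hD₀
  · intro V₁ V₂ h₁ h₂ hV₁ hV₂ hV₁' hV₂'
    have hsub := Set.prod_mono h₁ h₂
    have ht : V₁ ×ˢ V₂ ⊆ e.target := htar ▸ hsub
    have hs' := hs.mono h₁ h₂
    exact ⟨fun f hf hc => hs'.exists_isConservationLawOn hr he hV₁ hV₂ hV₁' hV₂' ht
        (fun u hu => (hI u (hsub hu)).2.2) hf hc,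
      fun A hA => hs'.exists_isSymmetryOn hr he hV₁ hV₂ hV₁' hV₂' ht
        (fun u hu => (hI u (hsub hu)).1) (fun u hu => (hI u (hsub hu)).2.1) hA,
      fun A hA => hs'.exists_isStrongSymmetryOn hr he hV₁ hV₂ hV₁' hV₂' ht
        (fun u hu => (hI u (hsub hu)).1) (fun u hu => (hI u (hsub hu)).2.1) hA⟩
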